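/- Theorem. Conventions. Let $\mathbb{R}^3_+=\{(x_1,x_2,x_3,0)\in\mathbb{R}^4: x_3\ge 0\}$ with boundary plane $\mathbb{R}^2=\{x_3=x_4=0\}$, let $R_\theta$ be the rotation of $\mathbb{R}^4$ about $\mathbb{R}^2$, so that $R_\theta(x_1,x_2,x_3,0)=(x_1,x_2,x_3\cos\theta,x_3\sin\theta)$, and let $\mathrm{Spin}(A)=\{R_\theta(x):x\in A,\ 0\le\theta\le 2\pi\}$ for $A\subset\mathbb{R}^3_+$. A *pearl* is a round 3-sphere in $\mathbb{R}^4$; the closed round 4-ball it bounds is the *solid pearl*. Two pearls are *orthogonal* if the square of the distance between their centers is the sum of the squares of their radii. An *arc* is an embedded arc in $\mathbb{R}^3_+$ meeting $\mathbb{R}^2$ exactly in its two end-points. It is *spinnable* if it is smoothly embedded and has contact of infinite order with the normal line of $\mathbb{R}^2$ at both end-points. It is a *trefoil arc* if its union with the straight segment joining its end-points is a trefoil knot (of either handedness) in $\mathbb{R}^3$. A *semi-pearl necklace subordinate to $A$* is a sequence of pearls $\Sigma^0,\dots,\Sigma^{m}$ with solid pearls $B^0,\dots,B^m$ such that: the end-points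 of $A$ are the centers of $B^0$ and $B^m$; $A\subset\bigcup_k B^k$; consecutive pearls are orthogonal and non-consecutive solid pearls are disjoint; and for every $k$, $A\cap B^k$ is an unknotted arc in the 3-ball $B^k\cap\mathbb{R}^3_+$ (the pair is homeomorphic to the unit ball with a diameter). Given pearls $\Sigma^0,\dots,\Sigma^{l+1}$, put $\Sigma^k_i=R_{2\pi i/6}(\Sigma^k)$ and $B^k_i=R_{2\pi i/6}(B^k)$ for $1\le k\le l$ and $i\in\mathbb{Z}/6$. Together with pearls $P^k_i$ ($1\le k<l$, $i\in\mathbb{Z}/6$) they form a *pearl-necklace subordinate to $\mathrm{Spin}(A)$* if: 1. $\Sigma^0,\dots,\Sigma^{l+1}$ is a semi-pearl necklace subordinate to $A$, and $\Sigma^k_i$ is orthogonal to $\Sigma^k_{i+1}$ for $1\le k\le l$ and all $i$; 2. for all $i$, the pearl $\Sigma^0$ at one pole is orthogonal to $\Sigma^1_i$ with $\Sigma^0\cap\Sigma^1_i\cap\Sigma^1_{i+1}\ne\emptyset$, and the pearl $\Sigma^{l+1}$ at the other pole is orthogonal to $\Sigma^l_i$ with $\Sigma^{l+1}\cap\Sigma^l_i\cap\Sigma^l_{i+1}\neq\emptyset$;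 3. for $1\le k<l$ and all $i$, the four pearls $\Sigma^k_i,\Sigma^{k+1}_i,\Sigma^k_{i+1},\Sigma^{k+1}_{i+1}$ meet in exactly one point; the pearl $P^k_i$ passes through this point and is orthogonal to these four pearls, and the solid pearl of $P^k_i$ is disjoint from all other solid pearls $B^r_s$, from $B^0$ and $B^{l+1}$, and from the solid pearls of all the other $P^r_s$; 4. for $1\le k\le l$ and all $i$, $B^k_i\cap\mathrm{Spin}(A)$ is an unknotted disk in $B^k_i$ (the pair is homeomorphic to the unit 4-ball with a flat 2-disk through its center). Claim. There are points $c_0,\dots,c_{86}\in\mathbb{R}^3_+$, pearls $\Sigma^0,\dots,\Sigma^{86}$ with centers $c_0,\dots,c_{86}$, and pearls $P^k_i$ ($1\le k<85$, $i\in\mathbb{Z}/6$) such that: (a) all coordinates of the $c_k$ and all radii of the $\Sigma^k$ are algebraic over $\mathbb{Q}$; (b) for $1\le k\le 85$ the coordinates of $c_k$ and the radius of $\Sigma^k$ agree, up to an error of at most $1/100$, with an explicit decimal table of 85 centers and radii (listed in full in the formal statement); the centers for $k=76,77,78$ are exactly the rational points $(3611.943,-100,1000,0)$, $(2611.943,-100,1000,0)$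 and $(1611.943,-100,1000,0)$, with radius $1000/\sqrt2$; and $c_0$, $c_{86}$ are the orthogonal projections of $c_1$, $c_{85}$ to $\mathbb{R}^2$; (c) the polygonal line through $c_0,c_1,\dots,c_{86}$ is a trefoil arc $A$, and $\Sigma^0,\dots,\Sigma^{86}$ with the $P^k_i$ form a pearl-necklace ($l=85$) subordinate to $\mathrm{Spin}(A)$; in particular $\Sigma^0,\dots,\Sigma^{86}$ is a semi-pearl necklace subordinate to $A$; (d) there is also a spinnable trefoil arc $A'$ from $c_0$ to $c_{86}$ such that the same pearls form a pearl-necklace subordinate to $\mathrm{Spin}(A')$. -/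

import Mathlib

open Set Filter Topology Asymptotics
open scoped ContDiff

/-- Euclidean three-space. -/
abbrev E3 : Type := EuclideanSpace ℝ (Fin 3)

/-- Euclidean four-space. -/
abbrev E4 : Type := EuclideanSpace ℝ (Fin 4)

/-- The inclusion of three-space into four-space as the hyperplane `x₄ = 0`.  It identifies
`{x : E3 | 0 ≤ x 2}` with the half-space `ℝ³₊`, whose boundary plane is `{x | x 2 = 0}`. -/
noncomputable def toFour (x : E3) : E4 := !₂[x 0, x 1, x 2, 0]

/-- The rotation of four-space by the angle `θ` that fixes the plane `x₃ = x₄ = 0`.  On the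
half-space it is `(x₁, x₂, x₃, 0) ↦ (x₁, x₂, x₃ cos θ, x₃ sin θ)`. -/
noncomputable def spinRot (θ : ℝ) (x : E4) : E4 :=
  !₂[x 0, x 1, x 2 * Real.cos θ - x 3 * Real.sin θ, x 2 * Real.sin θ + x 3 * Real.cos θ]

/-- The set `Spin(A)` obtained by spinning a subset `A` of the half-space. -/
def spinSet (A : Set E3) : Set E4 :=
  {y | ∃ x ∈ A, ∃ θ ∈ Icc (0 : ℝ) (2 * Real.pi), y = spinRot θ (toFour x)}

/-! ### Arcs in the half-space -/

/-- `γ` restricted to `[0, 1]` is an injective parametrization of `A`, running from `a` to `b`, with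
end-points in the boundary plane and interior in the open half-space. -/
structure ParametrizesArc (γ : ℝ → E3) (A : Set E3) (a b : E3) : Prop where
  continuousOn : ContinuousOn γ (Icc 0 1)
  injOn : InjOn γ (Icc 0 1)
  image_eq : γ '' Icc 0 1 = A
  start_eq : γ 0 = a
  end_eq : γ 1 = b
  start_mem : a 2 = 0
  end_mem : b 2 = 0
  interior_pos : ∀ t ∈ Ioo (0 : ℝ) 1, 0 < γ t 2

/-- `A` is an embedded arc in the half-space from `a` to `b`, meeting the boundary plane exactly
in these end-points. -/
def IsHalfSpaceArc (A : Set E3) (a b : E3) : Prop := ∃ γ, ParametrizesArc γ A a b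

/-- At the parameter `s`, the curve `γ : [0, 1] → E3` has contact of infinite order with the normal
of the boundary plane through `γ s`: its horizontal deviation vanishes to infinite order. -/
def InfiniteContactWithNormal (γ : ℝ → E3) (s : ℝ) : Prop :=
  ∀ n : ℕ, (fun t => γ t 0 - γ s 0) =o[𝓝[Icc 0 1] s] (fun t => (t - s) ^ n) ∧
    (fun t => γ t 1 - γ s 1) =o[𝓝[Icc 0 1] s] (fun t => (t - s) ^ n)

/-- A spinnable arc: a smoothly embedded arc in the half-space having contact of infinite order with
the normal at both end-points. -/
def IsSpinnableArc (A : Set E3) (a b : E3) : Prop :=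
  ∃ γ, ParametrizesArc γ A a b ∧ ContDiffOn ℝ ∞ γ (Icc 0 1) ∧
    (∀ t ∈ Icc (0 : ℝ) 1, derivWithin γ (Icc 0 1) t ≠ 0) ∧
    InfiniteContactWithNormal γ 0 ∧ InfiniteContactWithNormal γ 1

/-- The polygonal line with vertices `v 0, v 1, …, v m`. -/
def polygonalArc (v : ℕ → E3) (m : ℕ) : Set E3 :=
  ⋃ k ∈ Finset.range m, segment ℝ (v k) (v (k + 1))

/-- The standard trefoil: the `(2, 3)` torus knot on the torus with radii `2` and `1`. -/
def standardTrefoil : Set E3 :=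
  range fun t : ℝ => !₂[(2 + Real.cos (3 * t)) * Real.cos (2 * t),
    (2 + Real.cos (3 * t)) * Real.sin (2 * t), Real.sin (3 * t)]

/-- A trefoil knot (of either handedness): the image of the standard trefoil under a homeomorphism
of three-space. -/
def IsTrefoilKnot (K : Set E3) : Prop := ∃ h : E3 ≃ₜ E3, h '' standardTrefoil = K

/-- An arc with end-points `a, b` in the boundary plane is a trefoil arc if closing it up by the
straight segment between its end-points, which lies in that plane, gives a trefoil knot. -/
def IsTrefoilArc (A : Set E3) (a b : E3) : Prop := IsTrefoilKnot (A ∪ segment ℝ a b)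

/-- `(D, X ∩ D)` is an unknotted (trivial) pair consisting of an `n`-ball and an `m`-ball properly
embedded in it: it is homeomorphic to the unit ball of `ℝⁿ` with its intersection with
`ℝᵐ × {0}`.  For `m = 1` and `m = 2` this says that `X ∩ D` is an unknotted arc, respectively an
unknotted disk, in `D`. -/
def IsTrivialBallPair {n : ℕ} (m : ℕ) (D X : Set (EuclideanSpace ℝ (Fin n))) : Prop :=
  ∃ f : D ≃ₜ Metric.closedBall (0 : EuclideanSpace ℝ (Fin n)) 1,
    ∀ x : D, (x : EuclideanSpace ℝ (Fin n)) ∈ X ↔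
      ∀ i : Fin n, m ≤ (i : ℕ) → (f x : EuclideanSpace ℝ (Fin n)) i = 0

/-! ### Pearls -/

/-- A pearl, given by the center and the radius of a round 3-sphere in four-space. -/
structure Pearl where
  center : E4
  radius : ℝ
  radius_pos : 0 < radius

namespace Pearl

/-- The round 3-sphere of a pearl. -/
def sphere (P : Pearl) : Set E4 := Metric.sphere P.center P.radius

/-- The solid pearl: the closed round 4-ball bounded by the pearl. -/
def solid (P : Pearl) : Set E4 := Metric.closedBall P.center P.radius

/-- Two pearls are orthogonal if the square of the distance between their centers is the sum of the
squares of their radii. -/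
def Orthogonal (P Q : Pearl) : Prop :=
  dist P.center Q.center ^ 2 = P.radius ^ 2 + Q.radius ^ 2

/-- The image of a pearl under the rotation by `θ`. -/
noncomputable def rotate (θ : ℝ) (P : Pearl) : Pearl := ⟨spinRot θ P.center, P.radius, P.radius_pos⟩

end Pearl

/-- The pearls `S 0, …, S m` form a semi-pearl necklace subordinate to the arc `A` from `a` to `b`.
In the last field, the 3-ball in which the segment of `A` is unknotted is the part of the solid
pearl in the half-space `ℝ³₊` (a half-ball for the two end pearls). -/
structure IsSemiPearlNecklace (A : Set E3) (a b : E3) (m : ℕ) (S : ℕ → Pearl) : Prop where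
  center_first : (S 0).center = toFour a
  center_last : (S m).center = toFour b
  covers : ∀ x ∈ A, ∃ k ≤ m, toFour x ∈ (S k).solid
  orthogonal : ∀ k < m, (S k).Orthogonal (S (k + 1))
  disjoint : ∀ j k, j + 1 < k → k ≤ m → Disjoint (S j).solid (S k).solid
  unknotted : ∀ k ≤ m, IsTrivialBallPair 1 {x : E3 | 0 ≤ x 2 ∧ toFour x ∈ (S k).solid} A

/-- The pearl of latitude `k` on the meridian `i`, with `i` taken modulo `6`: the copy of `S k`
rotated by `2 π i / 6`. -/
noncomputable def meridianPearl (S : ℕ → Pearl) (k : ℕ) (i : ZMod 6) : Pearl :=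
  (S k).rotate (2 * Real.pi * (i.val : ℝ) / 6)

/-- The pearl-necklace subordinate to the spun knot of `A`, built from the pearls
`S 0, …, S (l + 1)`.  It consists of
* the pearls `meridianPearl S k i` with `1 ≤ k ≤ l` and `i` modulo `6`,
* the two pearls `S 0` and `S (l + 1)` centered at the poles (a pearl centered at a pole and
  orthogonal to the neighbouring pearls is necessarily the corresponding end pearl),
* the pearls `P k i` with `1 ≤ k < l` and `i` modulo `6`, one at each point where the four pearls
  with latitudes `k, k + 1` and meridians `i, i + 1` meet. -/
structure IsPearlNecklace (A : Set E3) (a b : E3) (l : ℕ) (S : ℕ → Pearl)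
    (P : ℕ → ZMod 6 → Pearl) : Prop where
  semi : IsSemiPearlNecklace A a b (l + 1) S
  orthogonal_meridian : ∀ k, 1 ≤ k → k ≤ l → ∀ i : ZMod 6,
    (meridianPearl S k i).Orthogonal (meridianPearl S k (i + 1))
  pole_first : ∀ i : ZMod 6, (S 0).Orthogonal (meridianPearl S 1 i) ∧
    ((S 0).sphere ∩ (meridianPearl S 1 i).sphere ∩ (meridianPearl S 1 (i + 1)).sphere).Nonempty
  pole_last : ∀ i : ZMod 6, (S (l + 1)).Orthogonal (meridianPearl S l i) ∧
    ((S (l + 1)).sphere ∩ (meridianPearl S l i).sphere ∩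
      (meridianPearl S l (i + 1)).sphere).Nonempty
  joint : ∀ k, 1 ≤ k → k < l → ∀ i : ZMod 6, ∃ p : E4,
    (meridianPearl S k i).sphere ∩ (meridianPearl S (k + 1) i).sphere ∩
      (meridianPearl S k (i + 1)).sphere ∩ (meridianPearl S (k + 1) (i + 1)).sphere = {p} ∧
    p ∈ (P k i).sphere
  joint_orthogonal : ∀ k, 1 ≤ k → k < l → ∀ i : ZMod 6,
    (P k i).Orthogonal (meridianPearl S k i) ∧
    (P k i).Orthogonal (meridianPearl S (k + 1) i) ∧
    (P k i).Orthogonal (meridianPearl S k (i + 1)) ∧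
    (P k i).Orthogonal (meridianPearl S (k + 1) (i + 1))
  joint_disjoint_meridian : ∀ k, 1 ≤ k → k < l → ∀ i : ZMod 6, ∀ r, 1 ≤ r → r ≤ l → ∀ s : ZMod 6,
    ¬ ((r = k ∨ r = k + 1) ∧ (s = i ∨ s = i + 1)) →
      Disjoint (P k i).solid (meridianPearl S r s).solid
  joint_disjoint_pole : ∀ k, 1 ≤ k → k < l → ∀ i : ZMod 6,
    Disjoint (P k i).solid (S 0).solid ∧ Disjoint (P k i).solid (S (l + 1)).solid
  joint_disjoint_joint : ∀ k, 1 ≤ k → k < l → ∀ i : ZMod 6, ∀ r, 1 ≤ r → r < l → ∀ s : ZMod 6,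
    (k, i) ≠ (r, s) → Disjoint (P k i).solid (P r s).solid
  unknotted_disk : ∀ k, 1 ≤ k → k ≤ l → ∀ i : ZMod 6,
    IsTrivialBallPair 2 (meridianPearl S k i).solid (spinSet A)

/-! ### The explicit pearls -/

/-- The decimal table of the 85 pearls: the first three coordinates of the center, then the radius.
The fourth coordinate of each center is `0`. -/
def pearlTable : List (ℚ × ℚ × ℚ × ℚ) :=
  [(2426.06421, 2296.89168, 0.75966995, 0.537167778),
   (2426.06421, 2296.89168, 2.835126878, 2.004737441),
   (2426.06421, 2296.89168, 10.58083755, 7.481781981),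
   (2426.06421, 2296.89168, 39.48822332, 27.92239049),
   (2426.06421, 2296.89168, 147.3720558, 104.20778),
   (2426.06421, 2296.89168, 550, 388.9087297),
   (2426.06421, 1746.89168, 550, 388.9087297),
   (2426.06421, 1196.89168, 550, 388.9087297),
   (2426.06421, 740, 400, 282.8427125),
   (2226.56071, 597.879, 200, 141.4213562),
   (2126.56071, 397.879, 258.5786444, 182.8427129),
   (2026.56071, 197.879, 200, 141.4213562),
   (1826.56071, 197.879, 200, 141.4213562),
   (1626.56071, 197.879, 200, 141.4213562),
   (1426.56071, 197.879, 200, 141.4213562),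
   (1226.56071, 197.879, 200, 141.4213562),
   (1026.56071, 197.879, 200, 141.4213562),
   (826.56071, 197.879, 200, 141.4213562),
   (626.56071, 197.879, 200, 141.4213562),
   (426.56071, 197.879, 200, 141.4213562),
   (426.56071, 390.842826, 186.6225781, 131.9620905),
   (426.56071, 556.1388641, 150, 106.0660172),
   (426.56071, 695.063304, 130, 91.92388155),
   (390, 804.611533, 105, 74.24621202),
   (420.7470362, 905.0088369, 105, 74.24621202),
   (518.54878, 907.99193, 91.98807, 65.0453),
   (610.5368498, 907.99193, 91.98807, 65.0453),
   (702.5249198, 907.99193, 91.98807, 65.0453),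
   (794.5129898, 907.99193, 91.98807, 65.0453),
   (886.5010598, 907.99193, 91.98807, 65.0453),
   (978.4891298, 907.99193, 91.98807, 65.0453),
   (1070.4772, 907.99193, 91.98807, 65.0453),
   (1162.46527, 907.99193, 91.98807, 65.0453),
   (1254.45334, 907.99193, 91.98807, 65.0453),
   (1346.44141, 907.99193, 91.98807, 65.0453),
   (1438.42948, 907.99193, 91.98807, 65.0453),
   (1530.41755, 907.99193, 91.98807, 65.0453),
   (1622.40562, 907.99193, 91.98807, 65.0453),
   (1714.39369, 907.99193, 91.98807, 65.0453),
   (1806.38176, 907.99193, 91.98807, 65.0453),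
   (1898.36983, 907.99193, 91.98807, 65.0453),
   (1990.3579, 907.99193, 91.98807, 65.0453),
   (2082.34597, 907.99193, 91.98807, 65.0453),
   (2174.33404, 907.99193, 91.98807, 65.0453),
   (2266.32211, 907.99193, 91.98807, 65.0453),
   (2358.31018, 907.99193, 91.98807, 65.0453),
   (2450.29825, 907.99193, 91.98807, 65.0453),
   (2542.28632, 907.99193, 91.98807, 65.0453),
   (2634.27439, 907.99193, 91.98807, 65.0453),
   (2726.26246, 907.99193, 91.98807, 65.0453),
   (2818.25053, 907.99193, 91.98807, 65.0453),
   (2910.2386, 907.99193, 91.98807, 65.0453),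
   (3002.22667, 907.99193, 91.98807, 65.0453),
   (3094.21474, 907.99193, 91.98807, 65.0453),
   (3186.20281, 907.99193, 91.98807, 65.0453),
   (3278.19088, 907.99193, 91.98807, 65.0453),
   (3370.17895, 907.99193, 91.98807, 65.0453),
   (3462.16702, 907.99193, 91.98807, 65.0453),
   (3554.15509, 907.99193, 91.98807, 65.0453),
   (3646.14316, 907.99193, 91.98807, 65.0453),
   (3738.13123, 907.99193, 91.98807, 65.0453),
   (3830.1193, 907.99193, 91.98807, 65.0453),
   (3922.10737, 907.99193, 91.98807, 65.0453),
   (4014.09544, 907.99193, 91.98807, 65.0453),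
   (4106.08351, 907.99193, 91.98807, 65.0453),
   (4198.07158, 907.99193, 91.98807, 65.0453),
   (4290.05965, 907.99193, 91.98807, 65.0453),
   (4382.04772, 907.99193, 91.98807, 65.0453),
   (4474.03579, 907.99193, 91.98807, 65.0453),
   (4566.02386, 907.99193, 91.98807, 65.0453),
   (4650.89687, 943.4652579, 91.98807, 65.0453),
   (4750, 914.7460538, 120, 84.85281374),
   (4750, 770.0255859, 203.776124, 144.0914791),
   (4750, 522.386491, 451.4162296, 319.19947),
   (4570, 0, 930.302113, 657.8229327),
   (3611.943, -100, 1000, 707.1067812),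
   (2611.943, -100, 1000, 707.1067812),
   (1611.943, -100, 1000, 707.1067812),
   (1096.504432, 756.930197, 1000, 707.1067812),
   (922.2268, 600, 300, 212.1320344),
   (750, 500, 163.335525, 115.4956573),
   (750, 500, 43.765626, 30.94697),
   (750, 500, 11.72696421, 8.29221591),
   (750, 500, 3.1422119, 2.221879342),
   (750, 500, 0.841953143, 0.595350776)]

theorem pearlTable_length : pearlTable.length = 85 := rfl

/-!
All the pearls come from one chain of round balls in the half-space: the centers `c k` of the inner balls
have height `z k` and the radii are `z k / √2`, which makes neighbouring copies of a pearl under the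
rotation by `2 π / 6` orthogonal. Consecutive pearls are then orthogonal if and only if
`2 (dx ^ 2 + dy ^ 2) + z ^ 2 + z' ^ 2 = 4 z z'`. Rational solutions of this chain of equations exist within
the rounding of the decimal table for the centers `6, …, 81`; at the two ends the arc descends vertically
to the boundary plane, with heights in geometric progression of ratio `2 - √3`. For these exact
algebraic data the disjointness of non-consecutive pearls is a finite computation with integers.

Everything else follows from orthogonality and disjointness (`IsPearlChain`).

* The polygonal line through the centers, with corners rounded within small balls about the vertices
  (`roundedCurve`), is in the ball number `k` exactly for a time interval of radius `r k` about the time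
  of the vertex (`IsPearlChain.curve_mem_iff`): an edge that came back to a ball further along would
  produce a point common to two non-consecutive balls. Thus the line is embedded, and inside each ball it
  is a corner, which a norm-preserving homeomorphism carries to a diameter (`exists_straightening`).
  Spinning that homeomorphism along the caps over the points of the ball makes the disks in the four-balls
  unknotted as well (`isTrivialBallPair_spinSet`). Absolute values as corner profiles give the polygonal
  arc, smooth profiles give a spinnable arc, and the two are ambiently homeomorphic
  (`IsPearlChain.ambientEquiv_roundedArc`).
* Four pearls with latitudes `k, k + 1` and meridians `i, i + 1` are centered at the vertices of a plane
  trapezoid and meet in a point of its plane, hence in that point only. This point lies outside all other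
  pearls, so that every sufficiently small pearl through it, with center displaced horizontally and
  perpendicularly to the edge of the polygon, can serve as the pearl `P k i`
  (`IsPearlChain.exists_isPearlNecklace`).

It remains to recognize the closed polygon through the centers as a trefoil knot
(`ambientEquiv_standardTrefoil_necklacePolygon`). Two curves that are joined by a straight-line isotopy
whose stages separate points uniformly are ambiently homeomorphic
(`ambientEquiv_of_linear_isotopy`). On the one hand this applies to the removal of a vertex from a
closed polygon, if separating linear functionals show that the other edges miss the triangle swept out.
Such moves, certified by integers, lead from the polygon through the centers to a dodecagon. On the other
hand it applies to closed braids, since a closed curve winding twice around an axis is embedded as long as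
the two strands do not meet, and this deforms the standard trefoil to that dodecagon.
-/

/-! ### Ambient equivalence and isotopy extension -/

/-- Two subsets of three-space are ambiently equivalent if a homeomorphism of three-space maps one
onto the other. -/
def AmbientEquiv (K L : Set E3) : Prop := ∃ h : E3 ≃ₜ E3, h '' K = L

theorem AmbientEquiv.refl (K : Set E3) : AmbientEquiv K K := ⟨Homeomorph.refl _, by simp⟩

theorem AmbientEquiv.symm {K L : Set E3} (h : AmbientEquiv K L) : AmbientEquiv L K := by
  obtain ⟨f, rfl⟩ := h
  exact ⟨f.symm, by simp [Set.image_image]⟩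

theorem AmbientEquiv.trans {K L M : Set E3} (h : AmbientEquiv K L) (h' : AmbientEquiv L M) :
    AmbientEquiv K M := by
  obtain ⟨f, rfl⟩ := h
  obtain ⟨g, rfl⟩ := h'
  exact ⟨f.trans g, by rw [Set.image_image]; rfl⟩

/-- A displacement of a subset that is Lipschitz with a small constant extends to a homeomorphism of
the whole space: extend it to a Lipschitz map and add the identity. -/
theorem exists_homeomorph_of_small_displacement :
    ∃ κ : ℝ, 0 < κ ∧ ∀ {T : Type} (f g : T → E3),
      (∀ s t, ‖(g s - f s) - (g t - f t)‖ ≤ κ * ‖f s - f t‖) →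
      ∃ H : E3 ≃ₜ E3, ∀ t, H (f t) = g t := by
  set L := lipschitzExtensionConstant E3
  have hL : 0 < L := lipschitzExtensionConstant_pos E3
  refine ⟨(L⁻¹ * 2⁻¹ : NNReal), by positivity, fun {T} f g h => ?_⟩
  classical
  let φ : E3 → E3 := fun x => if hx : ∃ t, f t = x then g hx.choose - f hx.choose else 0
  have hφ : ∀ t, φ (f t) = g t - f t := by
    intro t
    have hx : ∃ s, f s = f t := ⟨t, rfl⟩
    have h1 : φ (f t) = g hx.choose - f hx.choose := dif_pos hx
    rw [h1]
    have h2 := h hx.choose t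
    rw [hx.choose_spec, sub_self, norm_zero, mul_zero] at h2
    exact sub_eq_zero.1 (norm_le_zero_iff.1 (by rw [hx.choose_spec]; exact h2))
  have hlip : LipschitzOnWith (L⁻¹ * 2⁻¹) φ (range f) := by
    refine LipschitzOnWith.of_dist_le_mul ?_
    rintro _ ⟨s, rfl⟩ _ ⟨t, rfl⟩
    rw [hφ, hφ, dist_eq_norm, dist_eq_norm]
    exact h s t
  obtain ⟨ψ, hψ, hψφ⟩ := hlip.extend_finite_dimension
  have hK : L * (L⁻¹ * 2⁻¹) = 2⁻¹ := by
    rw [← mul_assoc, mul_inv_cancel₀ hL.ne', one_mul]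
  change LipschitzWith (L * (L⁻¹ * 2⁻¹)) ψ at hψ
  rw [hK] at hψ
  have happ : ApproximatesLinearOn (fun x => x + ψ x)
      ((ContinuousLinearEquiv.refl ℝ E3 : E3 ≃L[ℝ] E3) : E3 →L[ℝ] E3) univ 2⁻¹ := by
    intro x _ y _
    have h1 := hψ.dist_le_mul x y
    rw [dist_eq_norm, dist_eq_norm] at h1
    have h2 : x + ψ x - (y + ψ y) - ((ContinuousLinearEquiv.refl ℝ E3 : E3 ≃L[ℝ] E3) :
        E3 →L[ℝ] E3) (x - y) = ψ x - ψ y := by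
      simp only [ContinuousLinearEquiv.coe_refl, ContinuousLinearMap.id_apply]
      abel
    rw [h2]
    exact h1
  have hc : (2⁻¹ : NNReal) < ‖((ContinuousLinearEquiv.refl ℝ E3).symm : E3 →L[ℝ] E3)‖₊⁻¹ := by
    have : ‖((ContinuousLinearEquiv.refl ℝ E3).symm : E3 →L[ℝ] E3)‖₊ = 1 := by
      rw [ContinuousLinearEquiv.refl_symm, ContinuousLinearEquiv.coe_refl]
      exact NNReal.eq (by simp)
    rw [this, inv_one]
    exact NNReal.inv_lt_one_iff (by norm_num) |>.2 (by norm_num)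
  refine ⟨happ.toHomeomorph _ (Or.inr hc), fun t => ?_⟩
  change f t + ψ (f t) = g t
  rw [← hψφ ⟨t, rfl⟩, hφ]
  abel

/-- Isotopy extension along a straight-line isotopy: if the intermediate maps
`f + s (g - f)` are uniformly bi-Lipschitz with respect to the displacement `g - f`, then a
homeomorphism of space carries `f` to `g`.  The isotopy is cut into short steps, and each of
them is a small displacement. -/
theorem exists_homeomorph_of_linear_isotopy {T : Type} (f g : T → E3) (C : ℝ)
    (h : ∀ r ∈ Icc (0 : ℝ) 1, ∀ s t, ‖(g s - f s) - (g t - f t)‖ ≤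
      C * ‖(f s + r • (g s - f s)) - (f t + r • (g t - f t))‖) :
    ∃ H : E3 ≃ₜ E3, ∀ t, H (f t) = g t := by
  obtain ⟨κ, hκ, hstep⟩ := exists_homeomorph_of_small_displacement
  obtain ⟨N, hN⟩ := exists_nat_gt (C / κ)
  have hN1 : C ≤ (N + 1 : ℝ) * κ := by
    rw [div_lt_iff₀ hκ] at hN
    nlinarith
  have key : ∀ j : ℕ, j ≤ N + 1 → ∃ H : E3 ≃ₜ E3, ∀ t,
      H (f t) = f t + ((j : ℝ) / (N + 1)) • (g t - f t) := by
    intro j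
    induction j with
    | zero => exact fun _ => ⟨Homeomorph.refl _, by simp⟩
    | succ j ih =>
      intro hj
      obtain ⟨H, hH⟩ := ih (by omega)
      have hNp : (0 : ℝ) < N + 1 := by positivity
      obtain ⟨G, hG⟩ := hstep (fun t => f t + ((j : ℝ) / (N + 1)) • (g t - f t))
        (fun t => f t + (((j + 1 : ℕ) : ℝ) / (N + 1)) • (g t - f t)) (by
          intro s t
          have hr : (j : ℝ) / (N + 1) ∈ Icc (0 : ℝ) 1 := by
            refine ⟨by positivity, ?_⟩
            rw [div_le_one hNp]
            have : (j : ℝ) + 1 ≤ (N : ℝ) + 1 := by exact_mod_cast hj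
            linarith
          have h1 := h _ hr s t
          set X := ‖(f s + ((j : ℝ) / (N + 1)) • (g s - f s)) -
            (f t + ((j : ℝ) / (N + 1)) • (g t - f t))‖
          have h2 : (f s + (((j + 1 : ℕ) : ℝ) / (N + 1)) • (g s - f s) -
              (f s + ((j : ℝ) / (N + 1)) • (g s - f s))) -
              (f t + (((j + 1 : ℕ) : ℝ) / (N + 1)) • (g t - f t) -
              (f t + ((j : ℝ) / (N + 1)) • (g t - f t))) =
              ((1 : ℝ) / (N + 1)) • ((g s - f s) - (g t - f t)) := by
            push_cast
            rw [add_div]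
            module
          rw [h2, norm_smul, Real.norm_of_nonneg (by positivity), one_div, inv_mul_le_iff₀ hNp]
          have hX : 0 ≤ X := norm_nonneg _
          nlinarith)
      exact ⟨H.trans G, fun t => by rw [Homeomorph.trans_apply, hH, hG]⟩
  obtain ⟨H, hH⟩ := key (N + 1) le_rfl
  refine ⟨H, fun t => ?_⟩
  rw [hH]
  push_cast
  rw [div_self (by positivity), one_smul]
  abel

/-- A linear isotopy along which points are separated proportionally to their relative displacement is
ambient: it is divided into steps with displacements of small Lipschitz constant. -/
theorem ambientEquiv_of_linear_isotopy {T : Type} (f g : T → E3) (C : ℝ)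
    (h : ∀ r ∈ Icc (0 : ℝ) 1, ∀ s t, ‖(g s - f s) - (g t - f t)‖ ≤
      C * ‖(f s + r • (g s - f s)) - (f t + r • (g t - f t))‖) :
    AmbientEquiv (range f) (range g) := by
  obtain ⟨H, hH⟩ := exists_homeomorph_of_linear_isotopy f g C h
  refine ⟨H, ?_⟩
  rw [← range_comp]
  congr 1
  exact funext hH

/-! ### Triangle moves on polygons -/

/-- If a linear functional weakly separates the triangle `a b c` from the segment `[p, q]`, and
strictly separates `b` and the midpoint of `[a, c]` from it, then the distance between points of the
segment and points of the two sides of the moving corner grows linearly with the distance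
from the fixed vertices. -/
theorem exists_bound_of_separation {a b b' c p q : E3} (ℓ : E3 →L[ℝ] ℝ)
    (hap : ℓ a ≤ ℓ p) (haq : ℓ a ≤ ℓ q) (hcp : ℓ c ≤ ℓ p) (hcq : ℓ c ≤ ℓ q)
    (hbp : ℓ b < ℓ p) (hbq : ℓ b < ℓ q) (hbp' : ℓ b' < ℓ p) (hbq' : ℓ b' < ℓ q) :
    ∃ C : ℝ, 0 ≤ C ∧ ∀ x ∈ segment ℝ p q, ∀ r ∈ Icc (0 : ℝ) 1, ∀ τ ∈ Icc (0 : ℝ) 1,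
      ∀ e, e = a ∨ e = c → τ ≤ C * ‖x - (e + τ • (b + r • (b' - b) - e))‖ := by
  set m := min (ℓ p) (ℓ q)
  set M := max (ℓ b) (ℓ b')
  have hmM : 0 < m - M := by
    simp only [m, M, sub_pos, lt_min_iff, max_lt_iff]
    tauto
  refine ⟨‖ℓ‖ / (m - M), by positivity, ?_⟩
  rintro x ⟨u, v, hu, hv, huv, rfl⟩ r hr τ hτ e he
  have h1 : m ≤ ℓ (u • p + v • q) := by
    have h2 : m ≤ ℓ p := min_le_left _ _
    have h3 : m ≤ ℓ q := min_le_right _ _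
    have h4 : m = u * m + v * m := by rw [← add_mul, huv, one_mul]
    simp only [map_add, map_smul, smul_eq_mul]
    rw [h4]
    exact add_le_add (mul_le_mul_of_nonneg_left h2 hu) (mul_le_mul_of_nonneg_left h3 hv)
  have he1 : ℓ e ≤ m := by
    rcases he with rfl | rfl
    · exact le_min hap haq
    · exact le_min hcp hcq
  have h4 : ℓ (b + r • (b' - b)) ≤ M := by
    have h2 : ℓ b ≤ M := le_max_left _ _
    have h3 : ℓ b' ≤ M := le_max_right _ _
    simp only [map_add, map_smul, map_sub, smul_eq_mul]
    nlinarith [hr.1, hr.2]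
  have h5 : τ * (m - M) ≤ ℓ ((u • p + v • q) - (e + τ • (b + r • (b' - b) - e))) := by
    rw [map_sub, map_add ℓ e, map_smul, map_sub ℓ _ e, smul_eq_mul]
    nlinarith [hτ.1, hτ.2]
  have h6 := (le_abs_self _).trans (ℓ.le_opNorm ((u • p + v • q) - (e + τ • (b + r • (b' - b) - e))))
  rw [div_mul_eq_mul_div, le_div_iff₀ hmM]
  exact h5.trans h6

/-- Straightening the corner `a b c` of a curve to the segment `[a, c]` does not change the ambient
type, provided the rest `X` of the curve stays away from the triangle in the quantitative sense
provided by `exists_bound_of_separation`. -/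
theorem ambientEquiv_straighten_corner {a b c : E3} {X : Set E3} (ℓ : E3 →L[ℝ] ℝ)
    (hab : ℓ a < ℓ b) (hbc : ℓ b < ℓ c)
    (hX : ∃ C : ℝ, 0 ≤ C ∧ ∀ x ∈ X, ∀ r ∈ Icc (0 : ℝ) 1, ∀ τ ∈ Icc (0 : ℝ) 1,
      ∀ e, e = a ∨ e = c →
        τ ≤ C * ‖x - (e + τ • (b + r • ((a + (1 / 2 : ℝ) • (c - a)) - b) - e))‖) :
    AmbientEquiv (X ∪ (segment ℝ a b ∪ segment ℝ b c)) (X ∪ segment ℝ a c) := by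
  obtain ⟨C, hC, hX⟩ := hX
  set b' := a + (1 / 2 : ℝ) • (c - a) with hb'
  have hℓb' : ℓ b' = (ℓ a + ℓ c) / 2 := by
    simp only [hb', map_add, map_smul, map_sub, smul_eq_mul]; ring
  let E : Bool → E3 := fun i => if i then a else c
  have hE : ∀ i, E i = a ∨ E i = c := by
    intro i; cases i <;> simp [E]
  let f : X ⊕ (Icc (0 : ℝ) 1 × Bool) → E3 :=
    Sum.elim (fun x => x) fun y => E y.2 + (y.1 : ℝ) • (b - E y.2)
  let g : X ⊕ (Icc (0 : ℝ) 1 × Bool) → E3 :=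
    Sum.elim (fun x => x) fun y => E y.2 + (y.1 : ℝ) • (b' - E y.2)
  have hseg : ∀ w : E3, (range fun y : Icc (0 : ℝ) 1 × Bool => E y.2 + (y.1 : ℝ) • (w - E y.2)) =
      segment ℝ a w ∪ segment ℝ w c := by
    intro w
    rw [segment_symm ℝ w c, segment_eq_image', segment_eq_image']
    ext z
    constructor
    · rintro ⟨⟨t, i⟩, rfl⟩
      cases i
      · exact Or.inr ⟨t, t.2, by simp [E]⟩
      · exact Or.inl ⟨t, t.2, by simp [E]⟩
    · rintro (⟨t, ht, rfl⟩ | ⟨t, ht, rfl⟩)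
      · exact ⟨(⟨t, ht⟩, true), by simp [E]⟩
      · exact ⟨(⟨t, ht⟩, false), by simp [E]⟩
  have hf : range f = X ∪ (segment ℝ a b ∪ segment ℝ b c) := by
    rw [← hseg b]
    simp only [f, Sum.elim_range, Subtype.range_coe]
  have hac : segment ℝ a b' ∪ segment ℝ b' c = segment ℝ a c := by
    apply Subset.antisymm
    · have hm : b' ∈ segment ℝ a c := by
        rw [segment_eq_image']
        exact ⟨1 / 2, by norm_num, rfl⟩
      exact union_subset ((convex_segment a c).segment_subset (left_mem_segment ..) hm)
        ((convex_segment a c).segment_subset hm (right_mem_segment ..))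
    · rw [segment_eq_image' ℝ a c]
      rintro _ ⟨t, ht, rfl⟩
      rcases le_total t (1 / 2) with h | h
      · left
        rw [segment_eq_image']
        refine ⟨2 * t, ⟨by linarith [ht.1], by linarith⟩, ?_⟩
        simp only [hb']
        module
      · right
        rw [segment_eq_image']
        refine ⟨2 * t - 1, ⟨by linarith [ht.1], by linarith [ht.2]⟩, ?_⟩
        simp only [hb']
        module
  have hg : range g = X ∪ segment ℝ a c := by
    rw [← hac, ← hseg b']
    simp only [g, Sum.elim_range, Subtype.range_coe]
  rw [← hf, ← hg]
  set d := ‖b' - b‖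
  set h := min (min (ℓ b - ℓ a) (ℓ c - ℓ b)) ((ℓ c - ℓ a) / 2) with hh
  have hpos : 0 < h := by
    simp only [hh, lt_min_iff]
    refine ⟨⟨?_, ?_⟩, ?_⟩ <;> linarith
  -- the moving vertex stays at height at least `h` away from both fixed vertices
  have hlow : ∀ r ∈ Icc (0 : ℝ) 1, h ≤ ℓ (b + r • (b' - b)) - ℓ a ∧
      h ≤ ℓ c - ℓ (b + r • (b' - b)) := by
    intro r hr
    have h1 : h ≤ ℓ b - ℓ a := (min_le_left _ _).trans (min_le_left _ _)
    have h2 : h ≤ ℓ c - ℓ b := (min_le_left _ _).trans (min_le_right _ _)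
    have h3 : h ≤ (ℓ c - ℓ a) / 2 := min_le_right _ _
    rw [map_add, map_smul, map_sub, hℓb', smul_eq_mul]
    constructor <;> nlinarith [hr.1, hr.2]
  have hd : 0 ≤ d := norm_nonneg _
  apply ambientEquiv_of_linear_isotopy f g (C * d + ‖ℓ‖ / h * d)
  have hmove : ∀ r : ℝ, ∀ y : Icc (0 : ℝ) 1 × Bool, f (.inr y) + r • (g (.inr y) - f (.inr y)) =
      E y.2 + (y.1 : ℝ) • (b + r • (b' - b) - E y.2) := by
    intro r y
    simp only [f, g, Sum.elim_inr]
    module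
  have hdisp : ∀ y : Icc (0 : ℝ) 1 × Bool, g (.inr y) - f (.inr y) = (y.1 : ℝ) • (b' - b) := by
    intro y
    simp only [f, g, Sum.elim_inr]
    module
  have hle1 : ∀ z : E3, C * d * ‖z‖ ≤ (C * d + ‖ℓ‖ / h * d) * ‖z‖ := by
    intro z
    have : 0 ≤ ‖ℓ‖ / h * d * ‖z‖ := by positivity
    linarith
  have hle2 : ∀ z : E3, ‖ℓ‖ / h * d * ‖z‖ ≤ (C * d + ‖ℓ‖ / h * d) * ‖z‖ := by
    intro z
    have : 0 ≤ C * d * ‖z‖ := by positivity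
    linarith
  have hXY : ∀ r ∈ Icc (0 : ℝ) 1, ∀ (x : X) (y : Icc (0 : ℝ) 1 × Bool),
      (y.1 : ℝ) * d ≤ (C * d + ‖ℓ‖ / h * d) *
        ‖(x : E3) - (E y.2 + (y.1 : ℝ) • (b + r • (b' - b) - E y.2))‖ := by
    intro r hr x y
    refine le_trans ?_ (hle1 _)
    have := hX x x.2 r hr y.1 y.1.2 (E y.2) (hE _)
    nlinarith
  rintro r hr (x | y) (x' | y')
  · simp only [f, g, Sum.elim_inl, sub_self, norm_zero]
    positivity
  · rw [hmove, hdisp]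
    simp only [f, g, Sum.elim_inl, sub_self, zero_sub, norm_neg, smul_zero, add_zero, norm_smul]
    rw [Real.norm_of_nonneg y'.1.2.1]
    exact hXY r hr x y'
  · rw [hmove, hdisp, norm_sub_rev (E _ + _)]
    simp only [f, g, Sum.elim_inl, sub_self, sub_zero, smul_zero, add_zero, norm_smul]
    rw [Real.norm_of_nonneg y.1.2.1]
    exact hXY r hr x' y
  · rw [hmove, hmove, hdisp, hdisp]
    refine le_trans ?_ (hle2 _)
    rw [← sub_smul, norm_smul, Real.norm_eq_abs, mul_comm (‖ℓ‖ / h), mul_assoc, mul_comm]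
    refine mul_le_mul_of_nonneg_left ?_ hd
    rw [div_mul_eq_mul_div, le_div_iff₀ hpos]
    refine le_trans ?_ (ℓ.le_opNorm _)
    obtain ⟨hl1, hl2⟩ := hlow r hr
    set w := b + r • (b' - b)
    obtain ⟨⟨s, hs⟩, i⟩ := y
    obtain ⟨⟨t, ht⟩, j⟩ := y'
    have hs1 := hs.1
    have hs2 := hs.2
    have ht1 := ht.1
    have ht2 := ht.2
    rw [map_sub, map_add, map_add, map_smul, map_smul, map_sub, map_sub, Real.norm_eq_abs,
      smul_eq_mul, smul_eq_mul]
    -- both sides are absolute values of expressions in the heights; compare signs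
    cases i <;> cases j <;> simp only [E, if_true, if_false, Bool.false_eq_true]
    · rw [show ℓ c + s * (ℓ w - ℓ c) - (ℓ c + t * (ℓ w - ℓ c)) = (s - t) * (ℓ w - ℓ c) by ring,
        abs_mul]
      refine mul_le_mul_of_nonneg_left ?_ (abs_nonneg _)
      rw [abs_sub_comm]
      exact hl2.trans (le_abs_self _)
    · refine le_trans ?_ (le_abs_self _)
      have h7 : |s - t| * h ≤ ((1 - s) + (1 - t)) * h :=
        mul_le_mul_of_nonneg_right (abs_le.2 ⟨by linarith, by linarith⟩) hpos.le
      nlinarith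
    · rw [abs_sub_comm (ℓ a + _)]
      refine le_trans ?_ (le_abs_self _)
      have h7 : |s - t| * h ≤ ((1 - s) + (1 - t)) * h :=
        mul_le_mul_of_nonneg_right (abs_le.2 ⟨by linarith, by linarith⟩) hpos.le
      nlinarith
    · rw [show ℓ a + s * (ℓ w - ℓ a) - (ℓ a + t * (ℓ w - ℓ a)) = (s - t) * (ℓ w - ℓ a) by ring,
        abs_mul]
      refine mul_le_mul_of_nonneg_left ?_ (abs_nonneg _)
      exact hl1.trans (le_abs_self _)

/-! ### Polygons with integral vertices and a decision procedure for triangle moves -/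

/-- Integral points of three-space. -/
abbrev Z3 : Type := ℤ × ℤ × ℤ

namespace Z3

/-- The point of Euclidean space with the given integral coordinates. -/
noncomputable def toE (v : Z3) : E3 := !₂[(v.1 : ℝ), (v.2.1 : ℝ), (v.2.2 : ℝ)]

/-- The dot product. -/
def dot (u v : Z3) : ℤ := u.1 * v.1 + u.2.1 * v.2.1 + u.2.2 * v.2.2

/-- The cross product. -/
def cross (u v : Z3) : Z3 :=
  (u.2.1 * v.2.2 - u.2.2 * v.2.1, u.2.2 * v.1 - u.1 * v.2.2, u.1 * v.2.1 - u.2.1 * v.1)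

/-- The linear functional `x ↦ ⟨l, x⟩`. -/
noncomputable def functional (l : Z3) : E3 →L[ℝ] ℝ := innerSL ℝ l.toE

theorem functional_toE (l v : Z3) : l.functional v.toE = (dot l v : ℝ) := by
  simp [functional, toE, dot, PiLp.inner_apply, Fin.sum_univ_three]
  ring

/-- The functional `l` weakly separates the triangle `a b c` from the segment `[p, q]`, strictly at
`b` and at the midpoint of `[a, c]`. -/
def separates (a b c p q l : Z3) : Bool :=
  dot l a ≤ dot l p && dot l a ≤ dot l q && dot l c ≤ dot l p && dot l c ≤ dot l q &&
  dot l b < dot l p && dot l b < dot l q &&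
  dot l a + dot l c < 2 * dot l p && dot l a + dot l c < 2 * dot l q

/-- Candidates for a functional separating the triangle `a b c` from the segment `[p, q]`: the
coordinate directions, the normal of the triangle, its products with the sides, and the products of
the sides with the direction of the segment. -/
def axes (a b c p q : Z3) : List Z3 :=
  let e := [b - a, c - b, a - c]
  let n := cross (b - a) (c - b)
  (1, 0, 0) :: (0, 1, 0) :: (0, 0, 1) :: n ::
    (e.map fun x => cross x (q - p)) ++ e.map fun x => cross n x

/-- A functional that increases strictly along `a`, `b`, `c`, if there is any. -/
def increasing (a b c : Z3) : Z3 :=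
  let u := b - a
  let v := c - b
  if 0 < dot u v then u + v else (dot v v - dot u v) • u + (dot u u - dot u v) • v

/-- Every edge of the path has a separating functional among the candidate axes. -/
def pathSeparated (a b c : Z3) : List Z3 → Bool
  | p :: q :: l =>
    (axes a b c p q).any (fun x => separates a b c p q x || separates a b c p q (-x)) &&
      pathSeparated a b c (q :: l)
  | _ => true

/-- The corner `b` of the closed polygon `a, b, c, l` can be straightened. -/
def canStraighten (a b c : Z3) (l : List Z3) : Bool :=
  dot (increasing a b c) a < dot (increasing a b c) b &&
  dot (increasing a b c) b < dot (increasing a b c) c && pathSeparated a b c (c :: l ++ [a])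

end Z3

open Z3

/-- The polygonal path with the given vertices. -/
def polygonalPath : List Z3 → Set E3
  | a :: b :: l => segment ℝ a.toE b.toE ∪ polygonalPath (b :: l)
  | _ => ∅

/-- The closed polygon with the given vertices. -/
def closedPolygon : List Z3 → Set E3
  | a :: l => polygonalPath (a :: l ++ [a])
  | [] => ∅

theorem polygonalPath_append (l : List Z3) (a b : Z3) :
    polygonalPath (l ++ [a, b]) = polygonalPath (l ++ [a]) ∪ segment ℝ a.toE b.toE := by
  induction l with
  | nil => simp [polygonalPath]
  | cons c l ih =>
    cases l with
    | nil => simp [polygonalPath]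
    | cons d l =>
      simp only [List.cons_append, polygonalPath] at ih ⊢
      rw [ih, union_assoc]

theorem closedPolygon_rotate_one (a : Z3) (l : List Z3) :
    closedPolygon (l ++ [a]) = closedPolygon (a :: l) := by
  cases l with
  | nil => rfl
  | cons b l =>
    simp only [closedPolygon, List.cons_append, List.append_assoc, polygonalPath]
    rw [List.nil_append, ← List.cons_append, polygonalPath_append, union_comm]
    rfl

theorem closedPolygon_rotate (l₁ l₂ : List Z3) :
    closedPolygon (l₂ ++ l₁) = closedPolygon (l₁ ++ l₂) := by
  induction l₁ generalizing l₂ with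
  | nil => simp
  | cons a l ih =>
    have h := ih (l₂ ++ [a])
    rw [List.append_assoc] at h
    rw [List.cons_append, ← closedPolygon_rotate_one, List.append_assoc, ← h]
    rfl

/-- During the straightening of the corner `b`, the distance of a point of the moving edges from a
separated path is bounded below by a multiple of its parameter `τ`, which is the fraction of the way
from a fixed end `e` to the moving vertex. -/
theorem exists_bound_of_pathSeparated {a b c : Z3} (l : List Z3) (h : pathSeparated a b c l) :
    ∃ C : ℝ, 0 ≤ C ∧ ∀ x ∈ polygonalPath l, ∀ r ∈ Icc (0 : ℝ) 1, ∀ τ ∈ Icc (0 : ℝ) 1,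
      ∀ e, e = a.toE ∨ e = c.toE → τ ≤ C * ‖x - (e + τ • (b.toE +
        r • ((a.toE + (1 / 2 : ℝ) • (c.toE - a.toE)) - b.toE) - e))‖ := by
  induction l with
  | nil => exact ⟨0, le_rfl, by simp [polygonalPath]⟩
  | cons p l ih =>
    cases l with
    | nil => exact ⟨0, le_rfl, by simp [polygonalPath]⟩
    | cons q l =>
      rw [pathSeparated, Bool.and_eq_true, List.any_eq_true] at h
      obtain ⟨⟨x, -, hx⟩, hl⟩ := h
      obtain ⟨C₁, hC₁, h₁⟩ := ih hl
      have hy : ∃ y : Z3, separates a b c p q y := by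
        rw [Bool.or_eq_true] at hx
        exact hx.elim (fun h => ⟨x, h⟩) fun h => ⟨-x, h⟩
      obtain ⟨y, hy⟩ := hy
      simp only [separates, Bool.and_eq_true, decide_eq_true_eq] at hy
      obtain ⟨⟨⟨⟨⟨⟨⟨h1, h2⟩, h3⟩, h4⟩, h5⟩, h6⟩, h7⟩, h8⟩ := hy
      have hmid : y.functional (a.toE + (1 / 2 : ℝ) • (c.toE - a.toE)) =
          ((dot y a + dot y c : ℤ) : ℝ) / 2 := by
        rw [map_add, map_smul, map_sub, functional_toE, functional_toE, smul_eq_mul]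
        push_cast
        ring
      obtain ⟨C₂, hC₂, h₂⟩ := exists_bound_of_separation (a := a.toE) (b := b.toE)
        (b' := a.toE + (1 / 2 : ℝ) • (c.toE - a.toE)) (c := c.toE) (p := p.toE) (q := q.toE)
        y.functional
        (by rw [functional_toE, functional_toE]; exact_mod_cast h1)
        (by rw [functional_toE, functional_toE]; exact_mod_cast h2)
        (by rw [functional_toE, functional_toE]; exact_mod_cast h3)
        (by rw [functional_toE, functional_toE]; exact_mod_cast h4)
        (by rw [functional_toE, functional_toE]; exact_mod_cast h5)
        (by rw [functional_toE, functional_toE]; exact_mod_cast h6)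
        (by rw [hmid, functional_toE, div_lt_iff₀ two_pos, mul_comm]; exact_mod_cast h7)
        (by rw [hmid, functional_toE, div_lt_iff₀ two_pos, mul_comm]; exact_mod_cast h8)
      refine ⟨C₂ + C₁, add_nonneg hC₂ hC₁, ?_⟩
      rintro z (hz | hz) r hr τ hτ e he
      · refine (h₂ z hz r hr τ hτ e he).trans (mul_le_mul_of_nonneg_right ?_ (norm_nonneg _))
        linarith
      · refine (h₁ z hz r hr τ hτ e he).trans (mul_le_mul_of_nonneg_right ?_ (norm_nonneg _))
        linarith

theorem ambientEquiv_of_canStraighten {a b c : Z3} {l : List Z3} (h : canStraighten a b c l) :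
    AmbientEquiv (closedPolygon (a :: b :: c :: l)) (closedPolygon (a :: c :: l)) := by
  simp only [canStraighten, Bool.and_eq_true, decide_eq_true_eq] at h
  obtain ⟨⟨h1, h2⟩, h3⟩ := h
  have key := ambientEquiv_straighten_corner (a := a.toE) (b := b.toE) (c := c.toE)
    (X := polygonalPath (c :: l ++ [a])) (increasing a b c).functional
    (by rw [functional_toE, functional_toE]; exact_mod_cast h1)
    (by rw [functional_toE, functional_toE]; exact_mod_cast h2)
    (exists_bound_of_pathSeparated _ h3)
  have e1 : closedPolygon (a :: b :: c :: l) = polygonalPath (c :: l ++ [a]) ∪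
      (segment ℝ a.toE b.toE ∪ segment ℝ b.toE c.toE) := by
    simp only [closedPolygon, List.cons_append, polygonalPath]
    rw [← union_assoc, union_comm]
  have e2 : closedPolygon (a :: c :: l) = polygonalPath (c :: l ++ [a]) ∪
      segment ℝ a.toE c.toE := by
    simp only [closedPolygon, List.cons_append, polygonalPath]
    rw [union_comm]
  rw [e1, e2]
  exact key

/-- One move on a closed polygon: rotate the list of vertices by `o.1`; then either straighten the
corner at the second vertex, or, conversely, insert a new second vertex. -/
def polygonStep (o : ℕ × Option Z3) (L : List Z3) : Option (List Z3) :=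
  match L.drop o.1 ++ L.take o.1, o.2 with
  | a :: b :: c :: l, none => if canStraighten a b c l then some (a :: c :: l) else none
  | a :: c :: l, some v => if canStraighten a v c l then some (a :: v :: c :: l) else none
  | _, _ => none

/-- Perform a list of moves, failing if one of them is not admissible. -/
def polygonRun : List (ℕ × Option Z3) → List Z3 → Option (List Z3)
  | [], L => some L
  | o :: s, L => (polygonStep o L).bind (polygonRun s)

theorem ambientEquiv_of_polygonStep {o : ℕ × Option Z3} {L L' : List Z3}
    (h : polygonStep o L = some L') : AmbientEquiv (closedPolygon L) (closedPolygon L') := by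
  have hrot : closedPolygon L = closedPolygon (L.drop o.1 ++ L.take o.1) := by
    rw [closedPolygon_rotate, List.take_append_drop]
  rw [hrot]
  unfold polygonStep at h
  split at h
  · rename_i a b c l e1 e2
    split at h
    · rw [e1, ← Option.some.inj h]
      exact ambientEquiv_of_canStraighten ‹_›
    · exact absurd h (by simp)
  · rename_i a c l v e1 e2
    split at h
    · rw [e1, ← Option.some.inj h]
      exact (ambientEquiv_of_canStraighten ‹_›).symm
    · exact absurd h (by simp)
  · exact absurd h (by simp)

theorem ambientEquiv_of_polygonRun {s : List (ℕ × Option Z3)} {L L' : List Z3}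
    (h : polygonRun s L = some L') : AmbientEquiv (closedPolygon L) (closedPolygon L') := by
  induction s generalizing L with
  | nil => rw [Option.some.inj h]; exact AmbientEquiv.refl _
  | cons o s ih =>
    obtain ⟨M, hM, hM'⟩ := Option.bind_eq_some_iff.1 h
    exact (ambientEquiv_of_polygonStep hM).trans (ih hM')

/-! ### The rational centers -/

/-- The common denominator `8 · 5 ^ 15` of the rational centers. -/
def denom : ℤ := 244140625000

/-- `n` equally spaced integral points, starting at `v`. -/
def equallySpaced (n : ℕ) (v step : Z3) : List Z3 :=
  (List.range n).map fun j => v + (j : ℤ) • step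

/-- The centers number `6, …, 81`, multiplied by `denom`.  Consecutive pearls are exactly
orthogonal; this forces all third coordinates to have the same `2`-adic valuation, and points with
denominators a power of `5` were chosen close to the decimal table. -/
def rationalCenters : List Z3 :=
  equallySpaced 3 (592302077680855, 560764615106144, 134277013854144) (0, -134277013854144, 0) ++
  [(592299734993815, 180664555217632, 97656646957504),
   (543592636569751, 145966767335712, 48828392838592),
   (519178569020183, 97138652018400, 63128930804800)] ++
  equallySpaced 9 (494766476620823, 48309694731040, 48828209256640) (-48828209256640, 0, 0) ++
  [(104140631051479, 95420636147872, 45563228409280),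
   (104141684500759, 135775848291872, 36620153947840),
   (104139673967959, 169691954210592, 31737265404480),
   (95214512364055, 196437889270176, 25635993015744),
   (102722605095639, 220948950309792, 25634410596160)] ++
  equallySpaced 45 (126599841506583, 221677151070496, 22457996318784) (22457996318784, 0, 0) ++
  [(1135472565046551, 230340017626976, 22459722041408),
   (1159668130692631, 223325276443040, 29297236783296),
   (1159667185653271, 187993024499936, 49748672705088),
   (1159668736484823, 127536246718304, 110209364056000),
   (1115721883358935, 547269920, 227123257176000)] ++
  equallySpaced 3 (881822021484375, -24414062500000, 244140625000000) (-244140625000000, 0, 0) ++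
  [(267702642533271, 184797828844256, 244141466329536),
   (225152162873751, 146485628493344, 73242656644032),
   (183106561495191, 122069720790112, 39876111207232)]

/-- The closed polygon through the centers, multiplied by `denom`: the rational centers and the two
end-points of the arc. -/
def necklacePolygon : List Z3 :=
  (592302077680855, 560764615106144, 0) :: rationalCenters ++ [(183106561495191, 122069720790112, 0)]

/-- Moves from `necklacePolygon` to a heptagon: the rotations before the successive removals of
vertices, and then seven displacements of a vertex, each of them an insertion and a removal. -/
def necklaceMoves : List (ℕ × Option Z3) :=
  (List.replicate 4 0 ++ [1] ++ List.replicate 7 0 ++ [1] ++ List.replicate 9 0 ++ [2] ++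
    List.replicate 33 0 ++ [1] ++ List.replicate 8 0 ++ [1] ++ List.replicate 4 0 ++ [4]).map
      (fun n => (n, none)) ++
  [(2, (4079, 953, 170)),
   (4, (2202, 1954, -84)),
   (3, (522, -146, 306)),
   (5, (699, 793, -150)),
   (0, (3345, -45, 802)),
   (4, (2866, 616, 351)),
   (3, (1085, 1195, 222))].flatMap (fun m => [(m.1, some (denom • m.2)), (7, none)])

/-- A closed polygon with twelve vertices, an affine image of `braidVertex`, multiplied by
`denom`. -/
def braidPolygon : List Z3 :=
  [(2202, 1954, -84), (4465, 1355, 542), (2866, 616, 351),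
   (2959, -447, 430), (522, -146, 306), (1085, 1195, 222),
   (2753, 678, 322), (4079, 953, 170), (5592, 94, 786),
   (3345, -45, 802), (2697, 608, 335), (699, 793, -150)].map (denom • ·)

/-- Both polygons reduce to the same heptagon, up to the choice of the first vertex. -/
theorem ambientEquiv_necklacePolygon_braidPolygon :
    AmbientEquiv (closedPolygon necklacePolygon) (closedPolygon braidPolygon) := by
  have h₁ : (polygonRun necklaceMoves necklacePolygon).isSome = true := by decide +kernel
  have h₂ : (polygonRun necklaceMoves necklacePolygon).map (fun L => L.drop 3 ++ L.take 3) =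
      polygonRun ([0, 1, 2, 1, 1].map fun n => (n, none)) braidPolygon := by decide +kernel
  obtain ⟨L, hL⟩ := Option.isSome_iff_exists.1 h₁
  rw [hL, Option.map_some] at h₂
  refine (ambientEquiv_of_polygonRun hL).trans ?_
  rw [← List.take_append_drop 3 L, ← closedPolygon_rotate]
  exact (ambientEquiv_of_polygonRun h₂.symm).symm

/-! ### Closed braids on two strands -/

/-- The point with cylindrical coordinates `r`, `2 t`, `z`. -/
noncomputable def cylindrical (r t z : ℝ) : E3 :=
  !₂[r * Real.cos (2 * t), r * Real.sin (2 * t), z]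

theorem E3.norm_sq (x : E3) : ‖x‖ ^ 2 = x 0 ^ 2 + x 1 ^ 2 + x 2 ^ 2 := by
  rw [EuclideanSpace.norm_sq_eq, Fin.sum_univ_three]
  simp

/-- A closed braid on two strands, parametrized by half of the polar angle: the second strand passes
over the angle of the first one half a period later. -/
structure IsClosedBraid (c L : ℝ) (f : ℝ → E3) : Prop where
  periodic : Function.Periodic f (2 * Real.pi)
  lipschitz : ∀ s t, ‖f s - f t‖ ≤ L * |s - t|
  polar : ∀ t, ∃ r z, c ≤ r ∧ f t = cylindrical r t z

/-- The direction, in the half-plane of angle `2 t`, from the second strand of the standard trefoil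
to the first one. -/
noncomputable def strandDirection (t : ℝ) : E3 := cylindrical (Real.cos (3 * t)) t (Real.sin (3 * t))

theorem norm_strandDirection (t : ℝ) : ‖strandDirection t‖ = 1 := by
  have h : ‖strandDirection t‖ ^ 2 = 1 := by
    rw [E3.norm_sq]
    simp only [strandDirection, cylindrical, PiLp.toLp_apply, Matrix.cons_val]
    nlinarith [Real.sin_sq_add_cos_sq (3 * t), Real.sin_sq_add_cos_sq (2 * t)]
  nlinarith [norm_nonneg (strandDirection t)]

theorem norm_cylindrical_sub {c r r' z z' s t : ℝ} (hc : 0 < c) (hr : c ≤ r) (hr' : c ≤ r') :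
    2 * c * |Real.sin (s - t)| ≤ ‖cylindrical r s z - cylindrical r' t z'‖ := by
  apply abs_le_of_sq_le_sq' _ (norm_nonneg _) |>.2
  rw [E3.norm_sq, mul_pow, sq_abs]
  simp only [cylindrical, PiLp.sub_apply, Matrix.cons_val]
  have h1 : Real.sin (s - t) ^ 2 = (1 - Real.cos (2 * s - 2 * t)) / 2 := by
    rw [Real.sin_sq_eq_half_sub, mul_sub]; ring
  rw [h1, Real.cos_sub]
  have h2 := Real.cos_le_one (2 * s - 2 * t)
  rw [Real.cos_sub] at h2
  have h3 : c * c ≤ r * r' := mul_le_mul hr hr' hc.le (hc.le.trans hr)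
  set C := Real.cos (2 * s) * Real.cos (2 * t) + Real.sin (2 * s) * Real.sin (2 * t) with hC
  have h4 : (r * Real.cos (2 * s) - r' * Real.cos (2 * t)) ^ 2 +
      (r * Real.sin (2 * s) - r' * Real.sin (2 * t)) ^ 2 =
      (r - r') ^ 2 + 2 * (r * r') * (1 - C) := by
    rw [hC]
    linear_combination r ^ 2 * Real.sin_sq_add_cos_sq (2 * s) +
      r' ^ 2 * Real.sin_sq_add_cos_sq (2 * t)
  rw [h4]
  nlinarith [sq_nonneg (r - r'), sq_nonneg (z - z'), mul_nonneg (sub_nonneg.2 h3) (sub_nonneg.2 h2)]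

/-- Two closed braids on two strands whose strands are, at every angle, linked in directions that
form an acute angle with a common direction, are ambiently equivalent: the straight-line
isotopy between them is an isotopy of closed braids. -/
theorem ambientEquiv_of_isClosedBraid {c L d : ℝ} (hc : 0 < c) (hL : 0 < L) (hd : 0 < d)
    {f g : ℝ → E3} (hf : IsClosedBraid c L f) (hg : IsClosedBraid c L g)
    (hfd : ∀ t, d ≤ inner ℝ (strandDirection t) (f t - f (t + Real.pi)))
    (hgd : ∀ t, d ≤ inner ℝ (strandDirection t) (g t - g (t + Real.pi))) :
    AmbientEquiv (range f) (range g) := by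
  have hπ := Real.pi_pos
  set κ := 4 * c / Real.pi with hκ
  have hκ0 : 0 < κ := by positivity
  set m := d / (1 + L / κ) with hm
  have hm0 : 0 < m := by positivity
  apply ambientEquiv_of_linear_isotopy f g (2 * L / κ + 4 * L * Real.pi / m)
  intro r hr s t
  have hr0 := hr.1
  have hr1 := hr.2
  set F : ℝ → E3 := fun t => f t + r • (g t - f t) with hF
  have hFL : ∀ s t, ‖F s - F t‖ ≤ L * |s - t| := by
    intro s t
    have e : F s - F t = (1 - r) • (f s - f t) + r • (g s - g t) := by simp only [hF]; module
    rw [e]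
    refine (norm_add_le _ _).trans ?_
    rw [norm_smul, norm_smul, Real.norm_of_nonneg hr0, Real.norm_of_nonneg (by linarith)]
    nlinarith [hf.lipschitz s t, hg.lipschitz s t]
  have hΔL : ∀ s t, ‖(g s - f s) - (g t - f t)‖ ≤ 2 * L * |s - t| := by
    intro s t
    have e : (g s - f s) - (g t - f t) = (g s - g t) - (f s - f t) := by abel
    rw [e]
    refine (norm_sub_le _ _).trans ?_
    linarith [hf.lipschitz s t, hg.lipschitz s t]
  have hFp : ∀ t, ∃ ρ z, c ≤ ρ ∧ F t = cylindrical ρ t z := by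
    intro t
    obtain ⟨r₀, z₀, h₀, e₀⟩ := hf.polar t
    obtain ⟨r₁, z₁, h₁, e₁⟩ := hg.polar t
    refine ⟨(1 - r) * r₀ + r * r₁, (1 - r) * z₀ + r * z₁, by nlinarith, ?_⟩
    simp only [hF, e₀, e₁]
    ext i
    fin_cases i <;> simp [cylindrical] <;> ring
  have hFd : ∀ t, d ≤ ‖F t - F (t + Real.pi)‖ := by
    intro t
    have e : F t - F (t + Real.pi) = (1 - r) • (f t - f (t + Real.pi)) +
        r • (g t - g (t + Real.pi)) := by simp only [hF]; module
    have h1 := real_inner_le_norm (strandDirection t) (F t - F (t + Real.pi))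
    rw [norm_strandDirection, one_mul, e, inner_add_right, inner_smul_right, inner_smul_right,
      ← e] at h1
    refine le_trans ?_ h1
    nlinarith [hfd t, hgd t]
  -- compare with the parameter `t + n π` that is closest to `s`
  set n := round ((s - t) / Real.pi) with hn
  set δ := s - t - n * Real.pi with hδ
  have hδ2 : |δ| ≤ Real.pi / 2 := by
    have h1 := abs_sub_round ((s - t) / Real.pi)
    have h2 : δ = ((s - t) / Real.pi - n) * Real.pi := by
      rw [hδ, sub_mul, div_mul_cancel₀ _ hπ.ne']
    rw [h2, abs_mul, abs_of_pos hπ]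
    nlinarith
  have hlow : κ * |δ| ≤ ‖F s - F t‖ := by
    obtain ⟨ρ, z, hρ, e⟩ := hFp s
    obtain ⟨ρ', z', hρ', e'⟩ := hFp t
    rw [e, e']
    refine le_trans ?_ (norm_cylindrical_sub hc hρ hρ')
    have h1 : |Real.sin (s - t)| = |Real.sin δ| := by
      rw [hδ, Real.sin_sub_int_mul_pi, abs_mul, abs_zpow, abs_neg, abs_one, one_zpow, one_mul]
    have h2 : 2 / Real.pi * |δ| ≤ |Real.sin δ| := Real.mul_abs_le_abs_sin hδ2
    rw [h1, hκ]
    calc 4 * c / Real.pi * |δ| = 2 * c * (2 / Real.pi * |δ|) := by ring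
      _ ≤ _ := by gcongr
  have hX := norm_nonneg (F s - F t)
  have hA : 0 ≤ 2 * L / κ * ‖F s - F t‖ := by positivity
  have hB : 0 ≤ 4 * L * Real.pi / m * ‖F s - F t‖ := by positivity
  change _ ≤ _ * ‖F s - F t‖
  rw [add_mul]
  rcases Int.even_or_odd' n with ⟨j, hj | hj⟩
  · -- the same strand
    have ht : ∀ φ : ℝ → E3, Function.Periodic φ (2 * Real.pi) → φ t = φ (t + n * Real.pi) := by
      intro φ hφ
      have := hφ.int_mul j t
      rw [← this, hj]
      congr 1
      push_cast
      ring
    have h1 := hΔL s (t + n * Real.pi)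
    rw [← ht f hf.periodic, ← ht g hg.periodic, show s - (t + n * Real.pi) = δ by rw [hδ]; ring]
      at h1
    have h2 : 2 * L * |δ| ≤ 2 * L / κ * ‖F s - F t‖ := by
      rw [div_mul_eq_mul_div, le_div_iff₀ hκ0]
      nlinarith
    linarith
  · -- different strands
    have ht : ∀ φ : ℝ → E3, Function.Periodic φ (2 * Real.pi) →
        φ t = φ (t + n * Real.pi + Real.pi) := by
      intro φ hφ
      have := hφ.int_mul (j + 1) t
      rw [← this, hj]
      congr 1
      push_cast
      ring
    have h1 := hΔL s (t + n * Real.pi + Real.pi)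
    rw [← ht f hf.periodic, ← ht g hg.periodic,
      show s - (t + n * Real.pi + Real.pi) = δ - Real.pi by rw [hδ]; ring] at h1
    have h2 : |δ - Real.pi| ≤ 2 * Real.pi := by
      rw [abs_le] at hδ2 ⊢
      constructor <;> linarith
    have h3 : d - L * |δ| ≤ ‖F s - F t‖ := by
      have h4 := hFL (s + Real.pi) (t + n * Real.pi + Real.pi)
      rw [show s + Real.pi - (t + n * Real.pi + Real.pi) = δ by rw [hδ]; ring] at h4
      have h5 : F (t + n * Real.pi + Real.pi) = F t := by
        simp only [hF, ← ht f hf.periodic, ← ht g hg.periodic]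
      rw [h5] at h4
      have h6 := norm_sub_le_norm_sub_add_norm_sub (F s) (F t) (F (s + Real.pi))
      rw [norm_sub_rev (F t)] at h6
      linarith [hFd s]
    have h4 : m ≤ ‖F s - F t‖ := by
      rw [hm, div_le_iff₀ (by positivity), mul_add, mul_one, mul_div_assoc', add_comm]
      have h5 : L * |δ| ≤ ‖F s - F t‖ * L / κ := by
        rw [le_div_iff₀ hκ0]
        nlinarith
      linarith
    have h5 : 4 * L * Real.pi ≤ 4 * L * Real.pi / m * ‖F s - F t‖ := by
      rw [div_mul_eq_mul_div, le_div_iff₀ hm0]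
      exact mul_le_mul_of_nonneg_left h4 (by positivity)
    have h6 : 2 * L * |δ - Real.pi| ≤ 2 * L * (2 * Real.pi) :=
      mul_le_mul_of_nonneg_left h2 (by positivity)
    linarith

/-- A function on the line that is Lipschitz on each cell of a partition into intervals of equal
length is Lipschitz. -/
theorem lipschitz_of_cells {X : Type*} [PseudoMetricSpace X] {f : ℝ → X} {h L : ℝ} (hh : 0 < h)
    (hf : ∀ k : ℤ, ∀ x ∈ Icc (k * h) ((k + 1) * h), ∀ y ∈ Icc (k * h) ((k + 1) * h),
      dist (f x) (f y) ≤ L * |x - y|) (x y : ℝ) : dist (f x) (f y) ≤ L * |x - y| := by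
  have key : ∀ k m : ℤ, k ≤ m → ∀ x ∈ Icc (k * h) ((k + 1) * h),
      ∀ y ∈ Icc (m * h) ((m + 1) * h), x ≤ y → dist (f x) (f y) ≤ L * |x - y| := by
    intro k m hkm x hx
    induction m, hkm using Int.leInduction with
    | base => exact fun y hy _ => hf k x hx y hy
    | succ m hm ih =>
      intro y hy hxy
      push_cast at hy
      have hkm : ((k : ℝ) + 1) ≤ m + 1 := by exact_mod_cast Int.add_le_add_right hm 1
      have hx' : x ≤ (m + 1) * h := hx.2.trans (mul_le_mul_of_nonneg_right hkm hh.le)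
      have h1 := ih ((m + 1) * h) ⟨by nlinarith, le_rfl⟩ hx'
      have h2 := hf (m + 1) ((m + 1) * h) ⟨by push_cast; rfl, by push_cast; nlinarith⟩ y
        (by push_cast; exact hy)
      refine (dist_triangle _ _ _).trans ((add_le_add h1 h2).trans ?_)
      rw [abs_of_nonpos (by linarith), abs_of_nonpos (by linarith [hy.1]),
        abs_of_nonpos (by linarith)]
      linarith
  have hcell : ∀ x : ℝ, x ∈ Icc (⌊x / h⌋ * h) ((⌊x / h⌋ + 1) * h) := fun x =>
    ⟨(le_div_iff₀ hh).1 (Int.floor_le _), ((div_lt_iff₀ hh).1 (Int.lt_floor_add_one _)).le⟩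
  rcases le_total x y with hxy | hxy
  · exact key _ _ (Int.floor_le_floor (by gcongr)) x (hcell x) y (hcell y) hxy
  · rw [dist_comm, abs_sub_comm]
    exact key _ _ (Int.floor_le_floor (by gcongr)) y (hcell y) x (hcell x) hxy

/-! ### The standard trefoil as a closed braid -/

/-- The parametrization of the standard trefoil. -/
noncomputable def trefoilCurve (t : ℝ) : E3 := cylindrical (2 + Real.cos (3 * t)) t (Real.sin (3 * t))

theorem abs_cos_sub_cos_le (x y : ℝ) : |Real.cos x - Real.cos y| ≤ |x - y| := by
  rw [Real.cos_sub_cos]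
  have h1 := Real.abs_sin_le_one ((x + y) / 2)
  have h2 := Real.abs_sin_le_abs (x := (x - y) / 2)
  rw [abs_div, abs_two] at h2
  rw [abs_mul, abs_mul, abs_neg, abs_two]
  nlinarith [abs_nonneg (Real.sin ((x - y) / 2)), abs_nonneg (Real.sin ((x + y) / 2))]

theorem abs_sin_sub_sin_le (x y : ℝ) : |Real.sin x - Real.sin y| ≤ |x - y| := by
  rw [← Real.cos_pi_div_two_sub, ← Real.cos_pi_div_two_sub y]
  refine (abs_cos_sub_cos_le _ _).trans (le_of_eq ?_)
  rw [abs_sub_comm]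
  congr 1
  ring

theorem E3.norm_le (x : E3) : ‖x‖ ≤ |x 0| + |x 1| + |x 2| := by
  apply abs_le_of_sq_le_sq' _ (by positivity) |>.2
  rw [E3.norm_sq, ← sq_abs (x 0), ← sq_abs (x 1), ← sq_abs (x 2)]
  nlinarith [abs_nonneg (x 0), abs_nonneg (x 1), abs_nonneg (x 2),
    mul_nonneg (abs_nonneg (x 0)) (abs_nonneg (x 1)),
    mul_nonneg (abs_nonneg (x 0)) (abs_nonneg (x 2)),
    mul_nonneg (abs_nonneg (x 1)) (abs_nonneg (x 2))]

theorem abs_mul_sub_mul_le {a b a' b' : ℝ} (A B : ℝ) (ha : |a| ≤ A) (hb : |b'| ≤ B) :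
    |a * b - a' * b'| ≤ A * |b - b'| + B * |a - a'| := by
  rw [show a * b - a' * b' = a * (b - b') + b' * (a - a') by ring]
  refine (abs_add_le _ _).trans ?_
  rw [abs_mul, abs_mul]
  gcongr

theorem isClosedBraid_trefoilCurve : IsClosedBraid (1 / 20) 1000 trefoilCurve where
  periodic := by
    intro t
    simp only [trefoilCurve, cylindrical]
    rw [show 3 * (t + 2 * Real.pi) = 3 * t + (3 : ℕ) * (2 * Real.pi) by push_cast; ring,
      show 2 * (t + 2 * Real.pi) = 2 * t + (2 : ℕ) * (2 * Real.pi) by push_cast; ring]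
    simp only [Real.cos_add_nat_mul_two_pi, Real.sin_add_nat_mul_two_pi]
  lipschitz := by
    intro s t
    refine (E3.norm_le _).trans ?_
    simp only [trefoilCurve, cylindrical, PiLp.sub_apply, Matrix.cons_val]
    have hr : |2 + Real.cos (3 * s)| ≤ 3 := by
      rw [abs_le]
      constructor <;> linarith [Real.neg_one_le_cos (3 * s), Real.cos_le_one (3 * s)]
    have h1 := abs_mul_sub_mul_le (b := Real.cos (2 * s)) (a' := 2 + Real.cos (3 * t)) 3 1 hr
      (Real.abs_cos_le_one (2 * t))
    have h2 := abs_mul_sub_mul_le (b := Real.sin (2 * s)) (a' := 2 + Real.cos (3 * t)) 3 1 hr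
      (Real.abs_sin_le_one (2 * t))
    have h3 : |2 + Real.cos (3 * s) - (2 + Real.cos (3 * t))| ≤ 3 * |s - t| := by
      rw [add_sub_add_left_eq_sub]
      refine (abs_cos_sub_cos_le _ _).trans (le_of_eq ?_)
      rw [← mul_sub, abs_mul, abs_of_pos three_pos]
    have h4 := abs_cos_sub_cos_le (2 * s) (2 * t)
    have h5 := abs_sin_sub_sin_le (2 * s) (2 * t)
    have h6 := abs_sin_sub_sin_le (3 * s) (3 * t)
    rw [← mul_sub, abs_mul, abs_two] at h4 h5
    rw [← mul_sub, abs_mul, abs_of_pos (show (0 : ℝ) < 3 by norm_num)] at h6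
    linarith [abs_nonneg (s - t)]
  polar := fun t => ⟨_, _, by linarith [Real.neg_one_le_cos (3 * t)], rfl⟩

theorem inner_strandDirection (r r' z z' t : ℝ) :
    inner ℝ (strandDirection t) (cylindrical r t z - cylindrical r' (t + Real.pi) z') =
      Real.cos (3 * t) * (r - r') + Real.sin (3 * t) * (z - z') := by
  have h1 : Real.cos (2 * (t + Real.pi)) = Real.cos (2 * t) := by
    rw [mul_add, Real.cos_add_two_pi]
  have h2 : Real.sin (2 * (t + Real.pi)) = Real.sin (2 * t) := by
    rw [mul_add, Real.sin_add_two_pi]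
  simp only [PiLp.inner_apply, Fin.sum_univ_three, strandDirection, cylindrical, PiLp.sub_apply,
    Matrix.cons_val, h1, h2]
  simp only [RCLike.inner_apply, conj_trivial]
  linear_combination (Real.cos (3 * t) * (r - r')) * Real.sin_sq_add_cos_sq (2 * t)

/-- The two strands of the trefoil differ by `2` in the direction `strandDirection t`. -/
theorem trefoilCurve_strandDirection (t : ℝ) :
    (2 : ℝ) ≤ inner ℝ (strandDirection t) (trefoilCurve t - trefoilCurve (t + Real.pi)) := by
  rw [trefoilCurve, trefoilCurve, inner_strandDirection,
    show 3 * (t + Real.pi) = 3 * t + Real.pi + 2 * Real.pi by ring, Real.cos_add_two_pi,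
    Real.sin_add_two_pi, Real.cos_add_pi, Real.sin_add_pi]
  nlinarith [Real.sin_sq_add_cos_sq (3 * t)]

/-! ### A twelve-sided closed braid -/

/-- The distance of the `k`-th vertex from the axis. -/
noncomputable def braidRadius (k : ℤ) : ℝ :=
  if k % 4 = 0 then 3 else if k % 4 = 2 then 1 / 10 else 2

/-- The height of the `k`-th vertex. -/
noncomputable def braidHeight (k : ℤ) : ℝ :=
  if k % 4 = 1 then 1 else if k % 4 = 3 then -1 else 0

/-- The vertices of the polygonal trefoil.  Successive vertices are `π / 3` apart in angle, and at
the angles of the vertices the strands are linked as for the standard trefoil. -/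
noncomputable def braidVertex (k : ℤ) : E3 := cylindrical (braidRadius k) (k * (Real.pi / 6)) (braidHeight k)

theorem braidRadius_mem (k : ℤ) : 1 / 10 ≤ braidRadius k ∧ braidRadius k ≤ 3 := by
  unfold braidRadius
  split_ifs <;> norm_num

theorem abs_braidHeight_le (k : ℤ) : |braidHeight k| ≤ 1 := by
  unfold braidHeight
  split_ifs <;> norm_num

/-- Barycentric weight of the left end of a sector of angle `π / 3`, at the angle `2 x` from it. -/
noncomputable def sectorLeft (x : ℝ) : ℝ := Real.sin (Real.pi / 3 - 2 * x)

/-- Barycentric weight of the right end of a sector of angle `π / 3`, at the angle `2 x` from the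
left end. -/
noncomputable def sectorRight (x : ℝ) : ℝ := Real.sin (2 * x)

theorem sectorLeft_nonneg {x : ℝ} (hx : x ∈ Icc 0 (Real.pi / 6)) : 0 ≤ sectorLeft x :=
  Real.sin_nonneg_of_nonneg_of_le_pi (by linarith [hx.2]) (by linarith [hx.1, Real.pi_pos])

theorem sectorRight_nonneg {x : ℝ} (hx : x ∈ Icc 0 (Real.pi / 6)) : 0 ≤ sectorRight x :=
  Real.sin_nonneg_of_nonneg_of_le_pi (by linarith [hx.1]) (by linarith [hx.2, Real.pi_pos])

theorem half_le_sector {x : ℝ} (hx : x ∈ Icc 0 (Real.pi / 6)) :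
    (1 / 2 ≤ sectorLeft x ∧ x ≤ Real.pi / 12) ∨ (1 / 2 ≤ sectorRight x ∧ Real.pi / 12 ≤ x) := by
  have hπ := Real.pi_pos
  rcases le_total x (Real.pi / 12) with h | h
  · left
    refine ⟨?_, h⟩
    rw [← Real.sin_pi_div_six]
    exact Real.sin_le_sin_of_le_of_le_pi_div_two (by linarith) (by linarith [hx.1]) (by linarith)
  · right
    refine ⟨?_, h⟩
    rw [← Real.sin_pi_div_six]
    exact Real.sin_le_sin_of_le_of_le_pi_div_two (by linarith) (by linarith [hx.2]) (by linarith)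

/-- The harmonic weight which appears as denominator when an edge is parametrized by the angle. -/
noncomputable def sectorDenom (k : ℤ) (x : ℝ) : ℝ :=
  sectorLeft x * braidRadius (k + 1) + sectorRight x * braidRadius k

theorem sectorDenom_ge (k : ℤ) {x : ℝ} (hx : x ∈ Icc 0 (Real.pi / 6)) :
    1 / 20 ≤ sectorDenom k x := by
  have h1 := sectorLeft_nonneg hx
  have h2 := sectorRight_nonneg hx
  have h3 := (braidRadius_mem k).1
  have h4 := (braidRadius_mem (k + 1)).1
  unfold sectorDenom
  rcases half_le_sector hx with h | h <;> nlinarith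

theorem sectorDenom_le (k : ℤ) {x : ℝ} (hx : x ∈ Icc 0 (Real.pi / 6)) : sectorDenom k x ≤ 6 := by
  have h3 := (braidRadius_mem k)
  have h4 := (braidRadius_mem (k + 1))
  have h1 := sectorLeft_nonneg hx
  have h2 := sectorRight_nonneg hx
  have h5 : sectorLeft x ≤ 1 := Real.sin_le_one _
  have h6 : sectorRight x ≤ 1 := Real.sin_le_one _
  unfold sectorDenom
  nlinarith

/-- The position on the `k`-th edge at the angle `2 x` from the `k`-th vertex. -/
noncomputable def edgeParameter (k : ℤ) (x : ℝ) : ℝ :=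
  sectorRight x * braidRadius k / sectorDenom k x

/-- The distance from the axis of the point of the `k`-th edge at the angle `2 x` from the `k`-th
vertex. -/
noncomputable def edgeRadius (k : ℤ) (x : ℝ) : ℝ :=
  Real.sin (Real.pi / 3) * (braidRadius k * braidRadius (k + 1)) / sectorDenom k x

/-- The height of the point of the `k`-th edge at the angle `2 x` from the `k`-th vertex. -/
noncomputable def edgeHeight (k : ℤ) (x : ℝ) : ℝ :=
  (sectorLeft x * braidRadius (k + 1) * braidHeight k +
    sectorRight x * braidRadius k * braidHeight (k + 1)) / sectorDenom k x

theorem edgeParameter_mem (k : ℤ) {x : ℝ} (hx : x ∈ Icc 0 (Real.pi / 6)) :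
    edgeParameter k x ∈ Icc (0 : ℝ) 1 := by
  have h1 := sectorLeft_nonneg hx
  have h2 := sectorRight_nonneg hx
  have h3 := (braidRadius_mem k).1
  have h4 := (braidRadius_mem (k + 1)).1
  have h5 := sectorDenom_ge k hx
  refine ⟨div_nonneg (by nlinarith) (by linarith), ?_⟩
  rw [edgeParameter, div_le_one (by linarith), sectorDenom]
  nlinarith

theorem edgePoint_eq (k : ℤ) {x : ℝ} (hx : x ∈ Icc 0 (Real.pi / 6)) :
    braidVertex k + edgeParameter k x • (braidVertex (k + 1) - braidVertex k) =
      cylindrical (edgeRadius k x) (k * (Real.pi / 6) + x) (edgeHeight k x) := by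
  have h5 := sectorDenom_ge k hx
  have h6 : sectorDenom k x ≠ 0 := by linarith
  set a : ℝ := 2 * (k * (Real.pi / 6)) with ha
  have e1 : 2 * (((k + 1 : ℤ) : ℝ) * (Real.pi / 6)) = a + Real.pi / 3 := by
    rw [ha]; push_cast; ring
  have e2 : 2 * (k * (Real.pi / 6) + x) = a + 2 * x := by rw [ha]; ring
  have hs : Real.sin (Real.pi / 3) * Real.cos (2 * x) =
      sectorLeft x + sectorRight x * Real.cos (Real.pi / 3) := by
    rw [sectorLeft, sectorRight, Real.sin_sub]
    ring
  have h1 : edgeParameter k x * sectorDenom k x = sectorRight x * braidRadius k :=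
    div_mul_cancel₀ _ h6
  have h2 : edgeRadius k x * sectorDenom k x =
      Real.sin (Real.pi / 3) * (braidRadius k * braidRadius (k + 1)) := div_mul_cancel₀ _ h6
  have h3 : edgeHeight k x * sectorDenom k x = sectorLeft x * braidRadius (k + 1) * braidHeight k +
    sectorRight x * braidRadius k * braidHeight (k + 1) := div_mul_cancel₀ _ h6
  ext i
  fin_cases i
  · simp only [braidVertex, cylindrical, PiLp.add_apply, PiLp.smul_apply, PiLp.sub_apply,
      Fin.zero_eta, Fin.isValue, Matrix.cons_val, smul_eq_mul, e1, e2, ← ha, Real.cos_add]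
    apply mul_right_cancel₀ h6
    simp only [sectorDenom] at *
    have hd : Real.sin (2 * x) = sectorRight x := rfl
    rw [hd]
    linear_combination
      (braidRadius (k + 1) * (Real.cos a * Real.cos (Real.pi / 3) - Real.sin a * Real.sin (Real.pi / 3))
        - braidRadius k * Real.cos a) * h1 -
      (Real.cos a * Real.cos (2 * x) - Real.sin a * sectorRight x) * h2 -
      (braidRadius k * braidRadius (k + 1) * Real.cos a) * hs
  · simp only [braidVertex, cylindrical, PiLp.add_apply, PiLp.smul_apply, PiLp.sub_apply,
      Fin.mk_one, Fin.isValue, Matrix.cons_val, smul_eq_mul, e1, e2, ← ha, Real.sin_add]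
    apply mul_right_cancel₀ h6
    simp only [sectorDenom] at *
    have hd : Real.sin (2 * x) = sectorRight x := rfl
    rw [hd]
    linear_combination
      (braidRadius (k + 1) * (Real.sin a * Real.cos (Real.pi / 3) + Real.cos a * Real.sin (Real.pi / 3))
        - braidRadius k * Real.sin a) * h1 -
      (Real.sin a * Real.cos (2 * x) + Real.cos a * sectorRight x) * h2 -
      (braidRadius k * braidRadius (k + 1) * Real.sin a) * hs
  · simp only [braidVertex, cylindrical, PiLp.add_apply, PiLp.smul_apply, PiLp.sub_apply,
      Fin.reduceFinMk, Fin.isValue, Matrix.cons_val, smul_eq_mul]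
    apply mul_right_cancel₀ h6
    simp only [sectorDenom] at *
    linear_combination (braidHeight (k + 1) - braidHeight k) * h1 - h3

theorem edgeRadius_ge (k : ℤ) {x : ℝ} (hx : x ∈ Icc 0 (Real.pi / 6)) : 1 / 1200 ≤ edgeRadius k x := by
  have h1 := sectorDenom_ge k hx
  have h2 := sectorDenom_le k hx
  have h3 := (braidRadius_mem k).1
  have h4 := (braidRadius_mem (k + 1)).1
  have h5 : (1 : ℝ) / 2 ≤ Real.sin (Real.pi / 3) := by
    rw [← Real.sin_pi_div_six]
    exact Real.sin_le_sin_of_le_of_le_pi_div_two (by linarith [Real.pi_pos])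
      (by linarith [Real.pi_pos]) (by linarith [Real.pi_pos])
  rw [edgeRadius, le_div_iff₀ (by linarith)]
  have h6 : 1 / 100 ≤ braidRadius k * braidRadius (k + 1) := by nlinarith
  nlinarith

theorem abs_edgeParameter_sub_le (k : ℤ) {x y : ℝ} (hx : x ∈ Icc 0 (Real.pi / 6))
    (hy : y ∈ Icc 0 (Real.pi / 6)) : |edgeParameter k x - edgeParameter k y| ≤ 7200 * |x - y| := by
  have hx1 := sectorDenom_ge k hx
  have hy1 := sectorDenom_ge k hy
  have h3 := braidRadius_mem k
  have h4 := braidRadius_mem (k + 1)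
  have e : edgeParameter k x - edgeParameter k y = braidRadius k * braidRadius (k + 1) *
      (Real.sin (Real.pi / 3) * Real.sin (2 * (x - y))) / (sectorDenom k x * sectorDenom k y) := by
    rw [edgeParameter, edgeParameter, div_sub_div _ _ (by linarith) (by linarith)]
    congr 1
    simp only [sectorDenom, sectorLeft, sectorRight, Real.sin_sub, mul_sub]
    ring
  rw [e, abs_div, abs_mul, abs_mul, abs_mul, abs_of_nonneg (by linarith : 0 ≤ braidRadius k),
    abs_of_nonneg (by linarith : 0 ≤ braidRadius (k + 1)),
    abs_of_nonneg (by nlinarith : 0 ≤ sectorDenom k x * sectorDenom k y),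
    div_le_iff₀ (by nlinarith)]
  have h5 := Real.abs_sin_le_one (Real.pi / 3)
  have h6 := Real.abs_sin_le_abs (x := 2 * (x - y))
  rw [abs_mul, abs_two] at h6
  have h7 : |Real.sin (Real.pi / 3)| * |Real.sin (2 * (x - y))| ≤ 1 * (2 * |x - y|) :=
    mul_le_mul h5 h6 (abs_nonneg _) zero_le_one
  have h8 : braidRadius k * braidRadius (k + 1) ≤ 3 * 3 :=
    mul_le_mul h3.2 h4.2 (by linarith) (by norm_num)
  have h9 : 1 / 20 * (1 / 20) ≤ sectorDenom k x * sectorDenom k y :=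
    mul_le_mul hx1 hy1 (by norm_num) (by linarith)
  calc braidRadius k * braidRadius (k + 1) * (|Real.sin (Real.pi / 3)| * |Real.sin (2 * (x - y))|)
      ≤ 3 * 3 * (1 * (2 * |x - y|)) := by
        refine mul_le_mul h8 h7 (by positivity) (by norm_num)
    _ ≤ 7200 * |x - y| * (1 / 20 * (1 / 20)) := by linarith [abs_nonneg (x - y)]
    _ ≤ _ := mul_le_mul_of_nonneg_left h9 (by positivity)

/-- The polygonal trefoil, parametrized by half of the polar angle. -/
noncomputable def braidCurve (t : ℝ) : E3 :=
  braidVertex ⌊t / (Real.pi / 6)⌋ +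
    edgeParameter ⌊t / (Real.pi / 6)⌋ (t - ⌊t / (Real.pi / 6)⌋ * (Real.pi / 6)) •
      (braidVertex (⌊t / (Real.pi / 6)⌋ + 1) - braidVertex ⌊t / (Real.pi / 6)⌋)

theorem edgeParameter_zero (k : ℤ) : edgeParameter k 0 = 0 := by
  simp [edgeParameter, sectorRight]

theorem edgeParameter_end (k : ℤ) : edgeParameter k (Real.pi / 6) = 1 := by
  have h1 := sectorDenom_ge k (x := Real.pi / 6) ⟨by positivity, le_rfl⟩
  have h2 : sectorLeft (Real.pi / 6) = 0 := by
    rw [sectorLeft, show Real.pi / 3 - 2 * (Real.pi / 6) = 0 by ring, Real.sin_zero]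
  have h3 : sectorDenom k (Real.pi / 6) = sectorRight (Real.pi / 6) * braidRadius k := by
    rw [sectorDenom, h2, zero_mul, zero_add]
  rw [edgeParameter, ← h3, div_self (by linarith)]

/-- The formula for `braidCurve` on a half-open cell also holds at the right end-point. -/
theorem braidCurve_eq (k : ℤ) {t : ℝ} (ht : t ∈ Icc (k * (Real.pi / 6)) ((k + 1) * (Real.pi / 6))) :
    braidCurve t = braidVertex k + edgeParameter k (t - k * (Real.pi / 6)) •
      (braidVertex (k + 1) - braidVertex k) := by
  have hπ : 0 < Real.pi / 6 := by positivity
  rcases ht.2.eq_or_lt with h | h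
  · have hk : ⌊t / (Real.pi / 6)⌋ = k + 1 := by
      rw [h, mul_div_cancel_right₀ _ hπ.ne']
      exact_mod_cast Int.floor_intCast (k + 1)
    have e1 : t - ((k + 1 : ℤ) : ℝ) * (Real.pi / 6) = 0 := by push_cast; linarith
    have e2 : t - (k : ℝ) * (Real.pi / 6) = Real.pi / 6 := by linarith
    rw [braidCurve, hk, e1, e2, edgeParameter_zero, edgeParameter_end]
    module
  · have hk : ⌊t / (Real.pi / 6)⌋ = k := by
      rw [Int.floor_eq_iff, le_div_iff₀ hπ, div_lt_iff₀ hπ]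
      exact ⟨ht.1, h⟩
    rw [braidCurve, hk]

theorem mem_cell (t : ℝ) : t ∈ Icc (⌊t / (Real.pi / 6)⌋ * (Real.pi / 6))
    ((⌊t / (Real.pi / 6)⌋ + 1) * (Real.pi / 6)) := by
  have hπ : 0 < Real.pi / 6 := by positivity
  exact ⟨(le_div_iff₀ hπ).1 (Int.floor_le _), ((div_lt_iff₀ hπ).1 (Int.lt_floor_add_one _)).le⟩

theorem sub_mem_of_mem_cell {k : ℤ} {t : ℝ}
    (ht : t ∈ Icc (k * (Real.pi / 6)) ((k + 1) * (Real.pi / 6))) :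
    t - k * (Real.pi / 6) ∈ Icc 0 (Real.pi / 6) :=
  ⟨by linarith [ht.1], by linarith [ht.2]⟩

theorem braidCurve_eq_cylindrical (k : ℤ) {t : ℝ}
    (ht : t ∈ Icc (k * (Real.pi / 6)) ((k + 1) * (Real.pi / 6))) :
    braidCurve t = cylindrical (edgeRadius k (t - k * (Real.pi / 6))) t
      (edgeHeight k (t - k * (Real.pi / 6))) := by
  rw [braidCurve_eq k ht, edgePoint_eq k (sub_mem_of_mem_cell ht), add_sub_cancel]

theorem norm_braidVertex_le (k : ℤ) : ‖braidVertex k‖ ≤ 7 := by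
  refine (E3.norm_le _).trans ?_
  simp only [braidVertex, cylindrical, Matrix.cons_val]
  have h1 := braidRadius_mem k
  have h2 := abs_braidHeight_le k
  rw [abs_mul, abs_mul, abs_of_nonneg (by linarith : 0 ≤ braidRadius k)]
  have h3 := Real.abs_cos_le_one (2 * (k * (Real.pi / 6)))
  have h4 := Real.abs_sin_le_one (2 * (k * (Real.pi / 6)))
  nlinarith

theorem braidRadius_add (k j : ℤ) : braidRadius (k + 4 * j) = braidRadius k := by
  simp [braidRadius]

theorem braidHeight_add (k j : ℤ) : braidHeight (k + 4 * j) = braidHeight k := by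
  simp [braidHeight]

theorem braidVertex_add_twelve (k : ℤ) : braidVertex (k + 12) = braidVertex k := by
  have h1 := braidRadius_add k 3
  have h2 := braidHeight_add k 3
  norm_num at h1 h2
  rw [braidVertex, braidVertex, h1, h2, cylindrical, cylindrical]
  rw [show 2 * (((k + 12 : ℤ) : ℝ) * (Real.pi / 6)) = 2 * (k * (Real.pi / 6)) + (2 : ℕ) * (2 * Real.pi) by
    push_cast; ring, Real.cos_add_nat_mul_two_pi, Real.sin_add_nat_mul_two_pi]

theorem braidCurve_periodic : Function.Periodic braidCurve (2 * Real.pi) := by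
  intro t
  have hk := mem_cell t
  set k := ⌊t / (Real.pi / 6)⌋
  have hk' : t + 2 * Real.pi ∈ Icc (((k + 12 : ℤ) : ℝ) * (Real.pi / 6))
      ((((k + 12 : ℤ) : ℝ) + 1) * (Real.pi / 6)) := by
    push_cast
    constructor <;> linarith [hk.1, hk.2]
  have h1 := braidRadius_add k 3
  have h2 := braidRadius_add (k + 1) 3
  norm_num at h1 h2
  rw [braidCurve_eq _ hk', braidCurve_eq _ hk, braidVertex_add_twelve,
    show k + 12 + 1 = k + 1 + 12 by ring, braidVertex_add_twelve]
  congr 2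
  rw [show t + 2 * Real.pi - ((k + 12 : ℤ) : ℝ) * (Real.pi / 6) = t - k * (Real.pi / 6) by
    push_cast; ring]
  simp only [edgeParameter, sectorDenom]
  rw [show k + 12 + 1 = k + 1 + 12 by ring, h1, h2]

theorem isClosedBraid_braidCurve : IsClosedBraid (1 / 1200) 100800 braidCurve where
  periodic := braidCurve_periodic
  lipschitz := by
    intro s t
    rw [← dist_eq_norm]
    refine lipschitz_of_cells (h := Real.pi / 6) (by positivity) ?_ s t
    intro k x hx y hy
    rw [dist_eq_norm, braidCurve_eq k hx, braidCurve_eq k hy, add_sub_add_left_eq_sub, ← sub_smul,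
      norm_smul, Real.norm_eq_abs]
    have h1 := abs_edgeParameter_sub_le k (sub_mem_of_mem_cell hx) (sub_mem_of_mem_cell hy)
    rw [sub_sub_sub_cancel_right] at h1
    have h2 : ‖braidVertex (k + 1) - braidVertex k‖ ≤ 14 := by
      refine (norm_sub_le _ _).trans ?_
      linarith [norm_braidVertex_le k, norm_braidVertex_le (k + 1)]
    calc _ ≤ 7200 * |x - y| * 14 := mul_le_mul h1 h2 (norm_nonneg _) (by positivity)
      _ = 100800 * |x - y| := by ring
  polar := fun t =>
    ⟨_, _, edgeRadius_ge _ (sub_mem_of_mem_cell (mem_cell t)), braidCurve_eq_cylindrical _ (mem_cell t)⟩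

theorem half_le_cos_or_sin {x : ℝ} (hx : x ∈ Icc 0 (Real.pi / 6)) :
    0 ≤ Real.cos (3 * x) ∧ 0 ≤ Real.sin (3 * x) ∧
    (x ≤ Real.pi / 12 → 1 / 2 ≤ Real.cos (3 * x)) ∧
    (Real.pi / 12 ≤ x → 1 / 2 ≤ Real.sin (3 * x)) := by
  have hπ := Real.pi_pos
  have h1 := hx.1
  have h2 := hx.2
  refine ⟨Real.cos_nonneg_of_mem_Icc ⟨by linarith, by linarith⟩,
    Real.sin_nonneg_of_nonneg_of_le_pi (by linarith) (by linarith), fun h => ?_, fun h => ?_⟩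
  · rw [← Real.cos_pi_div_three]
    exact Real.cos_le_cos_of_nonneg_of_le_pi (by linarith) (by linarith) (by linarith)
  · rw [← Real.sin_pi_div_six]
    exact Real.sin_le_sin_of_le_of_le_pi_div_two (by linarith) (by linarith) (by linarith)

/-- The lower bound for the linking of the strands, for weights `c`, `s` of the radial and of the
vertical direction: `u` is the weight of the vertex at which the linking is radial. -/
theorem linking_bound {u v c s S p q r₁ r₂ h₁ h₂ : ℝ} (hc : 0 ≤ c) (hs : 0 ≤ s)
    (hu : 0 ≤ u) (hv : 0 ≤ v) (hS : 1 / 2 ≤ S) (h : (1 / 2 ≤ u ∧ 1 / 2 ≤ c) ∨ (1 / 2 ≤ v ∧ 1 / 2 ≤ s))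
    (hp : p = 2 * u + 3 * v) (hq : q = 2 * u + 1 / 10 * v) (hp0 : 0 < p) (hq0 : 0 < q)
    (hp6 : p ≤ 6) (h1 : r₁ = S * 6 / p) (h2 : r₂ = S * (1 / 5) / q)
    (h3 : h₁ = 3 * v / p) (h4 : h₂ = -(1 / 10 * v) / q) :
    1 / 40 ≤ c * (r₁ - r₂) + s * (h₁ - h₂) := by
  have e1 : u / 10 ≤ r₁ - r₂ := by
    rw [h1, h2, div_sub_div _ _ hp0.ne' hq0.ne', le_div_iff₀ (by positivity)]
    have : p * q ≤ 36 := by nlinarith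
    have h5 : u / 10 * (p * q) ≤ u / 10 * 36 := by gcongr
    have h6 : S * 6 * q - p * (S * (1 / 5)) = S * (58 / 5 * u) := by rw [hp, hq]; ring
    rw [h6]
    nlinarith
  have e2 : v / 10 ≤ h₁ - h₂ := by
    have h5 : h₂ ≤ 0 := by
      rw [h4]
      exact div_nonpos_of_nonpos_of_nonneg (by linarith) hq0.le
    have h6 : v / 10 ≤ h₁ := by
      rw [h3, le_div_iff₀ hp0]
      nlinarith
    linarith
  have e3 : c * (u / 10) + s * (v / 10) ≤ c * (r₁ - r₂) + s * (h₁ - h₂) := by gcongr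
  refine le_trans ?_ e3
  have e4 := mul_nonneg hc hu
  have e5 := mul_nonneg hs hv
  rcases h with ⟨h, h'⟩ | ⟨h, h'⟩
  · nlinarith [mul_le_mul h' h (by norm_num) hc]
  · nlinarith [mul_le_mul h' h (by norm_num) hs]

/-- The two strands of the twelve-sided braid are separated in the same rotating direction as those of
the trefoil, so that the linear isotopy between the braids keeps the strands apart. -/
theorem braidCurve_strandDirection (t : ℝ) :
    (1 / 40 : ℝ) ≤ inner ℝ (strandDirection t) (braidCurve t - braidCurve (t + Real.pi)) := by
  have hk := mem_cell t
  set k := ⌊t / (Real.pi / 6)⌋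
  have hk' : t + Real.pi ∈ Icc (((k + 6 : ℤ) : ℝ) * (Real.pi / 6))
      ((((k + 6 : ℤ) : ℝ) + 1) * (Real.pi / 6)) := by
    push_cast
    constructor <;> linarith [hk.1, hk.2]
  have hx := sub_mem_of_mem_cell hk
  rw [braidCurve_eq_cylindrical _ hk, braidCurve_eq_cylindrical _ hk', inner_strandDirection,
    show t + Real.pi - ((k + 6 : ℤ) : ℝ) * (Real.pi / 6) = t - k * (Real.pi / 6) by push_cast; ring]
  set x := t - k * (Real.pi / 6) with hxdef
  have hA := sectorLeft_nonneg hx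
  have hB := sectorRight_nonneg hx
  have hAB := half_le_sector hx
  obtain ⟨hc, hs, hc', hs'⟩ := half_le_cos_or_sin hx
  have hS : (1 : ℝ) / 2 ≤ Real.sin (Real.pi / 3) := by
    rw [← Real.sin_pi_div_six]
    exact Real.sin_le_sin_of_le_of_le_pi_div_two (by linarith [Real.pi_pos])
      (by linarith [Real.pi_pos]) (by linarith [Real.pi_pos])
  have hor : (1 / 2 ≤ sectorLeft x ∧ 1 / 2 ≤ Real.cos (3 * x)) ∨
      (1 / 2 ≤ sectorRight x ∧ 1 / 2 ≤ Real.sin (3 * x)) :=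
    hAB.imp (fun h => ⟨h.1, hc' h.2⟩) fun h => ⟨h.1, hs' h.2⟩
  have p1 := sectorDenom_ge k hx
  have p2 := sectorDenom_le k hx
  have q1 := sectorDenom_ge (k + 6) hx
  have q2 := sectorDenom_le (k + 6) hx
  have p0 : 0 < sectorDenom k x := by linarith
  have q0 : 0 < sectorDenom (k + 6) x := by linarith
  have h3t : 3 * t = 3 * x + k * (Real.pi / 2) := by rw [hxdef]; ring
  have hcases : k % 4 = 0 ∨ k % 4 = 1 ∨ k % 4 = 2 ∨ k % 4 = 3 := by omega
  obtain ⟨j, hj⟩ : ∃ j, k = k % 4 + 4 * j := ⟨k / 4, by omega⟩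
  have hper : 3 * t = 3 * x + ((k % 4 : ℤ) : ℝ) * (Real.pi / 2) + j * (2 * Real.pi) := by
    rw [h3t]
    conv_lhs => rw [hj]
    push_cast
    ring
  have hcos : Real.cos (3 * t) = Real.cos (3 * x + ((k % 4 : ℤ) : ℝ) * (Real.pi / 2)) := by
    rw [hper, Real.cos_add_int_mul_two_pi]
  have hsin : Real.sin (3 * t) = Real.sin (3 * x + ((k % 4 : ℤ) : ℝ) * (Real.pi / 2)) := by
    rw [hper, Real.sin_add_int_mul_two_pi]
  rw [hcos, hsin]
  rcases hcases with h | h | h | h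
  · have a1 : (k + 1) % 4 = 1 := by omega
    have a2 : (k + 6) % 4 = 2 := by omega
    have a3 : (k + 6 + 1) % 4 = 3 := by omega
    have e1 : Real.cos (3 * x + ((k % 4 : ℤ) : ℝ) * (Real.pi / 2)) = Real.cos (3 * x) := by
      rw [h]; simp
    have e2 : Real.sin (3 * x + ((k % 4 : ℤ) : ℝ) * (Real.pi / 2)) = Real.sin (3 * x) := by
      rw [h]; simp
    rw [e1, e2]
    refine linking_bound hc hs hA hB hS hor ?_ ?_ p0 q0 p2 ?_ ?_ ?_ ?_ <;>
      simp only [sectorDenom, edgeRadius, edgeHeight, braidRadius, braidHeight, h, a1, a2, a3] <;>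
      norm_num <;> ring_nf
  · have a1 : (k + 1) % 4 = 2 := by omega
    have a2 : (k + 6) % 4 = 3 := by omega
    have a3 : (k + 6 + 1) % 4 = 0 := by omega
    have e1 : Real.cos (3 * x + ((k % 4 : ℤ) : ℝ) * (Real.pi / 2)) = -Real.sin (3 * x) := by
      rw [h]; simp [Real.cos_add_pi_div_two]
    have e2 : Real.sin (3 * x + ((k % 4 : ℤ) : ℝ) * (Real.pi / 2)) = Real.cos (3 * x) := by
      rw [h]; simp [Real.sin_add_pi_div_two]
    rw [e1, e2]
    have := linking_bound (r₁ := edgeRadius (k + 6) x) (r₂ := edgeRadius k x)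
      (h₁ := -edgeHeight (k + 6) x) (h₂ := -edgeHeight k x) hs hc hB hA hS hor.symm
      (p := sectorDenom (k + 6) x) (q := sectorDenom k x) ?_ ?_ q0 p0 q2 ?_ ?_ ?_ ?_
    · linarith
    all_goals
      simp only [sectorDenom, edgeRadius, edgeHeight, braidRadius, braidHeight, h, a1, a2, a3] <;>
      norm_num <;> ring_nf
  · have a1 : (k + 1) % 4 = 3 := by omega
    have a2 : (k + 6) % 4 = 0 := by omega
    have a3 : (k + 6 + 1) % 4 = 1 := by omega
    have e1 : Real.cos (3 * x + ((k % 4 : ℤ) : ℝ) * (Real.pi / 2)) = -Real.cos (3 * x) := by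
      rw [h, show 3 * x + ((2 : ℤ) : ℝ) * (Real.pi / 2) = 3 * x + Real.pi by push_cast; ring,
        Real.cos_add_pi]
    have e2 : Real.sin (3 * x + ((k % 4 : ℤ) : ℝ) * (Real.pi / 2)) = -Real.sin (3 * x) := by
      rw [h, show 3 * x + ((2 : ℤ) : ℝ) * (Real.pi / 2) = 3 * x + Real.pi by push_cast; ring,
        Real.sin_add_pi]
    rw [e1, e2]
    have := linking_bound (r₁ := edgeRadius (k + 6) x) (r₂ := edgeRadius k x)
      (h₁ := edgeHeight (k + 6) x) (h₂ := edgeHeight k x) hc hs hA hB hS hor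
      (p := sectorDenom (k + 6) x) (q := sectorDenom k x) ?_ ?_ q0 p0 q2 ?_ ?_ ?_ ?_
    · linarith
    all_goals
      simp only [sectorDenom, edgeRadius, edgeHeight, braidRadius, braidHeight, h, a1, a2, a3] <;>
      norm_num <;> ring_nf
  · have a1 : (k + 1) % 4 = 0 := by omega
    have a2 : (k + 6) % 4 = 1 := by omega
    have a3 : (k + 6 + 1) % 4 = 2 := by omega
    have e1 : Real.cos (3 * x + ((k % 4 : ℤ) : ℝ) * (Real.pi / 2)) = Real.sin (3 * x) := by
      rw [h, show 3 * x + ((3 : ℤ) : ℝ) * (Real.pi / 2) = 3 * x + Real.pi / 2 + Real.pi by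
        push_cast; ring, Real.cos_add_pi, Real.cos_add_pi_div_two, neg_neg]
    have e2 : Real.sin (3 * x + ((k % 4 : ℤ) : ℝ) * (Real.pi / 2)) = -Real.cos (3 * x) := by
      rw [h, show 3 * x + ((3 : ℤ) : ℝ) * (Real.pi / 2) = 3 * x + Real.pi / 2 + Real.pi by
        push_cast; ring, Real.sin_add_pi, Real.sin_add_pi_div_two]
    rw [e1, e2]
    have := linking_bound (r₁ := edgeRadius k x) (r₂ := edgeRadius (k + 6) x)
      (h₁ := -edgeHeight k x) (h₂ := -edgeHeight (k + 6) x) hs hc hB hA hS hor.symm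
      (p := sectorDenom k x) (q := sectorDenom (k + 6) x) ?_ ?_ p0 q0 p2 ?_ ?_ ?_ ?_
    · linarith
    all_goals
      simp only [sectorDenom, edgeRadius, edgeHeight, braidRadius, braidHeight, h, a1, a2, a3] <;>
      norm_num <;> ring_nf

/-- The parametrized polygonal trefoil runs through the edges of the polygon. -/
theorem range_braidCurve :
    range braidCurve = ⋃ k ∈ Finset.range 12, segment ℝ (braidVertex (k : ℤ)) (braidVertex (k + 1)) := by
  have hπ : 0 < Real.pi / 6 := by positivity
  have himage : ∀ k : ℤ, braidCurve '' Icc (k * (Real.pi / 6)) ((k + 1) * (Real.pi / 6)) =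
      segment ℝ (braidVertex k) (braidVertex (k + 1)) := by
    intro k
    have hcont : ContinuousOn (edgeParameter k) (Icc 0 (Real.pi / 6)) := by
      apply ContinuousOn.div
      · exact Continuous.continuousOn (by unfold sectorRight; fun_prop)
      · exact Continuous.continuousOn (by unfold sectorDenom sectorLeft sectorRight; fun_prop)
      · intro x hx
        linarith [sectorDenom_ge k hx]
    have hsurj := intermediate_value_Icc hπ.le hcont
    rw [edgeParameter_zero, edgeParameter_end] at hsurj
    rw [segment_eq_image']
    ext y
    constructor
    · rintro ⟨t, ht, rfl⟩
      exact ⟨_, edgeParameter_mem k (sub_mem_of_mem_cell ht), (braidCurve_eq k ht).symm⟩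
    · rintro ⟨θ, hθ, rfl⟩
      obtain ⟨x, hx, rfl⟩ := hsurj hθ
      have ht : x + k * (Real.pi / 6) ∈ Icc (k * (Real.pi / 6)) ((k + 1) * (Real.pi / 6)) :=
        ⟨by linarith [hx.1], by linarith [hx.2]⟩
      refine ⟨_, ht, ?_⟩
      rw [braidCurve_eq k ht, add_sub_cancel_right]
  ext y
  simp only [mem_iUnion, Finset.mem_range, exists_prop]
  constructor
  · rintro ⟨t, rfl⟩
    obtain ⟨s, hs, hst⟩ := braidCurve_periodic.exists_mem_Ico₀ (by positivity) t
    have hk := mem_cell s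
    have h0 : 0 ≤ ⌊s / (Real.pi / 6)⌋ := Int.floor_nonneg.2 (div_nonneg hs.1 hπ.le)
    have h1 : ⌊s / (Real.pi / 6)⌋ < 12 := by
      rw [Int.floor_lt, div_lt_iff₀ hπ]
      push_cast
      linarith [hs.2]
    obtain ⟨n, hn⟩ := Int.eq_ofNat_of_zero_le h0
    refine ⟨n, by omega, ?_⟩
    rw [hn] at hk
    rw [hst, ← himage]
    exact ⟨s, hk, rfl⟩
  · rintro ⟨k, -, hy⟩
    rw [← himage] at hy
    exact image_subset_range _ _ hy

theorem ambientEquiv_standardTrefoil_braidCurve :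
    AmbientEquiv standardTrefoil (range braidCurve) := by
  have h : standardTrefoil = range trefoilCurve := rfl
  rw [h]
  refine ambientEquiv_of_isClosedBraid (c := 1 / 1200) (L := 100800) (d := 1 / 40) (by norm_num)
    (by norm_num) (by norm_num) ⟨isClosedBraid_trefoilCurve.periodic, fun s t => ?_, fun t => ?_⟩
    isClosedBraid_braidCurve (fun t => le_trans (by norm_num) (trefoilCurve_strandDirection t))
    braidCurve_strandDirection
  · refine (isClosedBraid_trefoilCurve.lipschitz s t).trans ?_
    gcongr
    norm_num
  · obtain ⟨r, z, hr, e⟩ := isClosedBraid_trefoilCurve.polar t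
    exact ⟨r, z, by linarith, e⟩

/-- The linear part of the affine map which carries `braidVertex` to `braidPolygon`. -/
noncomputable def braidLinear : E3 →ₗ[ℝ] E3 where
  toFun x := !₂[denom * (-190 * x 0 + 1690 * (x 1 / Real.sqrt 3) + 193 * x 2),
    denom * (440 * x 0 + 80 * (x 1 / Real.sqrt 3) + 201 * x 2),
    denom * (-140 * x 0 + 160 * (x 1 / Real.sqrt 3) + 186 * x 2)]
  map_add' x y := by ext i; fin_cases i <;> simp <;> ring
  map_smul' c x := by ext i; fin_cases i <;> simp <;> ring

theorem braidLinear_injective : Function.Injective braidLinear := by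
  rw [← LinearMap.ker_eq_bot, LinearMap.ker_eq_bot']
  intro x hx
  have hd : (denom : ℝ) ≠ 0 := by norm_num [denom]
  have h0 : (braidLinear x) 0 = 0 := by rw [hx]; rfl
  have h1 : (braidLinear x) 1 = 0 := by rw [hx]; rfl
  have h2 : (braidLinear x) 2 = 0 := by rw [hx]; rfl
  simp only [braidLinear, LinearMap.coe_mk, AddHom.coe_mk, Matrix.cons_val, mul_eq_zero, hd,
    false_or] at h0 h1 h2
  have hy : x 1 / Real.sqrt 3 = 0 := by linarith
  have hy' : x 1 = 0 := by
    rcases div_eq_zero_iff.1 hy with h | h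
    · exact h
    · exact absurd h (by positivity)
  have hx0 : x 0 = 0 := by linarith
  have hx2 : x 2 = 0 := by linarith
  ext i
  fin_cases i
  · exact hx0
  · exact hy'
  · exact hx2

/-- The affine homeomorphism which carries `braidVertex` to `braidPolygon`. -/
noncomputable def braidAffine : E3 ≃ₜ E3 :=
  (LinearEquiv.ofInjectiveEndo braidLinear braidLinear_injective).toContinuousLinearEquiv.toHomeomorph.trans
    (Homeomorph.addLeft (Z3.toE (denom • (2772, 634, 336))))

theorem braidAffine_apply (x : E3) :
    braidAffine x = Z3.toE (denom • (2772, 634, 336)) + braidLinear x := rfl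

theorem braidAffine_image_segment (a b : E3) :
    braidAffine '' segment ℝ a b = segment ℝ (braidAffine a) (braidAffine b) := by
  rw [braidAffine_apply, braidAffine_apply, ← segment_translate_image]
  have h := image_segment ℝ braidLinear.toAffineMap a b
  rw [LinearMap.coe_toAffineMap] at h
  rw [← h, image_image]
  rfl

/-- The cosine of `k π / 3` and the sine divided by `√3` satisfy a rational recursion. -/
theorem hexagon_step {a b a' b' : ℝ} {k : ℕ} (l : ℕ) (hl : l = k + 1)
    (ha : Real.cos (2 * (k * (Real.pi / 6))) = a)
    (hb : Real.sin (2 * (k * (Real.pi / 6))) = Real.sqrt 3 * b)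
    (ha' : a / 2 - 3 / 2 * b = a') (hb' : a / 2 + b / 2 = b') :
    Real.cos (2 * (l * (Real.pi / 6))) = a' ∧
    Real.sin (2 * (l * (Real.pi / 6))) = Real.sqrt 3 * b' := by
  have h3 : Real.sqrt 3 * Real.sqrt 3 = 3 := Real.mul_self_sqrt (by norm_num)
  have e : 2 * ((l : ℝ) * (Real.pi / 6)) = 2 * (k * (Real.pi / 6)) + Real.pi / 3 := by
    rw [hl]; push_cast; ring
  rw [← ha', ← hb', e, Real.cos_add, Real.sin_add, ha, hb, Real.cos_pi_div_three, Real.sin_pi_div_three]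
  constructor
  · linear_combination -b / 2 * h3
  · ring

theorem braidAffine_braidVertex {k : ℕ} {a b : ℝ} {u v w : ℤ}
    (h : Real.cos (2 * (k * (Real.pi / 6))) = a ∧ Real.sin (2 * (k * (Real.pi / 6))) = Real.sqrt 3 * b)
    (hu : braidRadius k * (-190 * a + 1690 * b) + 193 * braidHeight k + 2772 = u)
    (hv : braidRadius k * (440 * a + 80 * b) + 201 * braidHeight k + 634 = v)
    (hw : braidRadius k * (-140 * a + 160 * b) + 186 * braidHeight k + 336 = w) :
    braidAffine (braidVertex (k : ℤ)) = Z3.toE (denom • (u, v, w)) := by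
  have h3 : Real.sqrt 3 ≠ 0 := by positivity
  rw [braidAffine_apply]
  ext i
  fin_cases i
  · simp only [braidLinear, braidVertex, cylindrical, Z3.toE, Int.cast_natCast, h.1, h.2]
    simp [← hu]
    field_simp
    ring
  · simp only [braidLinear, braidVertex, cylindrical, Z3.toE, Int.cast_natCast, h.1, h.2]
    simp [← hv]
    field_simp
    ring
  · simp only [braidLinear, braidVertex, cylindrical, Z3.toE, Int.cast_natCast, h.1, h.2]
    simp [← hw]
    field_simp
    ring

theorem braidAffine_image_range : braidAffine '' range braidCurve = closedPolygon braidPolygon := by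
  have c0 : Real.cos (2 * ((0 : ℕ) * (Real.pi / 6))) = 1 ∧
      Real.sin (2 * ((0 : ℕ) * (Real.pi / 6))) = Real.sqrt 3 * 0 := by simp
  have c1 := hexagon_step 1 rfl c0.1 c0.2 (a' := 1 / 2) (b' := 1 / 2) (by norm_num) (by norm_num)
  have c2 := hexagon_step 2 rfl c1.1 c1.2 (a' := -1 / 2) (b' := 1 / 2) (by norm_num) (by norm_num)
  have c3 := hexagon_step 3 rfl c2.1 c2.2 (a' := -1) (b' := 0) (by norm_num) (by norm_num)
  have c4 := hexagon_step 4 rfl c3.1 c3.2 (a' := -1 / 2) (b' := -1 / 2) (by norm_num) (by norm_num)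
  have c5 := hexagon_step 5 rfl c4.1 c4.2 (a' := 1 / 2) (b' := -1 / 2) (by norm_num) (by norm_num)
  have c6 := hexagon_step 6 rfl c5.1 c5.2 (a' := 1) (b' := 0) (by norm_num) (by norm_num)
  have c7 := hexagon_step 7 rfl c6.1 c6.2 (a' := 1 / 2) (b' := 1 / 2) (by norm_num) (by norm_num)
  have c8 := hexagon_step 8 rfl c7.1 c7.2 (a' := -1 / 2) (b' := 1 / 2) (by norm_num) (by norm_num)
  have c9 := hexagon_step 9 rfl c8.1 c8.2 (a' := -1) (b' := 0) (by norm_num) (by norm_num)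
  have c10 := hexagon_step 10 rfl c9.1 c9.2 (a' := -1 / 2) (b' := -1 / 2) (by norm_num) (by norm_num)
  have c11 := hexagon_step 11 rfl c10.1 c10.2 (a' := 1 / 2) (b' := -1 / 2) (by norm_num) (by norm_num)
  have v0 := braidAffine_braidVertex (u := 2202) (v := 1954) (w := -84) c0
    (by norm_num [braidRadius, braidHeight]) (by norm_num [braidRadius, braidHeight])
    (by norm_num [braidRadius, braidHeight])
  have v1 := braidAffine_braidVertex (u := 4465) (v := 1355) (w := 542) c1
    (by norm_num [braidRadius, braidHeight]) (by norm_num [braidRadius, braidHeight])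
    (by norm_num [braidRadius, braidHeight])
  have v2 := braidAffine_braidVertex (u := 2866) (v := 616) (w := 351) c2
    (by norm_num [braidRadius, braidHeight]) (by norm_num [braidRadius, braidHeight])
    (by norm_num [braidRadius, braidHeight])
  have v3 := braidAffine_braidVertex (u := 2959) (v := -447) (w := 430) c3
    (by norm_num [braidRadius, braidHeight]) (by norm_num [braidRadius, braidHeight])
    (by norm_num [braidRadius, braidHeight])
  have v4 := braidAffine_braidVertex (u := 522) (v := -146) (w := 306) c4
    (by norm_num [braidRadius, braidHeight]) (by norm_num [braidRadius, braidHeight])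
    (by norm_num [braidRadius, braidHeight])
  have v5 := braidAffine_braidVertex (u := 1085) (v := 1195) (w := 222) c5
    (by norm_num [braidRadius, braidHeight]) (by norm_num [braidRadius, braidHeight])
    (by norm_num [braidRadius, braidHeight])
  have v6 := braidAffine_braidVertex (u := 2753) (v := 678) (w := 322) c6
    (by norm_num [braidRadius, braidHeight]) (by norm_num [braidRadius, braidHeight])
    (by norm_num [braidRadius, braidHeight])
  have v7 := braidAffine_braidVertex (u := 4079) (v := 953) (w := 170) c7
    (by norm_num [braidRadius, braidHeight]) (by norm_num [braidRadius, braidHeight])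
    (by norm_num [braidRadius, braidHeight])
  have v8 := braidAffine_braidVertex (u := 5592) (v := 94) (w := 786) c8
    (by norm_num [braidRadius, braidHeight]) (by norm_num [braidRadius, braidHeight])
    (by norm_num [braidRadius, braidHeight])
  have v9 := braidAffine_braidVertex (u := 3345) (v := -45) (w := 802) c9
    (by norm_num [braidRadius, braidHeight]) (by norm_num [braidRadius, braidHeight])
    (by norm_num [braidRadius, braidHeight])
  have v10 := braidAffine_braidVertex (u := 2697) (v := 608) (w := 335) c10
    (by norm_num [braidRadius, braidHeight]) (by norm_num [braidRadius, braidHeight])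
    (by norm_num [braidRadius, braidHeight])
  have v11 := braidAffine_braidVertex (u := 699) (v := 793) (w := -150) c11
    (by norm_num [braidRadius, braidHeight]) (by norm_num [braidRadius, braidHeight])
    (by norm_num [braidRadius, braidHeight])
  have v12 : braidVertex ((12 : ℕ) : ℤ) = braidVertex ((0 : ℕ) : ℤ) := by
    simpa using braidVertex_add_twelve 0
  have hsucc : ∀ k : ℕ, ((k : ℤ) + 1) = ((k + 1 : ℕ) : ℤ) := fun k => by push_cast; rfl
  rw [range_braidCurve]
  simp only [image_iUnion, braidAffine_image_segment, hsucc]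
  simp only [closedPolygon, braidPolygon, List.map_cons, List.map_nil, List.cons_append,
    List.nil_append, polygonalPath, union_empty]
  simp only [← v0, ← v1, ← v2, ← v3, ← v4, ← v5, ← v6, ← v7, ← v8, ← v9, ← v10, ← v11]
  ext y
  simp only [mem_iUnion, Finset.mem_range, exists_prop, mem_union]
  constructor
  · rintro ⟨k, hk, h⟩
    interval_cases k <;> simp only [v12, Nat.reduceAdd] at h <;> tauto
  · rintro (h | h | h | h | h | h | h | h | h | h | h | h)
    · exact ⟨0, by norm_num, h⟩
    · exact ⟨1, by norm_num, h⟩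
    · exact ⟨2, by norm_num, h⟩
    · exact ⟨3, by norm_num, h⟩
    · exact ⟨4, by norm_num, h⟩
    · exact ⟨5, by norm_num, h⟩
    · exact ⟨6, by norm_num, h⟩
    · exact ⟨7, by norm_num, h⟩
    · exact ⟨8, by norm_num, h⟩
    · exact ⟨9, by norm_num, h⟩
    · exact ⟨10, by norm_num, h⟩
    · exact ⟨11, by norm_num, by rw [v12]; exact h⟩

/-- The closed polygon through the centers is a trefoil. -/
theorem ambientEquiv_standardTrefoil_necklacePolygon :
    AmbientEquiv standardTrefoil (closedPolygon necklacePolygon) :=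
  (ambientEquiv_standardTrefoil_braidCurve.trans ⟨braidAffine, braidAffine_image_range⟩).trans
    ambientEquiv_necklacePolygon_braidPolygon.symm

/-! ### Norm-preserving homeomorphisms straightening a corner -/

/-- Projecting a sphere about the origin from an interior point `-w` is a homeomorphism of the sphere;
doing so on all spheres about the origin, with an interior point `-w ρ` depending continuously on the
radius `ρ`, gives a norm-preserving homeomorphism of space. -/
theorem exists_radial_homeomorph {w : ℝ → E3} (hw : Continuous w) (hlt : ∀ ρ, 0 < ρ → ‖w ρ‖ < ρ) :
    ∃ F : E3 ≃ₜ E3, ∀ x, F x = (‖x‖ / ‖x + w ‖x‖‖) • (x + w ‖x‖) ∧ ‖F x‖ = ‖x‖ := by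
  set f : E3 → E3 := fun x => (‖x‖ / ‖x + w ‖x‖‖) • (x + w ‖x‖) with hf
  have hne : ∀ x, x ≠ 0 → 0 < ‖x + w ‖x‖‖ := by
    intro x hx
    have h1 := hlt ‖x‖ (norm_pos_iff.2 hx)
    have h2 := norm_sub_norm_le x (-w ‖x‖)
    rw [norm_neg, sub_neg_eq_add] at h2
    linarith
  have hf0 : f 0 = 0 := by simp [hf]
  have hnorm : ∀ x, ‖f x‖ = ‖x‖ := by
    intro x
    rcases eq_or_ne x 0 with rfl | hx
    · rw [hf0]
    · have := hne x hx
      simp only [hf, norm_smul, norm_div, norm_norm]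
      field_simp
  have hcont : Continuous f := by
    rw [continuous_iff_continuousAt]
    intro x
    rcases eq_or_ne x 0 with rfl | hx
    · rw [ContinuousAt, hf0, tendsto_zero_iff_norm_tendsto_zero]
      simp only [hnorm]
      have := (continuous_norm (E := E3)).tendsto 0
      rwa [norm_zero] at this
    · have h1 : Continuous fun y : E3 => y + w ‖y‖ := by fun_prop
      exact (continuous_norm.continuousAt.div h1.norm.continuousAt (hne x hx).ne').smul
        h1.continuousAt
  have hinj : Function.Injective f := by
    intro x y hxy
    have hρ : ‖x‖ = ‖y‖ := by rw [← hnorm x, ← hnorm y, hxy]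
    rcases eq_or_ne x 0 with rfl | hx
    · rw [norm_zero] at hρ
      exact (norm_eq_zero.1 hρ.symm).symm
    have hx0 : 0 < ‖x‖ := norm_pos_iff.2 hx
    have hy : y ≠ 0 := norm_pos_iff.1 (hρ ▸ hx0)
    have hlt' := hlt ‖x‖ hx0
    have hnx := hne x hx
    have hny := hne y hy
    rw [← hρ] at hny
    simp only [hf, ← hρ] at hxy
    set v := w ‖x‖
    set μ := ‖y + v‖ / ‖x + v‖ with hμ
    have hμ0 : 0 < μ := div_pos hny hnx
    have e : y = μ • x + (μ - 1) • v := by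
      have h1 : y + v = μ • (x + v) := by
        have h2 := congrArg (fun z => (‖y + v‖ / ‖x‖) • z) hxy
        simp only [smul_smul] at h2
        rw [show ‖y + v‖ / ‖x‖ * (‖x‖ / ‖x + v‖) = μ by rw [hμ]; field_simp,
          show ‖y + v‖ / ‖x‖ * (‖x‖ / ‖y + v‖) = 1 by field_simp, one_smul] at h2
        exact h2.symm
      rw [eq_sub_of_add_eq h1]
      module
    have hμ1 : μ = 1 := by
      by_contra hne1
      rcases lt_or_gt_of_ne hne1 with h | h
      · have h1 := norm_add_le (μ • x) ((μ - 1) • v)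
        rw [← e, norm_smul, norm_smul, Real.norm_of_nonneg hμ0.le, ← hρ, Real.norm_eq_abs,
          abs_of_neg (by linarith)] at h1
        nlinarith
      · have h1 := norm_sub_le y ((μ - 1) • v)
        rw [show y - (μ - 1) • v = μ • x by rw [e]; module, norm_smul, norm_smul,
          Real.norm_of_nonneg hμ0.le, ← hρ, Real.norm_of_nonneg (by linarith)] at h1
        nlinarith
    rw [e, hμ1]
    module
  have hsurj : Function.Surjective f := by
    intro y
    rcases eq_or_ne y 0 with rfl | hy
    · exact ⟨0, hf0⟩
    have hy0 : 0 < ‖y‖ := norm_pos_iff.2 hy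
    set v := w ‖y‖ with hv
    have hv1 : ‖v‖ < ‖y‖ := hlt _ hy0
    have hc : ContinuousOn (fun μ : ℝ => ‖μ • y - v‖) (Icc 0 2) := by fun_prop
    have hmem : ‖y‖ ∈ Icc ‖(0 : ℝ) • y - v‖ ‖(2 : ℝ) • y - v‖ := by
      constructor
      · rw [zero_smul, zero_sub, norm_neg]; exact hv1.le
      · have := norm_sub_norm_le ((2 : ℝ) • y) v
        rw [norm_smul, Real.norm_of_nonneg (by norm_num)] at this
        linarith
    obtain ⟨μ, hμ, hμy⟩ := intermediate_value_Icc (by norm_num : (0 : ℝ) ≤ 2) hc hmem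
    beta_reduce at hμy
    have hμ0 : 0 < μ := by
      rcases hμ.1.eq_or_lt with h | h
      · rw [← h, zero_smul, zero_sub, norm_neg] at hμy
        exact absurd hμy hv1.ne
      · exact h
    refine ⟨μ • y - v, ?_⟩
    simp only [hf, hμy, ← hv, sub_add_cancel, smul_smul, norm_smul, Real.norm_of_nonneg hμ0.le]
    rw [show ‖y‖ / (μ * ‖y‖) * μ = 1 by field_simp, one_smul]
  have hproper : IsProperMap f := by
    rw [isProperMap_iff_tendsto_cocompact]
    refine ⟨hcont, ?_⟩
    rw [← Metric.cobounded_eq_cocompact, ← comap_norm_atTop, tendsto_comap_iff]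
    have : (norm ∘ f) = fun x => ‖x‖ := funext hnorm
    rw [this]
    exact tendsto_comap
  exact ⟨(Equiv.ofBijective f ⟨hinj, hsurj⟩).toHomeomorphOfContinuousClosed hcont
    hproper.isClosedMap, fun x => ⟨rfl, hnorm x⟩⟩

/-- A profile for rounding a corner: an even function which agrees with the absolute value outside
`(-δ, δ)`, is bounded by it and is monotone in `|s|`. -/
structure IsCornerProfile (δ : ℝ) (χ : ℝ → ℝ) : Prop where
  continuous : Continuous χ
  even : ∀ s, χ (-s) = χ s
  nonneg : ∀ s, 0 ≤ χ s
  le_abs : ∀ s, χ s ≤ |s|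
  mono : MonotoneOn χ (Ici 0)
  eq_abs : ∀ s, δ ≤ |s| → χ s = |s|

theorem isCornerProfile_abs (δ : ℝ) : IsCornerProfile δ (fun s => |s|) where
  continuous := continuous_abs
  even := abs_neg
  nonneg := abs_nonneg
  le_abs _ := le_rfl
  mono := fun x hx y hy h => by
    simpa only [abs_of_nonneg (mem_Ici.1 hx), abs_of_nonneg (mem_Ici.1 hy)] using h
  eq_abs _ _ := rfl

theorem IsCornerProfile.apply_abs {δ : ℝ} {χ : ℝ → ℝ} (h : IsCornerProfile δ χ) (s : ℝ) :
    χ |s| = χ s := by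
  rcases abs_choice s with hs | hs
  · rw [hs]
  · rw [hs, h.even]

theorem IsCornerProfile.apply_zero {δ : ℝ} {χ : ℝ → ℝ} (h : IsCornerProfile δ χ) : χ 0 = 0 :=
  le_antisymm (by simpa using h.le_abs 0) (h.nonneg 0)

/-- The corner at the origin between the rays in the directions `u` and `v`, rounded according to the
profile `χ`.  For `χ s = |s|` it is the polygonal corner, parametrized by arc length. -/
noncomputable def corner (χ : ℝ → ℝ) (u v : E3) (s : ℝ) : E3 :=
  s • ((1 / 2 : ℝ) • (v - u)) + χ s • ((1 / 2 : ℝ) • (u + v))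

theorem inner_half_sub_half_add {u v : E3} (hu : ‖u‖ = 1) (hv : ‖v‖ = 1) :
    inner ℝ ((1 / 2 : ℝ) • (v - u)) ((1 / 2 : ℝ) • (u + v)) = 0 := by
  rw [inner_smul_left, inner_smul_right, inner_sub_left, inner_add_right, inner_add_right,
    real_inner_self_eq_norm_sq, real_inner_self_eq_norm_sq, hu, hv, real_inner_comm u v]
  ring

theorem norm_sq_combination {u v : E3} (hu : ‖u‖ = 1) (hv : ‖v‖ = 1) (a b : ℝ) :
    ‖a • ((1 / 2 : ℝ) • (v - u)) + b • ((1 / 2 : ℝ) • (u + v))‖ ^ 2 =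
      a ^ 2 * ‖(1 / 2 : ℝ) • (v - u)‖ ^ 2 + b ^ 2 * ‖(1 / 2 : ℝ) • (u + v)‖ ^ 2 := by
  rw [norm_add_sq_real, inner_smul_left, inner_smul_right,
    inner_half_sub_half_add hu hv, norm_smul a, norm_smul b, mul_pow,
    mul_pow, Real.norm_eq_abs, Real.norm_eq_abs, sq_abs, sq_abs]
  ring

theorem norm_sq_add_norm_sq {u v : E3} (hu : ‖u‖ = 1) (hv : ‖v‖ = 1) :
    ‖(1 / 2 : ℝ) • (v - u)‖ ^ 2 + ‖(1 / 2 : ℝ) • (u + v)‖ ^ 2 = 1 := by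
  rw [norm_smul, norm_smul, mul_pow, mul_pow, norm_sub_sq_real, norm_add_sq_real, hu, hv,
    real_inner_comm u v, Real.norm_of_nonneg (by norm_num)]
  ring

theorem norm_half_sub_pos {u v : E3} (huv : u ≠ v) : 0 < ‖(1 / 2 : ℝ) • (v - u)‖ := by
  rw [norm_pos_iff]
  exact smul_ne_zero (by norm_num) (sub_ne_zero.2 huv.symm)

theorem norm_corner_sq {χ : ℝ → ℝ} {u v : E3} (hu : ‖u‖ = 1) (hv : ‖v‖ = 1) (s : ℝ) :
    ‖corner χ u v s‖ ^ 2 =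
      s ^ 2 * ‖(1 / 2 : ℝ) • (v - u)‖ ^ 2 + χ s ^ 2 * ‖(1 / 2 : ℝ) • (u + v)‖ ^ 2 :=
  norm_sq_combination hu hv _ _

theorem norm_corner_le {δ : ℝ} {χ : ℝ → ℝ} (hχ : IsCornerProfile δ χ) {u v : E3} (hu : ‖u‖ = 1)
    (hv : ‖v‖ = 1) (s : ℝ) : ‖corner χ u v s‖ ≤ |s| := by
  apply abs_le_of_sq_le_sq' _ (abs_nonneg s) |>.2
  rw [norm_corner_sq hu hv, sq_abs]
  have h1 := norm_sq_add_norm_sq hu hv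
  have h2 : χ s ^ 2 ≤ s ^ 2 := by
    rw [← sq_abs s]
    exact pow_le_pow_left₀ (hχ.nonneg s) (hχ.le_abs s) 2
  nlinarith [sq_nonneg ‖(1 / 2 : ℝ) • (u + v)‖]

theorem norm_corner_eq {δ : ℝ} {χ : ℝ → ℝ} (hχ : IsCornerProfile δ χ) {u v : E3} (hu : ‖u‖ = 1)
    (hv : ‖v‖ = 1) {s : ℝ} (hs : δ ≤ |s|) : ‖corner χ u v s‖ = |s| := by
  have h : ‖corner χ u v s‖ ^ 2 = |s| ^ 2 := by
    rw [norm_corner_sq hu hv, hχ.eq_abs s hs, sq_abs, ← mul_add, norm_sq_add_norm_sq hu hv, mul_one]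
  exact (pow_left_inj₀ (norm_nonneg _) (abs_nonneg _) two_ne_zero).1 h

/-- The interior points for `exists_radial_homeomorph` which straighten a rounded corner. -/
theorem exists_corner_offset {δ : ℝ} {χ : ℝ → ℝ} (hδ : 0 < δ) (hχ : IsCornerProfile δ χ) {u v : E3}
    (hu : ‖u‖ = 1) (hv : ‖v‖ = 1) (huv : u ≠ v) :
    ∃ w : ℝ → E3, Continuous w ∧ (∀ ρ, 0 < ρ → ‖w ρ‖ < ρ) ∧
      (∀ ρ, δ ≤ ρ → w ρ = -(ρ • ((1 / 2 : ℝ) • (u + v)))) ∧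
      ∀ x, (∃ c : ℝ, x + w ‖x‖ = c • ((1 / 2 : ℝ) • (v - u))) ↔ x ∈ range (corner χ u v) := by
  set e := (1 / 2 : ℝ) • (v - u) with he
  set n := (1 / 2 : ℝ) • (u + v) with hn
  have he0 : 0 < ‖e‖ := norm_half_sub_pos huv
  set N : ℝ → ℝ := fun s => if 0 ≤ s then ‖corner χ u v s‖ else s with hN
  have hNpos : ∀ s, 0 ≤ s → N s = ‖corner χ u v s‖ := fun s hs => if_pos hs
  have hNneg : ∀ s, s ≤ 0 → N s = s := by
    intro s hs
    rcases hs.eq_or_lt with rfl | h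
    · rw [hNpos 0 le_rfl]
      simp [corner, hχ.apply_zero]
    · exact if_neg (not_le.2 h)
  have hcorner : Continuous (corner χ u v) := by
    unfold corner
    have := hχ.continuous
    fun_prop
  have hNcont : Continuous N := by
    apply Continuous.if_le hcorner.norm continuous_id continuous_const continuous_id
    rintro s rfl
    simp [corner, hχ.apply_zero]
  have hNge : ∀ s, δ ≤ |s| → N s = s := by
    intro s hs
    rcases le_total 0 s with h | h
    · rw [hNpos s h, norm_corner_eq hχ hu hv hs, abs_of_nonneg h]
    · exact hNneg s h
  have hmono : StrictMono N := by
    intro s t hst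
    rcases le_or_gt 0 s with h | h
    · rw [hNpos s h, hNpos t (h.trans hst.le)]
      apply abs_lt_of_sq_lt_sq' _ (norm_nonneg _) |>.2
      rw [norm_corner_sq hu hv, norm_corner_sq hu hv]
      have h1 : χ s ≤ χ t := hχ.mono (mem_Ici.2 h) (mem_Ici.2 (h.trans hst.le)) hst.le
      have h2 : χ s ^ 2 ≤ χ t ^ 2 := pow_le_pow_left₀ (hχ.nonneg s) h1 2
      have h3 : s ^ 2 < t ^ 2 := pow_lt_pow_left₀ hst h two_ne_zero
      have h4 : 0 < ‖e‖ ^ 2 := by positivity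
      have h5 := mul_lt_mul_of_pos_right h3 h4
      have h6 := mul_le_mul_of_nonneg_right h2 (sq_nonneg ‖n‖)
      linarith
    · rw [hNneg s h.le]
      rcases le_or_gt t 0 with h' | h'
      · rwa [hNneg t h']
      · rw [hNpos t h'.le]
        exact h.trans_le (norm_nonneg _)
  have hsurj : Function.Surjective N := by
    apply hNcont.surjective
    · refine Tendsto.congr' ?_ tendsto_id
      filter_upwards [eventually_ge_atTop δ] with s hs
      exact (hNge s (hs.trans (le_abs_self s))).symm
    · refine Tendsto.congr' ?_ tendsto_id
      filter_upwards [eventually_le_atBot 0] with s hs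
      exact (hNneg s hs).symm
  set σ := (hmono.orderIsoOfSurjective N hsurj).toHomeomorph.symm with hσ
  have hσN : ∀ s, σ (N s) = s := (hmono.orderIsoOfSurjective N hsurj).toHomeomorph.symm_apply_apply
  have hNσ : ∀ ρ, N (σ ρ) = ρ := (hmono.orderIsoOfSurjective N hsurj).toHomeomorph.apply_symm_apply
  have hσ0 : ∀ ρ, 0 ≤ ρ → 0 ≤ σ ρ := by
    intro ρ hρ
    by_contra h
    have := hNneg (σ ρ) (not_le.1 h).le
    rw [hNσ] at this
    linarith
  have hsq : ∀ ρ, 0 ≤ ρ → ρ ^ 2 = σ ρ ^ 2 * ‖e‖ ^ 2 + χ (σ ρ) ^ 2 * ‖n‖ ^ 2 := by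
    intro ρ hρ
    rw [← norm_corner_sq hu hv, ← hNpos _ (hσ0 ρ hρ), hNσ]
  refine ⟨fun ρ => -(χ (σ ρ) • n), ?_, ?_, ?_, ?_⟩
  · have := hχ.continuous
    have := σ.continuous
    fun_prop
  · intro ρ hρ
    have h1 : σ ρ ≠ 0 := by
      intro h
      have := hNσ ρ
      rw [h, hNneg 0 le_rfl] at this
      linarith
    apply abs_lt_of_sq_lt_sq' _ hρ.le |>.2
    rw [norm_neg, norm_smul, mul_pow, Real.norm_eq_abs, sq_abs, hsq ρ hρ.le]
    have : 0 < σ ρ ^ 2 * ‖e‖ ^ 2 := by positivity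
    linarith
  · intro ρ hρ
    have h1 : σ ρ = ρ := by
      conv_lhs => rw [← hNge ρ (hρ.trans (le_abs_self ρ)), hσN]
    simp only [h1, hχ.eq_abs ρ (hρ.trans (le_abs_self ρ)), abs_of_nonneg (hδ.le.trans hρ)]
  · intro x
    constructor
    · rintro ⟨c, hc⟩
      have hx : x = c • e + χ (σ ‖x‖) • n := by
        rw [← sub_eq_add_neg, sub_eq_iff_eq_add] at hc
        exact hc
      have h1 : ‖x‖ ^ 2 = c ^ 2 * ‖e‖ ^ 2 + χ (σ ‖x‖) ^ 2 * ‖n‖ ^ 2 := by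
        rw [← norm_sq_combination hu hv, ← he, ← hn, ← hx]
      have h2 : c ^ 2 = σ ‖x‖ ^ 2 := by
        have h3 := hsq ‖x‖ (norm_nonneg x)
        have h4 : c ^ 2 * ‖e‖ ^ 2 = σ ‖x‖ ^ 2 * ‖e‖ ^ 2 := by linarith
        exact mul_right_cancel₀ (by positivity) h4
      have h3 : σ ‖x‖ = |c| := by
        rw [← abs_of_nonneg (hσ0 _ (norm_nonneg x))]
        exact ((sq_eq_sq_iff_abs_eq_abs _ _).1 h2).symm
      refine ⟨c, ?_⟩
      rw [corner, ← he, ← hn, ← hχ.apply_abs c, ← h3]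
      exact hx.symm
    · rintro ⟨s, rfl⟩
      have h1 : ‖corner χ u v s‖ = N |s| := by
        rw [hNpos _ (abs_nonneg s)]
        have h2 : ‖corner χ u v s‖ ^ 2 = ‖corner χ u v |s|‖ ^ 2 := by
          rw [norm_corner_sq hu hv, norm_corner_sq hu hv, sq_abs, hχ.apply_abs]
        exact (pow_left_inj₀ (norm_nonneg _) (norm_nonneg _) two_ne_zero).1 h2
      refine ⟨s, ?_⟩
      simp only [h1, hσN, hχ.apply_abs]
      rw [corner, ← he, ← hn]
      abel

/-- The homeomorphism of `exists_radial_homeomorph` maps to a line through the origin exactly the points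
which the translation by `w ‖x‖` maps to it. -/
theorem radial_mem_line_iff {w : ℝ → E3} {F : E3 → E3} (hw : Continuous w)
    (hlt : ∀ ρ, 0 < ρ → ‖w ρ‖ < ρ) (x e : E3) (hF : F x = (‖x‖ / ‖x + w ‖x‖‖) • (x + w ‖x‖)) :
    (∃ c : ℝ, x + w ‖x‖ = c • e) ↔ ∃ c : ℝ, F x = c • e := by
  constructor
  · rintro ⟨c, hc⟩
    exact ⟨‖x‖ / ‖x + w ‖x‖‖ * c, by rw [hF, hc, smul_smul]⟩
  · rintro ⟨c, hc⟩
    rcases eq_or_ne x 0 with rfl | hx0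
    · refine ⟨0, ?_⟩
      have : w 0 = 0 := by
        have h : Tendsto (fun ρ : ℝ => w ρ) (𝓝[>] 0) (𝓝 (w 0)) :=
          (hw.tendsto 0).mono_left nhdsWithin_le_nhds
        refine tendsto_nhds_unique h ?_
        rw [tendsto_zero_iff_norm_tendsto_zero]
        exact squeeze_zero' (Eventually.of_forall fun _ => norm_nonneg _)
          (eventually_nhdsWithin_of_forall fun ρ hρ => (hlt ρ hρ).le)
          (tendsto_id.mono_left nhdsWithin_le_nhds)
      simp [this]
    · have hxn : 0 < ‖x‖ := norm_pos_iff.2 hx0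
      have h5 : ‖x + w ‖x‖‖ ≠ 0 := by
        have h6 := norm_sub_norm_le x (-w ‖x‖)
        rw [norm_neg, sub_neg_eq_add] at h6
        have := hlt ‖x‖ hxn
        intro h
        linarith
      refine ⟨‖x + w ‖x‖‖ / ‖x‖ * c, ?_⟩
      rw [mul_smul, ← hc, hF, smul_smul, show ‖x + w ‖x‖‖ / ‖x‖ * (‖x‖ / ‖x + w ‖x‖‖) = 1 by
        field_simp, one_smul]

/-- A norm-preserving homeomorphism that carries a rounded corner to the first coordinate axis. -/
theorem exists_straightening {δ : ℝ} {χ : ℝ → ℝ} (hδ : 0 < δ) (hχ : IsCornerProfile δ χ) {u v : E3}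
    (hu : ‖u‖ = 1) (hv : ‖v‖ = 1) (huv : u ≠ v) :
    ∃ G : E3 ≃ₜ E3, (∀ x, ‖G x‖ = ‖x‖) ∧
      ∀ x, x ∈ range (corner χ u v) ↔ G x 1 = 0 ∧ G x 2 = 0 := by
  obtain ⟨w, hw, hlt, -, hx⟩ := exists_corner_offset hδ hχ hu hv huv
  obtain ⟨F, hF⟩ := exists_radial_homeomorph hw hlt
  set e := (1 / 2 : ℝ) • (v - u) with he
  have he0 : 0 < ‖e‖ := norm_half_sub_pos huv
  set b : E3 := EuclideanSpace.single 0 ‖e‖ with hb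
  have hbe : ‖e‖ = ‖b‖ := by simp [hb]
  set R := (ℝ ∙ (e - b))ᗮ.reflection
  have hR : R e = b := Submodule.reflection_sub hbe
  refine ⟨F.trans R.toHomeomorph, fun x => (R.norm_map (F x)).trans (hF x).2, fun x => ?_⟩
  change _ ↔ R (F x) 1 = 0 ∧ R (F x) 2 = 0
  rw [← hx, radial_mem_line_iff hw hlt x e (hF x).1]
  constructor
  · rintro ⟨c, hc⟩
    rw [hc, map_smul, hR]
    simp [hb]
  · rintro ⟨h1, h2⟩
    refine ⟨R (F x) 0 / ‖e‖, R.injective ?_⟩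
    rw [map_smul, hR]
    ext i
    fin_cases i
    · simp [hb, he0.ne']
    · simpa [hb] using h1
    · simpa [hb] using h2

/-- A norm-preserving homeomorphism that rounds a polygonal corner and is the identity away from the
vertex. -/
theorem exists_rounding {δ : ℝ} {χ χ' : ℝ → ℝ} (hδ : 0 < δ) (hχ : IsCornerProfile δ χ)
    (hχ' : IsCornerProfile δ χ') {u v : E3} (hu : ‖u‖ = 1) (hv : ‖v‖ = 1) (huv : u ≠ v) :
    ∃ G : E3 ≃ₜ E3, (∀ x, ‖G x‖ = ‖x‖) ∧ (∀ x, δ ≤ ‖x‖ → G x = x) ∧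
      ∀ x, G x ∈ range (corner χ' u v) ↔ x ∈ range (corner χ u v) := by
  obtain ⟨w, hw, hlt, hδw, hx⟩ := exists_corner_offset hδ hχ hu hv huv
  obtain ⟨F, hF⟩ := exists_radial_homeomorph hw hlt
  obtain ⟨w', hw', hlt', hδw', hx'⟩ := exists_corner_offset hδ hχ' hu hv huv
  obtain ⟨F', hF'⟩ := exists_radial_homeomorph hw' hlt'
  refine ⟨F.trans F'.symm, fun x => ?_, fun x hxδ => ?_, fun x => ?_⟩
  · change ‖F'.symm (F x)‖ = ‖x‖
    rw [← (hF' _).2, F'.apply_symm_apply, (hF x).2]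
  · change F'.symm (F x) = x
    rw [Homeomorph.symm_apply_eq, (hF x).1, (hF' x).1, hδw _ hxδ, hδw' _ hxδ]
  · change F'.symm (F x) ∈ _ ↔ _
    rw [← hx, ← hx', radial_mem_line_iff hw hlt _ _ (hF _).1,
      radial_mem_line_iff hw' hlt' _ _ (hF' _).1, F'.apply_symm_apply]

/-! ### Unknotted pairs of balls -/

/-- A continuous bijection of a compact set onto the unit ball gives an unknotted pair. -/
theorem isTrivialBallPair_of_bijOn {n m : ℕ} {D X : Set (EuclideanSpace ℝ (Fin n))}
    (hD : IsCompact D) {f : EuclideanSpace ℝ (Fin n) → EuclideanSpace ℝ (Fin n)}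
    (hf : ContinuousOn f D) (hbij : BijOn f D (Metric.closedBall 0 1))
    (hX : ∀ x ∈ D, x ∈ X ↔ ∀ i : Fin n, m ≤ (i : ℕ) → f x i = 0) : IsTrivialBallPair m D X := by
  have : CompactSpace D := isCompact_iff_compactSpace.1 hD
  refine ⟨Continuous.homeoOfEquivCompactToT2 (f := hbij.equiv f) ?_, fun x => hX x x.2⟩
  exact Continuous.subtype_mk (continuousOn_iff_continuous_domRestrict.1 hf) _

/-- The set `A` is straightened about `c`, within the ball of radius `r`, by a norm-preserving
homeomorphism: it corresponds there to the first coordinate axis. -/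
def IsStraightenedBy (G : E3 ≃ₜ E3) (A : Set E3) (c : E3) (r : ℝ) : Prop :=
  (∀ x, ‖G x‖ = ‖x‖) ∧ ∀ x, ‖x - c‖ ≤ r → (x ∈ A ↔ G (x - c) 1 = 0 ∧ G (x - c) 2 = 0)

theorem IsStraightenedBy.isTrivialBallPair {G : E3 ≃ₜ E3} {A : Set E3} {c : E3} {r : ℝ}
    (h : IsStraightenedBy G A c r) (hr : 0 < r) :
    IsTrivialBallPair 1 (Metric.closedBall c r) A := by
  refine isTrivialBallPair_of_bijOn (isCompact_closedBall c r) (f := fun x => r⁻¹ • G (x - c))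
    (Continuous.continuousOn (by have := G.continuous; fun_prop)) ⟨?_, ?_, ?_⟩ ?_
  · intro x hx
    rw [mem_closedBall_iff_norm] at hx
    rw [mem_closedBall_zero_iff, norm_smul, h.1, norm_inv, Real.norm_of_nonneg hr.le,
      inv_mul_le_iff₀ hr, mul_one]
    exact hx
  · intro x _ y _ hxy
    have := smul_right_injective E3 (inv_ne_zero hr.ne') hxy
    exact sub_left_injective (G.injective this)
  · intro y hy
    rw [mem_closedBall_zero_iff] at hy
    refine ⟨c + G.symm (r • y), ?_, ?_⟩
    · rw [mem_closedBall_iff_norm, add_sub_cancel_left, ← h.1, G.apply_symm_apply, norm_smul,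
        Real.norm_of_nonneg hr.le]
      nlinarith
    · simp only [add_sub_cancel_left, G.apply_symm_apply, smul_smul]
      rw [inv_mul_cancel₀ hr.ne', one_smul]
  · intro x hx
    rw [mem_closedBall_iff_norm] at hx
    rw [h.2 x hx]
    constructor
    · rintro ⟨h1, h2⟩ i hi
      fin_cases i
      · simp at hi
      · simp [h1]
      · simp [h2]
    · intro hi
      have h1 := hi 1 (by simp)
      have h2 := hi 2 (by simp)
      simp only [PiLp.smul_apply, smul_eq_mul, mul_eq_zero, inv_eq_zero, hr.ne', false_or] at h1 h2
      exact ⟨h1, h2⟩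

/-- A half-ball with its vertical radius is an unknotted pair: stretch each vertical chord to twice its
length. -/
theorem isTrivialBallPair_halfBall {A : Set E3} {c : E3} (hc : c 2 = 0) {r : ℝ} (hr : 0 < r)
    (hA : ∀ x, 0 ≤ x 2 → ‖x - c‖ ≤ r → (x ∈ A ↔ x 0 = c 0 ∧ x 1 = c 1)) :
    IsTrivialBallPair 1 {x : E3 | 0 ≤ x 2 ∧ ‖x - c‖ ≤ r} A := by
  set q : E3 → ℝ := fun x => Real.sqrt (r ^ 2 - (x 0 - c 0) ^ 2 - (x 1 - c 1) ^ 2) with hq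
  set f : E3 → E3 := fun x =>
    !₂[r⁻¹ * (2 * x 2 - q x), r⁻¹ * (x 0 - c 0), r⁻¹ * (x 1 - c 1)] with hf
  have hmem : ∀ x : E3, ‖x - c‖ ≤ r ↔ (x 0 - c 0) ^ 2 + (x 1 - c 1) ^ 2 + x 2 ^ 2 ≤ r ^ 2 := by
    intro x
    rw [← abs_of_nonneg (norm_nonneg (x - c)), ← sq_le_sq₀ (abs_nonneg _) hr.le, sq_abs, E3.norm_sq]
    simp [hc]
  have hmem0 : ∀ y : E3, ‖y‖ ≤ 1 ↔ y 0 ^ 2 + y 1 ^ 2 + y 2 ^ 2 ≤ 1 := by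
    intro y
    rw [← abs_of_nonneg (norm_nonneg y), ← sq_le_sq₀ (abs_nonneg _) zero_le_one, sq_abs, E3.norm_sq,
      one_pow]
  have hq2 : ∀ x : E3, (x 0 - c 0) ^ 2 + (x 1 - c 1) ^ 2 + x 2 ^ 2 ≤ r ^ 2 →
      q x ^ 2 = r ^ 2 - (x 0 - c 0) ^ 2 - (x 1 - c 1) ^ 2 := by
    intro x hx
    exact Real.sq_sqrt (by nlinarith [sq_nonneg (x 2)])
  have hq0 : ∀ x, 0 ≤ q x := fun x => Real.sqrt_nonneg _
  have hcompact : IsCompact {x : E3 | 0 ≤ x 2 ∧ ‖x - c‖ ≤ r} := by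
    have : {x : E3 | 0 ≤ x 2 ∧ ‖x - c‖ ≤ r} = {x : E3 | 0 ≤ x 2} ∩ Metric.closedBall c r := by
      ext x; simp only [mem_ofPred_eq, mem_inter_iff, mem_closedBall_iff_norm]
    rw [this]
    exact (isCompact_closedBall c r).inter_left (isClosed_le continuous_const (by fun_prop))
  refine isTrivialBallPair_of_bijOn hcompact (f := f) ?_ ⟨?_, ?_, ?_⟩ ?_
  · apply Continuous.continuousOn
    simp only [hf, hq]
    fun_prop
  · rintro x ⟨hx0, hx⟩
    rw [hmem] at hx
    rw [mem_closedBall_zero_iff, hmem0]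
    simp only [hf, Matrix.cons_val]
    have h1 := hq2 x hx
    have h2 := hq0 x
    have h3 : x 2 ≤ q x := by
      apply abs_le_of_sq_le_sq' _ h2 |>.2
      linarith
    rw [mul_pow, mul_pow, mul_pow, ← mul_add, ← mul_add, inv_pow, inv_mul_le_iff₀ (by positivity)]
    nlinarith [mul_nonneg hx0 (sub_nonneg.2 h3)]
  · rintro x ⟨hx0, hx⟩ y ⟨hy0, hy⟩ hxy
    have e0 : f x 0 = f y 0 := by rw [hxy]
    have e1 : f x 1 = f y 1 := by rw [hxy]
    have e2 : f x 2 = f y 2 := by rw [hxy]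
    simp only [hf, Matrix.cons_val, mul_eq_mul_left_iff, inv_eq_zero, hr.ne', or_false] at e0 e1 e2
    have e3 : q x = q y := by simp only [hq, e1, e2]
    ext i
    fin_cases i
    · exact sub_left_injective e1
    · exact sub_left_injective e2
    · change x 2 = y 2
      linarith
  · intro y hy
    rw [mem_closedBall_zero_iff, hmem0] at hy
    set s := Real.sqrt (1 - y 1 ^ 2 - y 2 ^ 2) with hs
    have hs2 : s ^ 2 = 1 - y 1 ^ 2 - y 2 ^ 2 := Real.sq_sqrt (by nlinarith [sq_nonneg (y 0)])
    have hs0 : 0 ≤ s := Real.sqrt_nonneg _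
    have hys := abs_le_of_sq_le_sq' (show y 0 ^ 2 ≤ s ^ 2 by linarith) hs0
    set x : E3 := !₂[c 0 + r * y 1, c 1 + r * y 2, r * (y 0 + s) / 2] with hx
    have hqx : q x = r * s := by
      simp only [hq, hx, Matrix.cons_val]
      rw [← Real.sqrt_sq (mul_nonneg hr.le hs0), mul_pow, hs2]
      congr 1
      ring
    refine ⟨x, ⟨?_, ?_⟩, ?_⟩
    · simp only [hx, Matrix.cons_val]
      have := mul_nonneg hr.le (by linarith : 0 ≤ y 0 + s)
      linarith
    · rw [hmem]
      simp only [hx, Matrix.cons_val]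
      have h1 : ((y 0 + s) / 2) ^ 2 ≤ s ^ 2 := by
        apply sq_le_sq' <;> linarith
      have h2 : r ^ 2 * ((y 0 + s) / 2) ^ 2 ≤ r ^ 2 * s ^ 2 :=
        mul_le_mul_of_nonneg_left h1 (sq_nonneg r)
      rw [hs2] at h2
      nlinarith
    · simp only [hf, hqx]
      ext i
      fin_cases i <;> simp [hx] <;> field_simp <;> ring
  · rintro x ⟨hx0, hx⟩
    rw [hA x hx0 hx]
    constructor
    · rintro ⟨h1, h2⟩ i hi
      fin_cases i
      · simp at hi
      · simp [hf, h1]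
      · simp [hf, h2]
    · intro hi
      have h1 := hi 1 (by simp)
      have h2 := hi 2 (by simp)
      simp only [hf, Matrix.cons_val, mul_eq_zero, inv_eq_zero, hr.ne', false_or, sub_eq_zero]
        at h1 h2
      exact ⟨h1, h2⟩

/-! ### Spun balls -/

theorem E4.norm_sq (x : E4) : ‖x‖ ^ 2 = x 0 ^ 2 + x 1 ^ 2 + x 2 ^ 2 + x 3 ^ 2 := by
  rw [EuclideanSpace.norm_sq_eq, Fin.sum_univ_four]
  simp only [Real.norm_eq_abs, sq_abs]

theorem spinRot_neg_apply (θ : ℝ) (x : E4) : spinRot (-θ) (spinRot θ x) = x := by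
  have h := Real.sin_sq_add_cos_sq θ
  ext i
  fin_cases i
  · simp [spinRot]
  · simp [spinRot]
  · simp [spinRot]
    linear_combination x 2 * h
  · simp [spinRot]
    linear_combination x 3 * h

theorem continuous_spinRot (θ : ℝ) : Continuous (spinRot θ) := by
  unfold spinRot
  fun_prop

/-- The rotation of four-space about the boundary plane, as a homeomorphism. -/
noncomputable def spinHomeomorph (θ : ℝ) : E4 ≃ₜ E4 where
  toFun := spinRot θ
  invFun := spinRot (-θ)
  left_inv := spinRot_neg_apply θ
  right_inv x := by simpa using spinRot_neg_apply (-θ) x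
  continuous_toFun := continuous_spinRot θ
  continuous_invFun := continuous_spinRot (-θ)

theorem dist_spinRot (θ : ℝ) (x y : E4) : dist (spinRot θ x) (spinRot θ y) = dist x y := by
  have h := Real.sin_sq_add_cos_sq θ
  rw [← pow_left_inj₀ dist_nonneg dist_nonneg two_ne_zero, dist_eq_norm, dist_eq_norm, E4.norm_sq,
    E4.norm_sq]
  simp only [spinRot, PiLp.sub_apply, Matrix.cons_val]
  linear_combination ((x 2 - y 2) ^ 2 + (x 3 - y 3) ^ 2) * h

/-- The distance of a point from the boundary plane together with its position along the plane: the
point of the half-space whose orbit under the rotations contains the given point. -/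
noncomputable def unspin (y : E4) : E3 := !₂[y 0, y 1, Real.sqrt (y 2 ^ 2 + y 3 ^ 2)]

theorem unspin_spinRot (θ : ℝ) (y : E4) : unspin (spinRot θ y) = unspin y := by
  have h := Real.sin_sq_add_cos_sq θ
  have e : (y 2 * Real.cos θ - y 3 * Real.sin θ) ^ 2 + (y 2 * Real.sin θ + y 3 * Real.cos θ) ^ 2 =
      y 2 ^ 2 + y 3 ^ 2 := by linear_combination (y 2 ^ 2 + y 3 ^ 2) * h
  simp only [unspin, spinRot, Matrix.cons_val, e]

theorem mem_spinSet_iff {A : Set E3} (hA : ∀ x ∈ A, 0 ≤ x 2) {y : E4} :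
    y ∈ spinSet A ↔ unspin y ∈ A := by
  constructor
  · rintro ⟨x, hx, θ, -, rfl⟩
    rw [unspin_spinRot]
    convert hx
    ext i
    fin_cases i <;> simp [unspin, toFour, Real.sqrt_sq (hA x hx)]
  · intro h
    set w : ℂ := ⟨y 2, y 3⟩ with hw
    have hn : ‖w‖ = Real.sqrt (y 2 ^ 2 + y 3 ^ 2) := by
      rw [Complex.norm_def, Complex.normSq_apply, ← sq, ← sq]
    have key : ∀ θ, Real.cos θ = Real.cos w.arg → Real.sin θ = Real.sin w.arg →
        y = spinRot θ (toFour (unspin y)) := by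
      intro θ hc hs
      have h1 := Complex.norm_mul_cos_arg w
      have h2 := Complex.norm_mul_sin_arg w
      rw [hn] at h1 h2
      ext i
      fin_cases i
      · simp [spinRot, toFour, unspin]
      · simp [spinRot, toFour, unspin]
      · simpa [spinRot, toFour, unspin, hc] using h1.symm
      · simpa [spinRot, toFour, unspin, hs] using h2.symm
    have ha := Complex.arg_mem_Ioc w
    rcases le_or_gt 0 w.arg with h0 | h0
    · exact ⟨_, h, w.arg, ⟨h0, by linarith [ha.2, Real.pi_pos]⟩, key _ rfl rfl⟩
    · exact ⟨_, h, w.arg + 2 * Real.pi, ⟨by linarith [ha.1, Real.pi_pos], by linarith⟩,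
        key _ (Real.cos_add_two_pi _) (Real.sin_add_two_pi _)⟩

theorem IsTrivialBallPair.image {n m : ℕ} {D X : Set (EuclideanSpace ℝ (Fin n))}
    (h : IsTrivialBallPair m D X) (e : EuclideanSpace ℝ (Fin n) ≃ₜ EuclideanSpace ℝ (Fin n)) :
    IsTrivialBallPair m (e '' D) (e '' X) := by
  obtain ⟨f, hf⟩ := h
  refine ⟨(e.image D).symm.trans f, ?_⟩
  intro x
  obtain ⟨y, rfl⟩ := (e.image D).surjective x
  change e y ∈ e '' X ↔ ∀ i : Fin n, m ≤ (i : ℕ) → (f ((e.image D).symm (e.image D y))).1 i = 0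
  rw [Homeomorph.symm_apply_apply, ← hf y, e.injective.mem_set_image]

/-- The spun ball in coordinates adapted to the caps: every point `(h, t)` of the disk is attained. -/
theorem exists_cap_point {z h t r : ℝ} (hz : 0 < z) (hr : 2 * r ^ 2 = z ^ 2)
    (hle : (h - z) ^ 2 + t ^ 2 ≤ r ^ 2) : ∃ w2 w3 : ℝ, 0 < w2 ∧
      Real.sqrt (w2 ^ 2 + w3 ^ 2) = h ∧
      Real.sqrt (2 * z) * w3 / Real.sqrt (h + w2) = t := by
  obtain ⟨w2, hw2⟩ : ∃ w, w = h - t ^ 2 / (2 * z) := ⟨_, rfl⟩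
  have e1 : 2 * z * w2 = 2 * z * h - t ^ 2 := by rw [hw2]; field_simp
  have hz2 := pow_pos hz 2
  have hw0 : 0 < w2 := by
    have : 0 < 2 * z * w2 := by nlinarith [sq_nonneg h]
    exact pos_of_mul_pos_right this (by positivity)
  have hwh : w2 ≤ h := by
    have : 0 ≤ t ^ 2 / (2 * z) := by positivity
    linarith
  have hh0 : 0 < h := hw0.trans_le hwh
  have h5 : 0 < Real.sqrt (h + w2) := Real.sqrt_pos.2 (by positivity)
  have h6 : 0 < Real.sqrt (2 * z) := Real.sqrt_pos.2 (by positivity)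
  have e3 : (t * Real.sqrt (h + w2) / Real.sqrt (2 * z)) ^ 2 = h ^ 2 - w2 ^ 2 := by
    rw [div_pow, mul_pow, Real.sq_sqrt (by positivity), Real.sq_sqrt (by positivity),
      div_eq_iff (by positivity)]
    linear_combination (h + w2) * e1
  refine ⟨w2, t * Real.sqrt (h + w2) / Real.sqrt (2 * z), hw0, ?_, ?_⟩
  · rw [e3, add_sub_cancel, Real.sqrt_sq hh0.le]
  · field_simp

/-- Spinning a ball pair: a four-ball centered at height `z` with radius `z / √2` is the union of
spherical caps lying over the points of a three-ball, and the caps carry a coordinate `T` for which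
`‖X - c‖ ^ 2 + T ^ 2` is the squared distance from the center. -/
theorem isTrivialBallPair_spinSet_zero {G : E3 ≃ₜ E3} {A : Set E3} {c : E3} {r : ℝ}
    (hG : IsStraightenedBy G A c r) (hA : ∀ x ∈ A, 0 ≤ x 2) (hc : 0 < c 2) (hr : 0 < r)
    (hcr : 2 * r ^ 2 = c 2 ^ 2) :
    IsTrivialBallPair 2 (Metric.closedBall (toFour c) r) (spinSet A) := by
  set z := c 2 with hz
  have hmem : ∀ y : E4, y ∈ Metric.closedBall (toFour c) r ↔
      (y 0 - c 0) ^ 2 + (y 1 - c 1) ^ 2 + (y 2 - z) ^ 2 + y 3 ^ 2 ≤ r ^ 2 := by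
    intro y
    rw [mem_closedBall_iff_norm, ← sq_le_sq₀ (norm_nonneg _) hr.le, E4.norm_sq]
    simp [toFour, hz]
  have hpos : ∀ y ∈ Metric.closedBall (toFour c) r, 0 < y 2 := by
    intro y hy
    rw [hmem] at hy
    nlinarith [sq_nonneg (y 0 - c 0), sq_nonneg (y 1 - c 1), sq_nonneg (y 3), sq_nonneg (y 2)]
  set T : E4 → ℝ := fun y => Real.sqrt (2 * z) * y 3 / Real.sqrt (unspin y 2 + y 2) with hT
  have hu : ∀ y : E4, unspin y 2 ^ 2 = y 2 ^ 2 + y 3 ^ 2 := fun y => by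
    simp only [unspin, Matrix.cons_val]
    exact Real.sq_sqrt (by positivity)
  have hu0 : ∀ y : E4, 0 ≤ unspin y 2 := fun y => Real.sqrt_nonneg _
  have hT2 : ∀ y : E4, 0 < y 2 → T y ^ 2 = 2 * z * (unspin y 2 - y 2) := by
    intro y hy
    have h1 : 0 < unspin y 2 + y 2 := by linarith [hu0 y]
    rw [hT]
    simp only [div_pow, mul_pow]
    rw [Real.sq_sqrt (by positivity), Real.sq_sqrt h1.le, div_eq_iff h1.ne']
    linear_combination (-2 * z) * hu y
  have hsum : ∀ y : E4, 0 < y 2 → ‖unspin y - c‖ ^ 2 + T y ^ 2 =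
      (y 0 - c 0) ^ 2 + (y 1 - c 1) ^ 2 + (y 2 - z) ^ 2 + y 3 ^ 2 := by
    intro y hy
    rw [hT2 y hy, E3.norm_sq]
    have h0 : unspin y 0 = y 0 := rfl
    have h1 : unspin y 1 = y 1 := rfl
    simp only [PiLp.sub_apply, h0, h1, ← hz]
    linear_combination hu y
  have hle : ∀ y ∈ Metric.closedBall (toFour c) r, ‖unspin y - c‖ ≤ r := by
    intro y hy
    have h1 := hsum y (hpos y hy)
    have h2 := (hmem y).1 hy
    exact (sq_le_sq₀ (norm_nonneg _) hr.le).1 (by nlinarith [sq_nonneg (T y)])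
  set f : E4 → E4 := fun y => r⁻¹ •
    !₂[G (unspin y - c) 0, T y, G (unspin y - c) 1, G (unspin y - c) 2] with hf
  have hfn : ∀ y : E4, 0 < y 2 → ‖f y‖ ^ 2 = (r⁻¹) ^ 2 *
      ((y 0 - c 0) ^ 2 + (y 1 - c 1) ^ 2 + (y 2 - z) ^ 2 + y 3 ^ 2) := by
    intro y hy
    rw [← hsum y hy, ← hG.1, hf]
    simp only [norm_smul, mul_pow, E4.norm_sq, E3.norm_sq, Matrix.cons_val, Real.norm_eq_abs, sq_abs]
    ring
  have hunspin : Continuous unspin := by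
    unfold unspin
    fun_prop
  refine isTrivialBallPair_of_bijOn (isCompact_closedBall _ _) (f := f) ?_ ⟨?_, ?_, ?_⟩ ?_
  · have h1 : Continuous fun y : E4 => G (unspin y - c) := by
      have := G.continuous
      fun_prop
    have h2 : ContinuousOn T (Metric.closedBall (toFour c) r) := by
      have h3 : Continuous fun y : E4 => unspin y 2 + y 2 := by fun_prop
      refine ContinuousOn.div (by fun_prop) h3.sqrt.continuousOn fun y hy => ?_
      exact (Real.sqrt_pos.2 (by linarith [hu0 y, hpos y hy])).ne'
    have h4 : ContinuousOn (fun y => ![G (unspin y - c) 0, T y, G (unspin y - c) 1,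
        G (unspin y - c) 2]) (Metric.closedBall (toFour c) r) := by
      rw [continuousOn_pi]
      intro i
      have h5 : ∀ j : Fin 3, ContinuousOn (fun y => G (unspin y - c) j)
          (Metric.closedBall (toFour c) r) := fun j => Continuous.continuousOn (by fun_prop)
      fin_cases i
      exacts [h5 0, h2, h5 1, h5 2]
    exact ((PiLp.continuous_toLp 2 _).comp_continuousOn h4).const_smul r⁻¹
  · intro y hy
    rw [mem_closedBall_zero_iff, ← sq_le_sq₀ (norm_nonneg _) zero_le_one, hfn y (hpos y hy), inv_pow,
      inv_mul_le_iff₀ (by positivity)]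
    simpa using (hmem y).1 hy
  · intro y hy y' hy' hyy
    have h1 := smul_right_injective E4 (inv_ne_zero hr.ne') hyy
    have hTT : T y = T y' := congrArg (fun v : E4 => v 1) h1
    have hX : unspin y = unspin y' := by
      have h2 : G (unspin y - c) = G (unspin y' - c) := by
        ext i
        fin_cases i
        · exact congrArg (fun v : E4 => v 0) h1
        · exact congrArg (fun v : E4 => v 2) h1
        · exact congrArg (fun v : E4 => v 3) h1
      exact sub_left_injective (G.injective h2)
    have e0 : y 0 = y' 0 := congrArg (fun v : E3 => v 0) hX
    have e1 : y 1 = y' 1 := congrArg (fun v : E3 => v 1) hX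
    have e2 : y 2 = y' 2 := by
      have h2 := hT2 y (hpos y hy)
      rw [hTT, hT2 y' (hpos y' hy'), hX] at h2
      have := mul_left_cancel₀ (by positivity) h2
      linarith
    have e3 : y 3 = y' 3 := by
      have h3 : 0 < Real.sqrt (unspin y' 2 + y' 2) :=
        Real.sqrt_pos.2 (by linarith [hu0 y', hpos y' hy'])
      have h4 : 0 < Real.sqrt (2 * z) := Real.sqrt_pos.2 (by positivity)
      simp only [hT, hX, e2] at hTT
      rw [div_left_inj' h3.ne'] at hTT
      exact mul_left_cancel₀ h4.ne' hTT
    ext i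
    fin_cases i
    exacts [e0, e1, e2, e3]
  · intro y hy
    rw [mem_closedBall_zero_iff, ← sq_le_sq₀ (norm_nonneg _) zero_le_one, E4.norm_sq, one_pow] at hy
    set g : E3 := !₂[r * y 0, r * y 2, r * y 3] with hg
    set X : E3 := c + G.symm g with hX
    have hXg : G (X - c) = g := by rw [hX, add_sub_cancel_left, G.apply_symm_apply]
    have hXn : ‖X - c‖ ^ 2 + (r * y 1) ^ 2 ≤ r ^ 2 := by
      rw [← hG.1, hXg, E3.norm_sq]
      simp only [hg, Matrix.cons_val]
      nlinarith [mul_le_mul_of_nonneg_left hy (sq_nonneg r)]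
    rw [E3.norm_sq] at hXn
    simp only [PiLp.sub_apply, ← hz] at hXn
    set t := r * y 1 with ht
    obtain ⟨w2, w3, hw0, hw1, hw2⟩ := exists_cap_point hc hcr
      (by nlinarith [sq_nonneg (X 0 - c 0), sq_nonneg (X 1 - c 1)] : (X 2 - z) ^ 2 + t ^ 2 ≤ r ^ 2)
    set x : E4 := !₂[X 0, X 1, w2, w3] with hx
    have hux : unspin x = X := by
      ext i
      fin_cases i
      · rfl
      · rfl
      · exact hw1
    have hTx : T x = t := by
      simp only [hT, hux]
      exact hw2
    refine ⟨x, ?_, ?_⟩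
    · rw [hmem]
      have h7 := hsum x hw0
      rw [hux, hTx, E3.norm_sq] at h7
      rw [← h7]
      exact hXn
    · simp only [hf, hux, hTx, hXg, hg, Matrix.cons_val]
      ext i
      fin_cases i <;> simp [ht] <;> field_simp
  · intro y hy
    rw [mem_spinSet_iff hA, hG.2 _ (hle y hy)]
    constructor
    · rintro ⟨h1, h2⟩ i hi
      fin_cases i
      · simp at hi
      · simp at hi
      · simp [hf, h1]
      · simp [hf, h2]
    · intro hi
      have h1 := hi 2 (by simp)
      have h2 := hi 3 (by simp)
      simp only [hf, PiLp.smul_apply, smul_eq_mul, mul_eq_zero, inv_eq_zero, hr.ne', false_or,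
        Matrix.cons_val] at h1 h2
      exact ⟨h1, h2⟩

/-- By rotation it is enough to consider the ball centered in the half-space. -/
theorem isTrivialBallPair_spinSet {G : E3 ≃ₜ E3} {A : Set E3} {c : E3} {r : ℝ}
    (hG : IsStraightenedBy G A c r) (hA : ∀ x ∈ A, 0 ≤ x 2) (hc : 0 < c 2) (hr : 0 < r)
    (hcr : 2 * r ^ 2 = c 2 ^ 2) (θ : ℝ) :
    IsTrivialBallPair 2 (Metric.closedBall (spinRot θ (toFour c)) r) (spinSet A) := by
  have h := (isTrivialBallPair_spinSet_zero hG hA hc hr hcr).image (spinHomeomorph θ)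
  have h1 : spinHomeomorph θ '' Metric.closedBall (toFour c) r =
      Metric.closedBall (spinRot θ (toFour c)) r := by
    ext y
    obtain ⟨x, rfl⟩ := (spinHomeomorph θ).surjective y
    rw [(spinHomeomorph θ).injective.mem_set_image, Metric.mem_closedBall, Metric.mem_closedBall]
    change _ ↔ dist (spinRot θ x) _ ≤ r
    rw [dist_spinRot]
  have h2 : spinHomeomorph θ '' spinSet A = spinSet A := by
    ext y
    obtain ⟨x, rfl⟩ := (spinHomeomorph θ).surjective y
    rw [(spinHomeomorph θ).injective.mem_set_image, mem_spinSet_iff hA, mem_spinSet_iff hA]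
    change _ ↔ unspin (spinRot θ x) ∈ A
    rw [unspin_spinRot]
  rwa [h1, h2] at h

/-! ### Rounded polygonal curves -/

/-- The length of the edge from `c k` to `c (k + 1)`. -/
noncomputable def edgeLength (c : ℕ → E3) (k : ℕ) : ℝ := dist (c k) (c (k + 1))

/-- The unit vector from `c k` towards `c (k + 1)`. -/
noncomputable def edgeDir (c : ℕ → E3) (k : ℕ) : E3 := (edgeLength c k)⁻¹ • (c (k + 1) - c k)

/-- The arc length of the polygonal line from `c 0` to `c k`. -/
noncomputable def arcTime (c : ℕ → E3) (k : ℕ) : ℝ := ∑ j ∈ Finset.range k, edgeLength c j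

/-- The polygonal line with vertices `c 0, …, c m`, parametrized over `[0, arcTime c m]`, with the corner
at `c k` rounded according to the profile `χ k`; it turns from the direction `edgeDir c (k - 1)` to
`edgeDir c k` near the time `arcTime c k`. -/
noncomputable def roundedCurve (c : ℕ → E3) (m : ℕ) (χ : ℕ → ℝ → ℝ) (t : ℝ) : E3 :=
  c 0 + t • edgeDir c 0 + ∑ j ∈ Finset.range (m - 1),
    ((t - arcTime c (j + 1) + χ (j + 1) (t - arcTime c (j + 1))) / 2) •
      (edgeDir c (j + 1) - edgeDir c j)

theorem edgeLength_nonneg (c : ℕ → E3) (k : ℕ) : 0 ≤ edgeLength c k := dist_nonneg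

theorem arcTime_succ (c : ℕ → E3) (k : ℕ) : arcTime c (k + 1) = arcTime c k + edgeLength c k :=
  Finset.sum_range_succ _ _

theorem arcTime_zero (c : ℕ → E3) : arcTime c 0 = 0 := Finset.sum_range_zero _

theorem monotone_arcTime (c : ℕ → E3) : Monotone (arcTime c) :=
  monotone_nat_of_le_succ fun k => by
    rw [arcTime_succ]
    linarith [edgeLength_nonneg c k]

theorem edgeLength_smul_edgeDir {c : ℕ → E3} {k : ℕ} (h : 0 < edgeLength c k) :
    edgeLength c k • edgeDir c k = c (k + 1) - c k := by
  rw [edgeDir, smul_smul, mul_inv_cancel₀ h.ne', one_smul]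

theorem norm_edgeDir {c : ℕ → E3} {k : ℕ} (h : 0 < edgeLength c k) : ‖edgeDir c k‖ = 1 := by
  rw [edgeDir, norm_smul, norm_inv, Real.norm_of_nonneg h.le, ← dist_eq_norm, dist_comm]
  exact inv_mul_cancel₀ h.ne'

/-- The partial sum of the corners that have been passed describes the edge following them. -/
theorem partial_roundedCurve {c : ℕ → E3} {δ : ℝ} {χ : ℕ → ℝ → ℝ} (hχ : ∀ k, IsCornerProfile δ (χ k))
    (hδ : 0 ≤ δ) {t : ℝ} {n : ℕ} (hl : ∀ k < n, 0 < edgeLength c k)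
    (ht : ∀ j, 1 ≤ j → j ≤ n → arcTime c j + δ ≤ t) :
    c 0 + t • edgeDir c 0 + ∑ j ∈ Finset.range n,
      ((t - arcTime c (j + 1) + χ (j + 1) (t - arcTime c (j + 1))) / 2) •
        (edgeDir c (j + 1) - edgeDir c j) = c n + (t - arcTime c n) • edgeDir c n := by
  induction n with
  | zero => simp [arcTime_zero]
  | succ n ih =>
    rw [Finset.sum_range_succ, ← add_assoc,
      ih (fun k hk => hl k (by omega)) (fun j h1 h2 => ht j h1 (by omega))]
    have h1 := ht (n + 1) (by omega) le_rfl
    rw [(hχ (n + 1)).eq_abs _ (by rw [abs_of_nonneg] <;> linarith), abs_of_nonneg (by linarith)]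
    have h2 := edgeLength_smul_edgeDir (hl n (by omega))
    have h3 : c (n + 1) = c n + edgeLength c n • edgeDir c n := by rw [h2]; abel
    rw [h3, arcTime_succ]
    module

theorem roundedCurve_eq_partial {c : ℕ → E3} {δ : ℝ} {χ : ℕ → ℝ → ℝ}
    (hχ : ∀ k, IsCornerProfile δ (χ k)) (hδ : 0 ≤ δ) {m n : ℕ} (hn : n < m) {t : ℝ}
    (ht : ∀ j, n < j → j < m → t ≤ arcTime c j - δ) :
    roundedCurve c m χ t = c 0 + t • edgeDir c 0 + ∑ j ∈ Finset.range n,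
      ((t - arcTime c (j + 1) + χ (j + 1) (t - arcTime c (j + 1))) / 2) •
        (edgeDir c (j + 1) - edgeDir c j) := by
  rw [roundedCurve]
  congr 1
  symm
  refine Finset.sum_subset (Finset.range_subset_range.2 (by omega)) fun j hj hj' => ?_
  rw [Finset.mem_range] at hj hj'
  have h1 := ht (j + 1) (by omega) (by omega)
  rw [(hχ (j + 1)).eq_abs _ (by rw [abs_of_nonpos] <;> linarith), abs_of_nonpos (by linarith)]
  simp

theorem roundedCurve_eq_edge {c : ℕ → E3} {δ : ℝ} {χ : ℕ → ℝ → ℝ}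
    (hχ : ∀ k, IsCornerProfile δ (χ k)) (hδ : 0 ≤ δ) {m n : ℕ} (hn : n < m)
    (hl : ∀ k < m, 0 < edgeLength c k) {t : ℝ}
    (ht : ∀ j, 1 ≤ j → j ≤ n → arcTime c j + δ ≤ t)
    (ht' : ∀ j, n < j → j < m → t ≤ arcTime c j - δ) :
    roundedCurve c m χ t = c n + (t - arcTime c n) • edgeDir c n := by
  rw [roundedCurve_eq_partial hχ hδ hn ht',
    partial_roundedCurve hχ hδ (fun k hk => hl k (hk.trans hn)) ht]

theorem roundedCurve_eq_corner {c : ℕ → E3} {δ : ℝ} {χ : ℕ → ℝ → ℝ}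
    (hχ : ∀ k, IsCornerProfile δ (χ k)) (hδ : 0 ≤ δ) {m n : ℕ} (hn : n + 1 < m)
    (hl : ∀ k < m, 0 < edgeLength c k) {t : ℝ}
    (ht : ∀ j, 1 ≤ j → j ≤ n → arcTime c j + δ ≤ t)
    (ht' : ∀ j, n + 1 < j → j < m → t ≤ arcTime c j - δ) :
    roundedCurve c m χ t = c (n + 1) +
      corner (χ (n + 1)) (-edgeDir c n) (edgeDir c (n + 1)) (t - arcTime c (n + 1)) := by
  rw [roundedCurve_eq_partial hχ hδ hn ht', Finset.sum_range_succ, ← add_assoc,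
    partial_roundedCurve hχ hδ (fun k hk => hl k (by omega)) ht]
  have h2 := edgeLength_smul_edgeDir (hl n (by omega))
  have h3 : c (n + 1) = c n + edgeLength c n • edgeDir c n := by rw [h2]; abel
  rw [corner, h3, arcTime_succ]
  module

theorem continuous_roundedCurve {c : ℕ → E3} {m : ℕ} {χ : ℕ → ℝ → ℝ} (hχ : ∀ k, Continuous (χ k)) :
    Continuous (roundedCurve c m χ) := by
  unfold roundedCurve
  fun_prop

/-- The image of `roundedCurve`. -/
noncomputable def roundedArc (c : ℕ → E3) (m : ℕ) (χ : ℕ → ℝ → ℝ) : Set E3 :=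
  roundedCurve c m χ '' Icc 0 (arcTime c m)

theorem exists_mem_edge {c : ℕ → E3} {m : ℕ} (hm : 0 < m) {t : ℝ} (ht : t ∈ Icc 0 (arcTime c m)) :
    ∃ n < m, t ∈ Icc (arcTime c n) (arcTime c (n + 1)) := by
  have hm1 : m - 1 + 1 = m := Nat.sub_add_cancel hm
  have hex : ∃ n, t ≤ arcTime c (n + 1) := ⟨m - 1, by rw [hm1]; exact ht.2⟩
  refine ⟨Nat.find hex, ?_, ?_, Nat.find_spec hex⟩
  · have := Nat.find_min' hex (show t ≤ arcTime c (m - 1 + 1) by rw [hm1]; exact ht.2)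
    omega
  · rcases Nat.eq_zero_or_pos (Nat.find hex) with h | h
    · rw [h, arcTime_zero]
      exact ht.1
    · have := Nat.find_min hex (show Nat.find hex - 1 < Nat.find hex by omega)
      rw [Nat.sub_add_cancel h] at this
      exact (not_le.1 this).le

theorem roundedArc_abs {c : ℕ → E3} {m : ℕ} (hm : 0 < m) (hl : ∀ k < m, 0 < edgeLength c k) :
    roundedArc c m (fun _ s => |s|) = polygonalArc c m := by
  have hχ : ∀ _ : ℕ, IsCornerProfile 0 (fun s => |s|) := fun _ => isCornerProfile_abs 0
  have hedge : ∀ n < m, ∀ t ∈ Icc (arcTime c n) (arcTime c (n + 1)),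
      roundedCurve c m (fun _ s => |s|) t = c n + (t - arcTime c n) • edgeDir c n := by
    intro n hn t ht
    refine roundedCurve_eq_edge hχ le_rfl hn hl (fun j _ hj => ?_) (fun j hj _ => ?_)
    · linarith [ht.1, monotone_arcTime c hj]
    · linarith [ht.2, monotone_arcTime c (Nat.succ_le_of_lt hj)]
  have hseg : ∀ n < m, ∀ a : ℝ, c n + a • (c (n + 1) - c n) =
      c n + (a * edgeLength c n) • edgeDir c n := by
    intro n hn a
    rw [← edgeLength_smul_edgeDir (hl n hn), smul_smul]
  ext x
  simp only [roundedArc, polygonalArc, mem_image, mem_iUnion, Finset.mem_range, segment_eq_image',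
    exists_prop]
  constructor
  · rintro ⟨t, ht, rfl⟩
    obtain ⟨n, hn, htn⟩ := exists_mem_edge hm ht
    refine ⟨n, hn, (t - arcTime c n) / edgeLength c n, ⟨?_, ?_⟩, ?_⟩
    · exact div_nonneg (by linarith [htn.1]) (hl n hn).le
    · rw [div_le_one (hl n hn)]
      linarith [htn.2, arcTime_succ c n]
    · rw [hseg n hn, hedge n hn t htn, div_mul_cancel₀ _ (hl n hn).ne']
  · rintro ⟨n, hn, a, ha, rfl⟩
    have h1 : 0 ≤ a * edgeLength c n := mul_nonneg ha.1 (hl n hn).le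
    have h2 : a * edgeLength c n ≤ edgeLength c n := mul_le_of_le_one_left (hl n hn).le ha.2
    have h3 : arcTime c n + a * edgeLength c n ∈ Icc (arcTime c n) (arcTime c (n + 1)) := by
      rw [arcTime_succ]
      exact ⟨by linarith, by linarith⟩
    refine ⟨arcTime c n + a * edgeLength c n, ⟨?_, ?_⟩, ?_⟩
    · have := monotone_arcTime c (Nat.zero_le n)
      rw [arcTime_zero] at this
      linarith
    · exact h3.2.trans (monotone_arcTime c hn)
    · rw [hedge n hn _ h3, hseg n hn, add_sub_cancel_left]

/-! ### Chains of orthogonal balls along a polygonal line -/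

/-- A chain of balls in the half-space whose traces are the pearls of a necklace: consecutive bounding
spheres are orthogonal, other balls are disjoint, the outer balls are centered on the boundary plane
below the centers of their neighbours, and an inner ball centered at height `z` has radius `z / √2`. -/
structure IsPearlChain (m : ℕ) (c : ℕ → E3) (r : ℕ → ℝ) : Prop where
  one_lt : 1 < m
  radius_pos : ∀ k ≤ m, 0 < r k
  orthogonal : ∀ k < m, edgeLength c k ^ 2 = r k ^ 2 + r (k + 1) ^ 2
  disjoint : ∀ j k, j + 1 < k → k ≤ m → r j + r k < dist (c j) (c k)
  height_pos : ∀ k, 1 ≤ k → k < m → 0 < c k 2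
  radius_sq : ∀ k, 1 ≤ k → k < m → 2 * r k ^ 2 = c k 2 ^ 2
  first_eq : c 0 = !₂[c 1 0, c 1 1, 0]
  last_eq : c m = !₂[c (m - 1) 0, c (m - 1) 1, 0]

/-- A width `δ` small enough for rounding the corners of the polygonal line within the balls of a
chain. -/
structure IsRoundingWidth (m : ℕ) (c : ℕ → E3) (r : ℕ → ℝ) (δ : ℝ) : Prop where
  pos : 0 < δ
  lt_radius : ∀ k ≤ m, δ < r k
  left_lt : ∀ k < m, r k + δ < edgeLength c k
  right_lt : ∀ k < m, r (k + 1) + δ < edgeLength c k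

theorem IsPearlChain.edgeLength_pos {m : ℕ} {c : ℕ → E3} {r : ℕ → ℝ} (h : IsPearlChain m c r) {k : ℕ}
    (hk : k < m) : 0 < edgeLength c k := by
  have h1 := h.orthogonal k hk
  have h2 := h.radius_pos k hk.le
  refine lt_of_le_of_ne (edgeLength_nonneg c k) fun h0 => ?_
  rw [← h0] at h1
  nlinarith [sq_nonneg (r (k + 1))]

theorem IsPearlChain.exists_isRoundingWidth {m : ℕ} {c : ℕ → E3} {r : ℕ → ℝ}
    (h : IsPearlChain m c r) : ∃ δ, IsRoundingWidth m c r δ := by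
  have hsmall : ∀ a : ℝ, 0 < a → ∀ᶠ δ in 𝓝[>] (0 : ℝ), δ < a := fun a ha =>
    (eventually_lt_nhds ha).filter_mono nhdsWithin_le_nhds
  have h1 : ∀ᶠ δ in 𝓝[>] (0 : ℝ), ∀ k ∈ Finset.range (m + 1), δ < r k := by
    rw [Filter.eventually_all_finset]
    exact fun k hk => hsmall _ (h.radius_pos k (by simpa [Nat.lt_succ_iff] using hk))
  have h2 : ∀ᶠ δ in 𝓝[>] (0 : ℝ), ∀ k ∈ Finset.range m,
      δ < edgeLength c k - r k ∧ δ < edgeLength c k - r (k + 1) := by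
    rw [Filter.eventually_all_finset]
    intro k hk
    rw [Finset.mem_range] at hk
    have e := h.orthogonal k hk
    have p1 := h.radius_pos k hk.le
    have p2 := h.radius_pos (k + 1) hk
    have p3 := h.edgeLength_pos hk
    exact (hsmall _ (by nlinarith)).and (hsmall _ (by nlinarith))
  obtain ⟨δ, hδ1, hδ2, hδ⟩ := (h1.and (h2.and self_mem_nhdsWithin)).exists
  refine ⟨δ, hδ, fun k hk => hδ1 k (by simpa [Nat.lt_succ_iff] using hk), fun k hk => ?_,
    fun k hk => ?_⟩
  · linarith [(hδ2 k (by simpa using hk)).1]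
  · linarith [(hδ2 k (by simpa using hk)).2]

theorem norm_sq_smul_add_smul {u v : E3} (hu : ‖u‖ = 1) (hv : ‖v‖ = 1) (a b : ℝ) :
    ‖a • u + b • v‖ ^ 2 = a ^ 2 + 2 * (a * b * inner ℝ u v) + b ^ 2 := by
  rw [norm_add_sq_real, norm_smul, norm_smul, hu, hv, inner_smul_left, inner_smul_right, mul_one,
    mul_one, Real.norm_eq_abs, Real.norm_eq_abs, sq_abs, sq_abs]
  simp only [conj_trivial]
  ring

/-- If three consecutive spheres of a chain are such that neighbours are orthogonal and the outer balls
are disjoint, then the ray from the middle center away from one end cannot come back to the ball at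
the other end: otherwise its first point on the middle sphere would lie in both outer balls. -/
theorem neg_lt_mul_inner {u v : E3} (hu : ‖u‖ = 1) (hv : ‖v‖ = 1) {l l' ra ρ rb : ℝ} (hl : 0 < l)
    (hra : 0 < ra) (hρ : 0 < ρ) (hrb : 0 < rb) (h1 : l ^ 2 = ra ^ 2 + ρ ^ 2)
    (h2 : l' ^ 2 = ρ ^ 2 + rb ^ 2) (hd : ra + rb < ‖l • u + l' • v‖) :
    -ρ < l' * inner ℝ u v := by
  by_contra hcon
  have e1 : ‖ρ • u + l' • v‖ ≤ rb := by
    rw [← sq_le_sq₀ (norm_nonneg _) hrb.le, norm_sq_smul_add_smul hu hv]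
    nlinarith
  have e2 : ‖(l - ρ) • u‖ ≤ ra := by
    rw [norm_smul, hu, mul_one, Real.norm_eq_abs, abs_of_nonneg] <;> nlinarith
  have e3 := norm_add_le ((l - ρ) • u) (ρ • u + l' • v)
  rw [show (l - ρ) • u + (ρ • u + l' • v) = l • u + l' • v by module] at e3
  linarith

theorem lt_norm_smul_add_smul {u v : E3} (hu : ‖u‖ = 1) (hv : ‖v‖ = 1) {l l' ra ρ rb : ℝ} (hl : 0 < l)
    (hra : 0 < ra) (hρ : 0 < ρ) (hrb : 0 < rb) (h1 : l ^ 2 = ra ^ 2 + ρ ^ 2)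
    (h2 : l' ^ 2 = ρ ^ 2 + rb ^ 2) (hd : ra + rb < ‖l • u + l' • v‖) {σ : ℝ} (hσ : 0 ≤ σ) :
    rb < ‖σ • u + l' • v‖ := by
  have h3 := neg_lt_mul_inner hu hv hl hra hρ hrb h1 h2 hd
  rw [← sq_lt_sq₀ hrb.le (norm_nonneg _), norm_sq_smul_add_smul hu hv]
  rcases hσ.eq_or_lt with rfl | hσ
  · nlinarith
  · nlinarith [mul_lt_mul_of_pos_left h3 hσ, sq_nonneg (σ - ρ)]

namespace IsPearlChain

variable {m : ℕ} {c : ℕ → E3} {r : ℕ → ℝ} {δ : ℝ} {χ : ℕ → ℝ → ℝ}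

theorem succ_eq (h : IsPearlChain m c r) {k : ℕ} (hk : k < m) :
    c (k + 1) = c k + edgeLength c k • edgeDir c k := by
  rw [edgeLength_smul_edgeDir (h.edgeLength_pos hk)]
  abel

theorem two_step (h : IsPearlChain m c r) {k : ℕ} (hk : k + 1 < m) :
    r k + r (k + 2) <
      ‖edgeLength c k • edgeDir c k + edgeLength c (k + 1) • edgeDir c (k + 1)‖ := by
  have h1 := h.disjoint k (k + 2) (by omega) (by omega)
  rw [dist_comm, dist_eq_norm] at h1
  rwa [edgeLength_smul_edgeDir (h.edgeLength_pos (by omega)),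
    edgeLength_smul_edgeDir (h.edgeLength_pos hk), sub_add_sub_cancel']

/-- Going backwards from the vertex `k + 1` along the edge line, one stays outside the ball `k + 2`. -/
theorem forward (h : IsPearlChain m c r) {k : ℕ} (hk : k + 1 < m) {σ : ℝ} (hσ : 0 ≤ σ) :
    r (k + 2) < ‖σ • edgeDir c k + edgeLength c (k + 1) • edgeDir c (k + 1)‖ :=
  lt_norm_smul_add_smul (norm_edgeDir (h.edgeLength_pos (by omega)))
    (norm_edgeDir (h.edgeLength_pos hk)) (h.edgeLength_pos (by omega)) (h.radius_pos k (by omega))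
    (h.radius_pos (k + 1) (by omega)) (h.radius_pos (k + 2) (by omega)) (h.orthogonal k (by omega))
    (h.orthogonal (k + 1) hk) (h.two_step hk) hσ

/-- Going forwards from the vertex `k + 1` along the next edge line, one stays outside the ball `k`. -/
theorem backward (h : IsPearlChain m c r) {k : ℕ} (hk : k + 1 < m) {σ : ℝ} (hσ : 0 ≤ σ) :
    r k < ‖edgeLength c k • edgeDir c k + σ • edgeDir c (k + 1)‖ := by
  rw [add_comm]
  refine lt_norm_smul_add_smul (norm_edgeDir (h.edgeLength_pos hk))
    (norm_edgeDir (h.edgeLength_pos (by omega))) (h.edgeLength_pos hk)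
    (h.radius_pos (k + 2) (by omega)) (h.radius_pos (k + 1) (by omega)) (h.radius_pos k (by omega))
    ?_ ?_ ?_ hσ
  · rw [h.orthogonal (k + 1) hk, add_comm]
  · rw [h.orthogonal k (by omega), add_comm]
  · rw [add_comm (r (k + 2)), add_comm (_ • _)]
    exact h.two_step hk

/-- Every time is either close to that of an inner vertex or in the straight part of an edge. -/
theorem time_cases (h : IsPearlChain m c r) {t : ℝ} (ht : t ∈ Icc 0 (arcTime c m)) :
    (∃ n, n + 1 < m ∧ |t - arcTime c (n + 1)| < δ) ∨
    ∃ n < m, t ∈ Icc (arcTime c n) (arcTime c (n + 1)) ∧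
      (∀ j, 1 ≤ j → j ≤ n → arcTime c j + δ ≤ t) ∧
      (∀ j, n < j → j < m → t ≤ arcTime c j - δ) := by
  obtain ⟨n, hn, htn⟩ := exists_mem_edge (by linarith [h.one_lt]) ht
  by_cases h1 : 1 ≤ n ∧ t < arcTime c n + δ
  · left
    obtain ⟨k, rfl⟩ : ∃ k, n = k + 1 := ⟨n - 1, by omega⟩
    refine ⟨k, hn, ?_⟩
    rw [abs_of_nonneg] <;> linarith [htn.1]
  by_cases h2 : n + 1 < m ∧ arcTime c (n + 1) - δ < t
  · left
    refine ⟨n, h2.1, ?_⟩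
    rw [abs_of_nonpos] <;> linarith [htn.2]
  · right
    refine ⟨n, hn, htn, fun j hj hjn => ?_, fun j hj hjm => ?_⟩
    · have := monotone_arcTime c hjn
      by_contra h3
      exact h1 ⟨by omega, by linarith⟩
    · have := monotone_arcTime c (Nat.succ_le_of_lt hj)
      by_contra h3
      exact h2 ⟨by omega, by linarith⟩

/-- Near a vertex the rounded curve is a single corner, with its two full adjacent edges. -/
theorem curve_corner (h : IsPearlChain m c r) (hδ : IsRoundingWidth m c r δ)
    (hχ : ∀ k, IsCornerProfile δ (χ k)) {n : ℕ} (hn : n + 1 < m) {t : ℝ}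
    (ht : arcTime c n + δ ≤ t) (ht' : t ≤ arcTime c (n + 2) - δ) :
    roundedCurve c m χ t = c (n + 1) +
      corner (χ (n + 1)) (-edgeDir c n) (edgeDir c (n + 1)) (t - arcTime c (n + 1)) :=
  roundedCurve_eq_corner hχ hδ.pos.le hn (fun _ => h.edgeLength_pos)
    (fun j _ hj => by linarith [monotone_arcTime c hj])
    (fun j hj _ => by linarith [monotone_arcTime c (Nat.succ_le_of_lt hj)])

theorem mem_corner (hδ : IsRoundingWidth m c r δ) {n : ℕ}
    (hn : n + 1 < m) {t : ℝ} (ht : |t - arcTime c (n + 1)| ≤ r (n + 1)) :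
    arcTime c n + δ < t ∧ t < arcTime c (n + 2) - δ := by
  have h1 := abs_le.1 ht
  have h2 := hδ.right_lt n (by omega)
  have h3 := hδ.left_lt (n + 1) hn
  have h4 := arcTime_succ c n
  have h5 := arcTime_succ c (n + 1)
  constructor <;> linarith

theorem curve_near (h : IsPearlChain m c r) (hδ : IsRoundingWidth m c r δ)
    (hχ : ∀ k, IsCornerProfile δ (χ k)) {n : ℕ} (hn : n + 1 < m) {t : ℝ}
    (ht : |t - arcTime c (n + 1)| ≤ r (n + 1)) :
    roundedCurve c m χ t = c (n + 1) +
      corner (χ (n + 1)) (-edgeDir c n) (edgeDir c (n + 1)) (t - arcTime c (n + 1)) :=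
  h.curve_corner hδ hχ hn (mem_corner hδ hn ht).1.le (mem_corner hδ hn ht).2.le

theorem curve_first (h : IsPearlChain m c r) (hδ : IsRoundingWidth m c r δ)
    (hχ : ∀ k, IsCornerProfile δ (χ k)) {t : ℝ} (ht : t ≤ arcTime c 1 - δ) :
    roundedCurve c m χ t = c 0 + t • edgeDir c 0 := by
  rw [roundedCurve_eq_edge hχ hδ.pos.le (n := 0) (by linarith [h.one_lt])
    (fun _ => h.edgeLength_pos) (fun j _ _ => by omega)
    (fun j hj _ => by linarith [monotone_arcTime c (Nat.succ_le_of_lt hj)]), arcTime_zero, sub_zero]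

theorem curve_last (h : IsPearlChain m c r) (hδ : IsRoundingWidth m c r δ)
    (hχ : ∀ k, IsCornerProfile δ (χ k)) {t : ℝ} (ht : arcTime c (m - 1) + δ ≤ t) :
    roundedCurve c m χ t = c m - (arcTime c m - t) • edgeDir c (m - 1) := by
  have hm := h.one_lt
  have hm1 : m - 1 + 1 = m := by omega
  rw [roundedCurve_eq_edge hχ hδ.pos.le (n := m - 1) (by omega)
    (fun _ => h.edgeLength_pos) (fun j _ hj => by linarith [monotone_arcTime c hj])
    (fun j hj _ => by omega)]
  have h1 := h.succ_eq (k := m - 1) (by omega)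
  have h2 := arcTime_succ c (m - 1)
  rw [hm1] at h1 h2
  rw [h1, h2]
  module

theorem arcTime_add_le {j k : ℕ} (hjk : j ≤ k) : arcTime c j + edgeLength c k ≤ arcTime c (k + 1) := by
  rw [arcTime_succ]
  linarith [monotone_arcTime c hjk]

/-- The rounded arc is in the `k`-th ball exactly during the time interval of radius `r k` about the
time of the `k`-th vertex. -/
theorem curve_mem_iff (h : IsPearlChain m c r) (hδ : IsRoundingWidth m c r δ)
    (hχ : ∀ k, IsCornerProfile δ (χ k)) {t : ℝ} (ht : t ∈ Icc 0 (arcTime c m)) {k : ℕ} (hk : k ≤ m) :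
    ‖roundedCurve c m χ t - c k‖ ≤ r k ↔ |t - arcTime c k| ≤ r k := by
  have hrk := h.radius_pos k hk
  rcases h.time_cases (δ := δ) ht with ⟨n, hn, hnt⟩ | ⟨n, hn, htn, hj1, hj2⟩
  · have hu : ‖-edgeDir c n‖ = 1 := by rw [norm_neg, norm_edgeDir (h.edgeLength_pos (by omega))]
    have hv := norm_edgeDir (h.edgeLength_pos hn)
    have hnr := hδ.lt_radius (n + 1) hn.le
    have hp : ‖roundedCurve c m χ t - c (n + 1)‖ < δ := by
      rw [h.curve_near hδ hχ hn (hnt.le.trans hnr.le), add_sub_cancel_left]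
      exact (norm_corner_le (hχ _) hu hv _).trans_lt hnt
    have habs := abs_lt.1 hnt
    rcases eq_or_ne k (n + 1) with rfl | hne
    · exact iff_of_true (hp.le.trans hnr.le) (hnt.le.trans hnr.le)
    · have hfar : r k + δ < dist (c (n + 1)) (c k) ∧ ¬ |t - arcTime c k| ≤ r k := by
        rcases Nat.lt_or_gt_of_ne hne with hlt | hgt
        · have h3 : r k + δ < arcTime c (n + 1) - arcTime c k := by
            have h4 := hδ.left_lt k (by omega)
            have h5 := monotone_arcTime c (show k + 1 ≤ n + 1 by omega)
            rw [arcTime_succ] at h5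
            linarith
          refine ⟨?_, fun h6 => by linarith [(abs_le.1 h6).2]⟩
          rw [dist_comm]
          rcases (show k + 1 = n + 1 ∨ k + 1 < n + 1 by omega) with he | hl
          · obtain rfl : k = n := by omega
            exact hδ.left_lt k (by omega)
          · linarith [h.disjoint k (n + 1) hl hn.le]
        · obtain ⟨k, rfl⟩ : ∃ k', k = k' + 1 := ⟨k - 1, by omega⟩
          have h3 : r (k + 1) + δ < arcTime c (k + 1) - arcTime c (n + 1) := by
            have h4 := hδ.right_lt k (by omega)
            have h5 := arcTime_add_le (c := c) (show n + 1 ≤ k by omega)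
            linarith
          refine ⟨?_, fun h6 => by linarith [(abs_le.1 h6).1]⟩
          rcases (show k = n + 1 ∨ n + 1 + 1 < k + 1 by omega) with he | hl
          · subst he
            exact hδ.right_lt (n + 1) (by omega)
          · linarith [h.disjoint (n + 1) (k + 1) hl hk]
      refine iff_of_false (fun h6 => ?_) hfar.2
      have h7 := dist_triangle_left (c (n + 1)) (c k) (roundedCurve c m χ t)
      rw [← dist_eq_norm] at hp h6
      linarith [hfar.1]
  · have hln := h.edgeLength_pos hn
    have hu := norm_edgeDir hln
    have hT := arcTime_succ c n
    have hsucc := h.succ_eq hn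
    rw [roundedCurve_eq_edge hχ hδ.pos.le hn (fun _ => h.edgeLength_pos) hj1 hj2]
    obtain ⟨s, hs⟩ : ∃ s, s = t - arcTime c n := ⟨_, rfl⟩
    rw [← hs]
    have hs0 : 0 ≤ s := by linarith [htn.1]
    have hs1 : s ≤ edgeLength c n := by linarith [htn.2]
    have hn1 : ‖c n + s • edgeDir c n - c n‖ = s := by
      rw [add_sub_cancel_left, norm_smul, hu, mul_one, Real.norm_of_nonneg hs0]
    have hn2 : ‖c n + s • edgeDir c n - c (n + 1)‖ = edgeLength c n - s := by
      rw [hsucc, show c n + s • edgeDir c n - (c n + edgeLength c n • edgeDir c n) =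
        (-(edgeLength c n - s)) • edgeDir c n by module, norm_smul, hu, mul_one, norm_neg,
        Real.norm_of_nonneg (by linarith)]
    -- the edge is covered by the balls about its end-points
    have hcov : s ≤ r n ∨ edgeLength c n - s ≤ r (n + 1) := by
      by_contra hcon
      push Not at hcon
      nlinarith [h.orthogonal n hn, h.radius_pos n hn.le, h.radius_pos (n + 1) hn]
    have hfar : ∀ j, (j = n ∧ s ≤ r n) ∨ (j = n + 1 ∧ edgeLength c n - s ≤ r (n + 1)) →
        r j + r k < dist (c j) (c k) → ¬ ‖c n + s • edgeDir c n - c k‖ ≤ r k := by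
      intro j hj hd h6
      have h7 := dist_triangle_left (c j) (c k) (c n + s • edgeDir c n)
      rw [dist_eq_norm (c n + s • edgeDir c n), dist_eq_norm (c n + s • edgeDir c n)] at h7
      rcases hj with ⟨rfl, hj⟩ | ⟨rfl, hj⟩ <;> linarith
    rcases (show k = n ∨ k = n + 1 ∨ n + 2 ≤ k ∨ k + 1 ≤ n by omega) with rfl | rfl | hgt | hlt
    · rw [hn1, ← hs, abs_of_nonneg hs0]
    · rw [hn2, hT, abs_of_nonpos (by linarith)]
      constructor <;> intro <;> linarith
    · obtain ⟨k, rfl⟩ : ∃ k', k = k' + 2 := ⟨k - 2, by omega⟩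
      refine iff_of_false ?_ fun h6 => ?_
      · rcases (show k = n ∨ n + 1 ≤ k by omega) with rfl | hgt'
        · rw [not_le, norm_sub_rev, h.succ_eq (show k + 1 < m by omega), hsucc,
            show c k + edgeLength c k • edgeDir c k + edgeLength c (k + 1) • edgeDir c (k + 1) -
              (c k + s • edgeDir c k) = (edgeLength c k - s) • edgeDir c k +
                edgeLength c (k + 1) • edgeDir c (k + 1) by module]
          exact h.forward (by omega) (by linarith)
        · rcases hcov with h7 | h7
          · exact hfar n (Or.inl ⟨rfl, h7⟩) (h.disjoint n _ (by omega) hk)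
          · exact hfar (n + 1) (Or.inr ⟨rfl, h7⟩) (h.disjoint (n + 1) _ (by omega) hk)
      · have h7 := arcTime_add_le (c := c) (show n + 1 ≤ k + 1 by omega)
        linarith [(abs_le.1 h6).1, hδ.right_lt (k + 1) (by omega), htn.2, hδ.pos]
    · refine iff_of_false ?_ fun h6 => ?_
      · rcases (show n = k + 1 ∨ k + 2 ≤ n by omega) with rfl | hlt'
        · rw [not_le, h.succ_eq (show k < m by omega),
            show c k + edgeLength c k • edgeDir c k + s • edgeDir c (k + 1) - c k =
              edgeLength c k • edgeDir c k + s • edgeDir c (k + 1) by module]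
          exact h.backward (by omega) hs0
        · rcases hcov with h7 | h7
          · refine hfar n (Or.inl ⟨rfl, h7⟩) ?_
            rw [add_comm, dist_comm]
            exact h.disjoint k n (by omega) hn.le
          · refine hfar (n + 1) (Or.inr ⟨rfl, h7⟩) ?_
            rw [add_comm, dist_comm]
            exact h.disjoint k (n + 1) (by omega) hn
      · have h7 := arcTime_add_le (c := c) (le_refl k)
        have h8 := monotone_arcTime c hlt
        linarith [(abs_le.1 h6).2, hδ.left_lt k (by omega), htn.1, hδ.pos]

end IsPearlChain

theorem inner_corner {u v : E3} (hu : ‖u‖ = 1) (hv : ‖v‖ = 1) (χ : ℝ → ℝ) (s : ℝ) :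
    inner ℝ ((1 / 2 : ℝ) • (v - u)) (corner χ u v s) = s * ‖(1 / 2 : ℝ) • (v - u)‖ ^ 2 := by
  rw [corner, inner_add_right, inner_smul_right (r := s), inner_smul_right (r := χ s),
    inner_half_sub_half_add hu hv, real_inner_self_eq_norm_sq]
  ring

theorem corner_injective {u v : E3} (hu : ‖u‖ = 1) (hv : ‖v‖ = 1) (huv : u ≠ v) (χ : ℝ → ℝ) :
    Function.Injective (corner χ u v) := by
  intro s t hst
  have h := inner_corner hu hv χ s
  rw [hst, inner_corner hu hv] at h
  exact (mul_right_cancel₀ (pow_pos (norm_half_sub_pos huv) 2).ne' h).symm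

namespace IsPearlChain

variable {m : ℕ} {c : ℕ → E3} {r : ℕ → ℝ} {δ : ℝ} {χ : ℕ → ℝ → ℝ}

theorem dir_ne (h : IsPearlChain m c r) {n : ℕ} (hn : n + 1 < m) :
    -edgeDir c n ≠ edgeDir c (n + 1) := by
  intro he
  have h1 := h.forward hn (h.edgeLength_pos hn).le
  rw [← he, smul_neg, add_neg_cancel, norm_zero] at h1
  exact absurd (h.radius_pos (n + 2) (by omega)) (not_lt.2 h1.le)

theorem norm_neg_dir (h : IsPearlChain m c r) {n : ℕ} (hn : n < m) : ‖-edgeDir c n‖ = 1 := by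
  rw [norm_neg, norm_edgeDir (h.edgeLength_pos hn)]

/-- The arc is covered by the balls, since the radii of consecutive balls add up to more than the
length of the edge. -/
theorem exists_time_near (h : IsPearlChain m c r) {t : ℝ} (ht : t ∈ Icc 0 (arcTime c m)) :
    ∃ k ≤ m, |t - arcTime c k| ≤ r k := by
  obtain ⟨n, hn, htn⟩ := exists_mem_edge (by linarith [h.one_lt]) ht
  have hT := arcTime_succ c n
  by_contra hcon
  push Not at hcon
  have h1 := hcon n hn.le
  have h2 := hcon (n + 1) hn
  rw [abs_of_nonneg (by linarith [htn.1])] at h1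
  rw [abs_of_nonpos (by linarith [htn.2])] at h2
  nlinarith [h.orthogonal n hn, h.radius_pos n hn.le, h.radius_pos (n + 1) hn]

theorem radius_first_lt (hδ : IsRoundingWidth m c r δ) (hm : 0 < m) : r 0 + δ < arcTime c 1 := by
  have := hδ.left_lt 0 hm
  rwa [arcTime_succ, arcTime_zero, zero_add]

theorem radius_last_lt (hδ : IsRoundingWidth m c r δ) (hm : 0 < m) :
    arcTime c (m - 1) + δ < arcTime c m - r m := by
  have h1 := hδ.right_lt (m - 1) (by omega)
  have h2 := arcTime_succ c (m - 1)
  rw [Nat.sub_add_cancel hm] at h1 h2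
  linarith

/-- Two times with the same point belong to a common ball, in which the curve is a corner. -/
theorem injOn_curve (h : IsPearlChain m c r) (hδ : IsRoundingWidth m c r δ)
    (hχ : ∀ k, IsCornerProfile δ (χ k)) : InjOn (roundedCurve c m χ) (Icc 0 (arcTime c m)) := by
  have hm := h.one_lt
  intro t ht t' ht' htt
  obtain ⟨k, hk, hkt⟩ := h.exists_time_near ht
  have hkt' : |t' - arcTime c k| ≤ r k := by
    rwa [← h.curve_mem_iff hδ hχ ht' hk, ← htt, h.curve_mem_iff hδ hχ ht hk]
  rcases (show k = 0 ∨ k = m ∨ 1 ≤ k ∧ k < m by omega) with rfl | rfl | ⟨h1, h2⟩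
  · have h3 := radius_first_lt hδ (by omega : 0 < m)
    have h4 := (abs_le.1 hkt).2
    have h5 := (abs_le.1 hkt').2
    rw [arcTime_zero] at h4 h5
    rw [h.curve_first hδ hχ (by linarith), h.curve_first hδ hχ (by linarith)] at htt
    have h6 : edgeDir c 0 ≠ 0 := norm_pos_iff.1 (by
      rw [norm_edgeDir (h.edgeLength_pos (by omega))]; exact one_pos)
    exact smul_left_injective ℝ h6 (add_left_cancel htt)
  · have h3 := radius_last_lt hδ (by omega : 0 < k)
    have h4 := (abs_le.1 hkt).1
    have h5 := (abs_le.1 hkt').1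
    rw [h.curve_last hδ hχ (by linarith), h.curve_last hδ hχ (by linarith)] at htt
    have h6 : edgeDir c (k - 1) ≠ 0 := norm_pos_iff.1 (by
      rw [norm_edgeDir (h.edgeLength_pos (by omega))]; exact one_pos)
    have h7 := smul_left_injective ℝ h6 (sub_right_injective htt)
    linarith
  · obtain ⟨n, rfl⟩ : ∃ n, k = n + 1 := ⟨k - 1, by omega⟩
    rw [h.curve_near hδ hχ h2 hkt, h.curve_near hδ hχ h2 hkt'] at htt
    have h6 := corner_injective (h.norm_neg_dir (by omega)) (norm_edgeDir (h.edgeLength_pos h2))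
      (h.dir_ne h2) _ (add_left_cancel htt)
    linarith

theorem norm_corner_le_iff (hδ : IsRoundingWidth m c r δ) {f : ℝ → ℝ}
    (hf : IsCornerProfile δ f) {k : ℕ} (hk : k ≤ m) {u v : E3} (hu : ‖u‖ = 1) (hv : ‖v‖ = 1) (s : ℝ) :
    ‖corner f u v s‖ ≤ r k ↔ |s| ≤ r k := by
  refine ⟨fun h1 => ?_, (norm_corner_le hf hu hv s).trans⟩
  rcases le_or_gt δ |s| with h2 | h2
  · rwa [norm_corner_eq hf hu hv h2] at h1
  · exact h2.le.trans (hδ.lt_radius k hk).le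

theorem mem_roundedArc_iff (h : IsPearlChain m c r) (hδ : IsRoundingWidth m c r δ)
    (hχ : ∀ k, IsCornerProfile δ (χ k)) {n : ℕ} (hn : n + 1 < m) {x : E3}
    (hx : ‖x - c (n + 1)‖ ≤ r (n + 1)) : x ∈ roundedArc c m χ ↔
      x - c (n + 1) ∈ range (corner (χ (n + 1)) (-edgeDir c n) (edgeDir c (n + 1))) := by
  have hu := h.norm_neg_dir (show n < m by omega)
  have hv := norm_edgeDir (h.edgeLength_pos hn)
  constructor
  · rintro ⟨t, ht, rfl⟩
    rw [h.curve_mem_iff hδ hχ ht hn.le] at hx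
    rw [h.curve_near hδ hχ hn hx, add_sub_cancel_left]
    exact mem_range_self _
  · rintro ⟨s, hs⟩
    rw [← hs, norm_corner_le_iff hδ (hχ _) hn.le hu hv] at hx
    have hx' : |arcTime c (n + 1) + s - arcTime c (n + 1)| ≤ r (n + 1) := by
      rwa [add_sub_cancel_left]
    have h1 := mem_corner hδ hn hx'
    refine ⟨arcTime c (n + 1) + s, ⟨?_, ?_⟩, ?_⟩
    · have := monotone_arcTime c (Nat.zero_le n)
      rw [arcTime_zero] at this
      linarith [hδ.pos]
    · have := monotone_arcTime c (show n + 2 ≤ m by omega)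
      linarith [hδ.pos]
    · rw [h.curve_near hδ hχ hn hx', add_sub_cancel_left, hs]
      abel

theorem exists_isStraightenedBy (h : IsPearlChain m c r) (hδ : IsRoundingWidth m c r δ)
    (hχ : ∀ k, IsCornerProfile δ (χ k)) {k : ℕ} (hk : 1 ≤ k) (hkm : k < m) :
    ∃ G, IsStraightenedBy G (roundedArc c m χ) (c k) (r k) := by
  obtain ⟨n, rfl⟩ : ∃ n, k = n + 1 := ⟨k - 1, by omega⟩
  obtain ⟨G, hG1, hG2⟩ := exists_straightening hδ.pos (hχ (n + 1)) (h.norm_neg_dir (by omega))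
    (norm_edgeDir (h.edgeLength_pos hkm)) (h.dir_ne hkm)
  exact ⟨G, hG1, fun x hx => (h.mem_roundedArc_iff hδ hχ hkm hx).trans (hG2 _)⟩

theorem edgeLength_first (h : IsPearlChain m c r) : edgeLength c 0 = c 1 2 := by
  have h1 := h.height_pos 1 le_rfl h.one_lt
  rw [edgeLength, dist_comm, dist_eq_norm, ← pow_left_inj₀ (norm_nonneg _) h1.le two_ne_zero,
    E3.norm_sq, h.first_eq]
  simp

theorem edgeLength_last (h : IsPearlChain m c r) : edgeLength c (m - 1) = c (m - 1) 2 := by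
  have hm := h.one_lt
  have h1 := h.height_pos (m - 1) (by omega) (by omega)
  rw [edgeLength, dist_eq_norm, ← pow_left_inj₀ (norm_nonneg _) h1.le two_ne_zero, E3.norm_sq,
    Nat.sub_add_cancel (by omega), h.last_eq]
  simp

theorem edgeDir_first (h : IsPearlChain m c r) : edgeDir c 0 = !₂[0, 0, 1] := by
  have h1 := h.height_pos 1 le_rfl h.one_lt
  rw [edgeDir, h.edgeLength_first, h.first_eq]
  ext i
  fin_cases i <;> simp [h1.ne']

theorem edgeDir_last (h : IsPearlChain m c r) : edgeDir c (m - 1) = !₂[0, 0, -1] := by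
  have hm := h.one_lt
  have h1 := h.height_pos (m - 1) (by omega) (by omega)
  rw [edgeDir, h.edgeLength_last, Nat.sub_add_cancel (by omega), h.last_eq]
  ext i
  fin_cases i <;> simp [h1.ne']

theorem arcTime_pos (h : IsPearlChain m c r) : 0 < arcTime c m := by
  have h1 := monotone_arcTime c (show 1 ≤ m by linarith [h.one_lt])
  have h2 := h.edgeLength_pos (k := 0) (by linarith [h.one_lt])
  rw [arcTime_succ, arcTime_zero] at h1
  linarith

/-- A chain ball about an inner vertex lies in the open half-space. -/
theorem pos_of_mem_ball (h : IsPearlChain m c r) {k : ℕ} (hk : 1 ≤ k) (hkm : k < m) {x : E3}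
    (hx : ‖x - c k‖ ≤ r k) : 0 < x 2 := by
  have h1 := h.height_pos k hk hkm
  have h2 := h.radius_sq k hk hkm
  have h3 := h.radius_pos k hkm.le
  have h4 : ‖x - c k‖ ^ 2 ≤ r k ^ 2 := pow_le_pow_left₀ (norm_nonneg _) hx 2
  rw [E3.norm_sq] at h4
  simp only [PiLp.sub_apply] at h4
  nlinarith [sq_nonneg (x 0 - c k 0), sq_nonneg (x 1 - c k 1), sq_nonneg (x 2)]

theorem curve_first_apply (h : IsPearlChain m c r) (hδ : IsRoundingWidth m c r δ)
    (hχ : ∀ k, IsCornerProfile δ (χ k)) {t : ℝ} (ht : t ≤ arcTime c 1 - δ) :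
    roundedCurve c m χ t = !₂[c 0 0, c 0 1, t] := by
  rw [h.curve_first hδ hχ ht, h.edgeDir_first]
  ext i
  fin_cases i <;> simp [h.first_eq]

theorem curve_last_apply (h : IsPearlChain m c r) (hδ : IsRoundingWidth m c r δ)
    (hχ : ∀ k, IsCornerProfile δ (χ k)) {t : ℝ} (ht : arcTime c (m - 1) + δ ≤ t) :
    roundedCurve c m χ t = !₂[c m 0, c m 1, arcTime c m - t] := by
  rw [h.curve_last hδ hχ ht, h.edgeDir_last]
  ext i
  fin_cases i <;> simp [h.last_eq]

theorem curve_pos (h : IsPearlChain m c r) (hδ : IsRoundingWidth m c r δ)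
    (hχ : ∀ k, IsCornerProfile δ (χ k)) {t : ℝ} (ht : t ∈ Ioo 0 (arcTime c m)) :
    0 < roundedCurve c m χ t 2 := by
  have hm := h.one_lt
  obtain ⟨k, hk, hkt⟩ := h.exists_time_near (Ioo_subset_Icc_self ht)
  rcases (show k = 0 ∨ k = m ∨ 1 ≤ k ∧ k < m by omega) with rfl | rfl | ⟨h1, h2⟩
  · have h3 := radius_first_lt hδ (by omega : 0 < m)
    have h4 := (abs_le.1 hkt).2
    rw [arcTime_zero] at h4
    rw [h.curve_first_apply hδ hχ (by linarith)]
    exact ht.1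
  · have h3 := radius_last_lt hδ (by omega : 0 < k)
    have h4 := (abs_le.1 hkt).1
    rw [h.curve_last_apply hδ hχ (by linarith)]
    exact sub_pos.2 ht.2
  · exact h.pos_of_mem_ball h1 h2
      ((h.curve_mem_iff hδ hχ (Ioo_subset_Icc_self ht) hk).2 hkt)

theorem curve_zero (h : IsPearlChain m c r) (hδ : IsRoundingWidth m c r δ)
    (hχ : ∀ k, IsCornerProfile δ (χ k)) : roundedCurve c m χ 0 = c 0 := by
  have h0 := h.radius_pos 0 (Nat.zero_le m)
  rw [h.curve_first hδ hχ
    (by linarith [radius_first_lt hδ (show 0 < m by linarith [h.one_lt]), hδ.pos]), zero_smul, add_zero]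

theorem curve_end (h : IsPearlChain m c r) (hδ : IsRoundingWidth m c r δ)
    (hχ : ∀ k, IsCornerProfile δ (χ k)) : roundedCurve c m χ (arcTime c m) = c m := by
  have h0 := h.radius_pos m le_rfl
  rw [h.curve_last hδ hχ
    (by linarith [radius_last_lt hδ (show 0 < m by linarith [h.one_lt]), hδ.pos]), sub_self, zero_smul,
    sub_zero]

theorem height_first (h : IsPearlChain m c r) : c 0 2 = 0 := by
  rw [h.first_eq]
  rfl

theorem height_last (h : IsPearlChain m c r) : c m 2 = 0 := by
  rw [h.last_eq]
  rfl

theorem nonneg_of_mem (h : IsPearlChain m c r) (hδ : IsRoundingWidth m c r δ)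
    (hχ : ∀ k, IsCornerProfile δ (χ k)) {x : E3} (hx : x ∈ roundedArc c m χ) : 0 ≤ x 2 := by
  obtain ⟨t, ht, rfl⟩ := hx
  rcases ht.1.eq_or_lt with rfl | h0
  · rw [h.curve_zero hδ hχ, h.height_first]
  rcases ht.2.eq_or_lt with rfl | h1
  · rw [h.curve_end hδ hχ, h.height_last]
  exact (h.curve_pos hδ hχ ⟨h0, h1⟩).le

/-- The arc has its end-points, and no other points, on the boundary plane. -/
theorem parametrizesArc (h : IsPearlChain m c r) (hδ : IsRoundingWidth m c r δ)
    (hχ : ∀ k, IsCornerProfile δ (χ k)) :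
    ParametrizesArc (fun τ => roundedCurve c m χ (arcTime c m * τ)) (roundedArc c m χ) (c 0) (c m) where
  continuousOn := by
    have := continuous_roundedCurve (c := c) (m := m) fun k => (hχ k).continuous
    exact Continuous.continuousOn (by fun_prop)
  injOn := by
    have hL := h.arcTime_pos
    intro a ha b hb hab
    exact mul_left_cancel₀ hL.ne' (h.injOn_curve hδ hχ
      ⟨mul_nonneg hL.le ha.1, mul_le_of_le_one_right hL.le ha.2⟩
      ⟨mul_nonneg hL.le hb.1, mul_le_of_le_one_right hL.le hb.2⟩ hab)
  image_eq := by
    have hL := h.arcTime_pos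
    rw [roundedArc, ← image_image (roundedCurve c m χ) (fun τ => arcTime c m * τ),
      image_mul_left_Icc hL.le zero_le_one, mul_zero, mul_one]
  start_eq := by
    rw [mul_zero, h.curve_zero hδ hχ]
  end_eq := by
    rw [mul_one, h.curve_end hδ hχ]
  start_mem := h.height_first
  end_mem := h.height_last
  interior_pos t ht := h.curve_pos hδ hχ
    ⟨mul_pos h.arcTime_pos ht.1, mul_lt_of_lt_one_right h.arcTime_pos ht.2⟩

/-- In the first ball the arc is the vertical radius of a half-ball. -/
theorem isTrivialBallPair_first (h : IsPearlChain m c r) (hδ : IsRoundingWidth m c r δ)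
    (hχ : ∀ k, IsCornerProfile δ (χ k)) :
    IsTrivialBallPair 1 {x : E3 | 0 ≤ x 2 ∧ ‖x - c 0‖ ≤ r 0} (roundedArc c m χ) := by
  have hm := h.one_lt
  have h3 := radius_first_lt hδ (by omega : 0 < m)
  refine isTrivialBallPair_halfBall h.height_first (h.radius_pos 0 (by omega)) fun x hx0 hx => ?_
  constructor
  · rintro ⟨t, ht, rfl⟩
    rw [h.curve_mem_iff hδ hχ ht (by omega)] at hx
    have h4 := (abs_le.1 hx).2
    rw [arcTime_zero] at h4
    rw [h.curve_first_apply hδ hχ (by linarith)]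
    exact ⟨rfl, rfl⟩
  · rintro ⟨h1, h2⟩
    have h4 : x 2 ≤ r 0 := by
      refine le_trans (le_of_eq ?_) hx
      rw [← pow_left_inj₀ hx0 (norm_nonneg _) two_ne_zero, E3.norm_sq]
      simp [h1, h2, h.height_first]
    have h5 := monotone_arcTime c (show 1 ≤ m by omega)
    refine ⟨x 2, ⟨hx0, by linarith [hδ.pos]⟩, ?_⟩
    rw [h.curve_first_apply hδ hχ (by linarith)]
    ext i
    fin_cases i
    exacts [h1.symm, h2.symm, rfl]

/-- In the last ball the arc is the vertical radius of a half-ball. -/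
theorem isTrivialBallPair_last (h : IsPearlChain m c r) (hδ : IsRoundingWidth m c r δ)
    (hχ : ∀ k, IsCornerProfile δ (χ k)) :
    IsTrivialBallPair 1 {x : E3 | 0 ≤ x 2 ∧ ‖x - c m‖ ≤ r m} (roundedArc c m χ) := by
  have hm := h.one_lt
  have h3 := radius_last_lt hδ (by omega : 0 < m)
  refine isTrivialBallPair_halfBall h.height_last (h.radius_pos m le_rfl) fun x hx0 hx => ?_
  constructor
  · rintro ⟨t, ht, rfl⟩
    rw [h.curve_mem_iff hδ hχ ht le_rfl] at hx
    have h4 := (abs_le.1 hx).1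
    rw [h.curve_last_apply hδ hχ (by linarith)]
    exact ⟨rfl, rfl⟩
  · rintro ⟨h1, h2⟩
    have h4 : x 2 ≤ r m := by
      refine le_trans (le_of_eq ?_) hx
      rw [← pow_left_inj₀ hx0 (norm_nonneg _) two_ne_zero, E3.norm_sq]
      simp [h1, h2, h.height_last]
    have h5 := monotone_arcTime c (show 0 ≤ m - 1 by omega)
    rw [arcTime_zero] at h5
    refine ⟨arcTime c m - x 2, ⟨by linarith [hδ.pos], by linarith⟩, ?_⟩
    rw [h.curve_last_apply hδ hχ (by linarith), sub_sub_cancel]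
    ext i
    fin_cases i
    exacts [h1.symm, h2.symm, rfl]

end IsPearlChain

/-! ### The smooth arc -/

/-- A smooth corner profile, which interpolates between `-s` for `s ≤ -δ` and `s` for `δ ≤ s`. -/
noncomputable def smoothProfile (δ s : ℝ) : ℝ :=
  s * (2 * Real.smoothTransition (s / (2 * δ) + 1 / 2) - 1)

theorem contDiff_smoothProfile (δ : ℝ) : ContDiff ℝ ∞ (smoothProfile δ) := by
  unfold smoothProfile
  have h : ContDiff ℝ ∞ fun s : ℝ => Real.smoothTransition (s / (2 * δ) + 1 / 2) :=
    Real.smoothTransition.contDiff.comp (by fun_prop)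
  fun_prop

theorem smoothTransition_one_sub (x : ℝ) :
    Real.smoothTransition (1 - x) = 1 - Real.smoothTransition x := by
  have h := (Real.smoothTransition.pos_denom x).ne'
  rw [Real.smoothTransition, Real.smoothTransition, sub_sub_cancel, add_comm (expNegInvGlue (1 - x)),
    eq_sub_iff_add_eq, ← add_div, add_comm (expNegInvGlue (1 - x)), div_self h]

theorem isCornerProfile_smoothProfile {δ : ℝ} (hδ : 0 < δ) : IsCornerProfile δ (smoothProfile δ) := by
  have heven : ∀ s, smoothProfile δ (-s) = smoothProfile δ s := by
    intro s
    rw [smoothProfile, show -s / (2 * δ) + 1 / 2 = 1 - (s / (2 * δ) + 1 / 2) by ring,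
      smoothTransition_one_sub, smoothProfile]
    ring
  have habs : ∀ s, smoothProfile δ |s| = smoothProfile δ s := by
    intro s
    rcases abs_choice s with hs | hs
    · rw [hs]
    · rw [hs, heven]
  have hfac : ∀ s, 0 ≤ s → 0 ≤ 2 * Real.smoothTransition (s / (2 * δ) + 1 / 2) - 1 := by
    intro s hs
    have h1 := Real.smoothTransition.monotone (show 1 / 2 ≤ s / (2 * δ) + 1 / 2 by
      have : 0 ≤ s / (2 * δ) := by positivity
      linarith)
    have h2 := smoothTransition_one_sub (1 / 2)
    norm_num at h1 h2
    linarith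
  have hle : ∀ s, 0 ≤ s → smoothProfile δ s ≤ s := by
    intro s hs
    have := Real.smoothTransition.le_one (s / (2 * δ) + 1 / 2)
    exact mul_le_of_le_one_right hs (by linarith)
  refine ⟨(contDiff_smoothProfile δ).continuous, heven, fun s => ?_, fun s => ?_, ?_, fun s hs => ?_⟩
  · rw [← habs]
    exact mul_nonneg (abs_nonneg s) (hfac _ (abs_nonneg s))
  · rw [← habs]
    exact hle _ (abs_nonneg s)
  · intro s hs t ht hst
    refine mul_le_mul hst ?_ (hfac s hs) ht
    have := Real.smoothTransition.monotone (show s / (2 * δ) + 1 / 2 ≤ t / (2 * δ) + 1 / 2 by gcongr)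
    linarith
  · rw [← habs, smoothProfile, Real.smoothTransition.one_of_one_le]
    · ring
    · have : 1 / 2 ≤ |s| / (2 * δ) := by
        rw [le_div_iff₀ (by positivity)]
        linarith
      linarith

theorem contDiff_roundedCurve {c : ℕ → E3} {m : ℕ} {χ : ℕ → ℝ → ℝ} (hχ : ∀ k, ContDiff ℝ ∞ (χ k)) :
    ContDiff ℝ ∞ (roundedCurve c m χ) := by
  unfold roundedCurve
  refine ContDiff.add (by fun_prop) (ContDiff.sum fun j _ => ?_)
  have h : ContDiff ℝ ∞ fun t => χ (j + 1) (t - arcTime c (j + 1)) := (hχ (j + 1)).comp (by fun_prop)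
  fun_prop

namespace IsPearlChain

variable {m : ℕ} {c : ℕ → E3} {r : ℕ → ℝ} {δ : ℝ} {χ : ℕ → ℝ → ℝ}

/-- Near each time, some linear coordinate of the curve moves at a constant non-zero speed. -/
theorem exists_moving_coordinate (h : IsPearlChain m c r) (hδ : IsRoundingWidth m c r δ)
    (hχ : ∀ k, IsCornerProfile δ (χ k)) {t : ℝ} (ht : t ∈ Icc 0 (arcTime c m)) :
    ∃ (e : E3) (a b : ℝ), b ≠ 0 ∧ ∀ᶠ t' in 𝓝 t, inner ℝ e (roundedCurve c m χ t') = t' * b + a := by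
  have hm := h.one_lt
  obtain ⟨k, hk, hkt⟩ := h.exists_time_near ht
  rcases (show k = 0 ∨ k = m ∨ 1 ≤ k ∧ k < m by omega) with rfl | rfl | ⟨h1, h2⟩
  · have h3 := radius_first_lt hδ (by omega : 0 < m)
    have h4 := (abs_le.1 hkt).2
    rw [arcTime_zero] at h4
    refine ⟨edgeDir c 0, inner ℝ (edgeDir c 0) (c 0), 1, one_ne_zero, ?_⟩
    filter_upwards [eventually_lt_nhds (show t < arcTime c 1 - δ by linarith)] with t' ht'
    rw [h.curve_first hδ hχ ht'.le, inner_add_right, inner_smul_right, real_inner_self_eq_norm_sq,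
      norm_edgeDir (h.edgeLength_pos (by omega))]
    ring
  · have h3 := radius_last_lt hδ (by omega : 0 < k)
    have h4 := (abs_le.1 hkt).1
    refine ⟨edgeDir c (k - 1), inner ℝ (edgeDir c (k - 1)) (c k) - arcTime c k, 1, one_ne_zero, ?_⟩
    filter_upwards [eventually_gt_nhds (show arcTime c (k - 1) + δ < t by linarith)] with t' ht'
    rw [h.curve_last hδ hχ ht'.le, inner_sub_right, inner_smul_right, real_inner_self_eq_norm_sq,
      norm_edgeDir (h.edgeLength_pos (by omega))]
    ring
  · obtain ⟨n, rfl⟩ : ∃ n, k = n + 1 := ⟨k - 1, by omega⟩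
    have h3 := mem_corner hδ h2 hkt
    set e := (1 / 2 : ℝ) • (edgeDir c (n + 1) - -edgeDir c n) with he
    refine ⟨e, inner ℝ e (c (n + 1)) - arcTime c (n + 1) * ‖e‖ ^ 2, ‖e‖ ^ 2,
      (pow_pos (norm_half_sub_pos (h.dir_ne h2)) 2).ne', ?_⟩
    filter_upwards [eventually_gt_nhds h3.1, eventually_lt_nhds h3.2] with t' ht1 ht2
    rw [h.curve_corner hδ hχ h2 ht1.le ht2.le, inner_add_right, he,
      inner_corner (h.norm_neg_dir (by omega)) (norm_edgeDir (h.edgeLength_pos h2))]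
    ring

/-- Near its end-points the arc is a vertical segment, so that it agrees with the normal line there. -/
theorem isSpinnableArc (h : IsPearlChain m c r) (hδ : IsRoundingWidth m c r δ)
    (hχ : ∀ k, IsCornerProfile δ (χ k)) (hχs : ∀ k, ContDiff ℝ ∞ (χ k)) :
    IsSpinnableArc (roundedArc c m χ) (c 0) (c m) := by
  have hm := h.one_lt
  have hL := h.arcTime_pos
  have hsmooth := contDiff_roundedCurve (c := c) (m := m) hχs
  have hcont : Continuous fun τ : ℝ => arcTime c m * τ := by fun_prop
  have hγ : ContDiff ℝ ∞ fun τ => roundedCurve c m χ (arcTime c m * τ) := hsmooth.comp (by fun_prop)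
  refine ⟨_, h.parametrizesArc hδ hχ, hγ.contDiffOn, fun τ hτ => ?_, fun n => ?_, fun n => ?_⟩
  · have hdiff : DifferentiableAt ℝ (fun τ => roundedCurve c m χ (arcTime c m * τ)) τ :=
      (hγ.differentiable (by simp)).differentiableAt
    rw [hdiff.derivWithin (uniqueDiffOn_Icc zero_lt_one τ hτ)]
    intro h0
    have ht : arcTime c m * τ ∈ Icc 0 (arcTime c m) :=
      ⟨mul_nonneg hL.le hτ.1, mul_le_of_le_one_right hL.le hτ.2⟩
    obtain ⟨e, a, b, hb, hev⟩ := h.exists_moving_coordinate hδ hχ ht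
    have h1 := ((hasDerivAt_const τ e).inner ℝ hdiff.hasDerivAt)
    rw [h0, inner_zero_right, inner_zero_left, add_zero] at h1
    have h2 : HasDerivAt (fun τ => arcTime c m * τ * b + a) (arcTime c m * 1 * b) τ :=
      (((hasDerivAt_id τ).const_mul (arcTime c m)).mul_const b).add_const a
    have h3 := (hcont.tendsto τ).eventually hev
    have h4 := (h2.congr_of_eventuallyEq h3).unique h1
    rw [mul_one] at h4
    exact mul_ne_zero hL.ne' hb h4
  · have h3 := radius_first_lt hδ (by omega : 0 < m)
    have h0 := h.radius_pos 0 (by omega)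
    have hev : ∀ᶠ τ in 𝓝[Icc 0 1] (0 : ℝ), arcTime c m * τ < arcTime c 1 - δ :=
      ((hcont.tendsto 0).eventually (eventually_lt_nhds (by linarith))).filter_mono
        nhdsWithin_le_nhds
    constructor <;>
    · refine (isLittleO_zero _ _).congr' ?_ (EventuallyEq.refl _ _)
      filter_upwards [hev] with τ hτ
      rw [mul_zero, h.curve_zero hδ hχ, h.curve_first_apply hδ hχ hτ.le]
      simp
  · have h3 := radius_last_lt hδ (by omega : 0 < m)
    have h0 := h.radius_pos m le_rfl
    have hev : ∀ᶠ τ in 𝓝[Icc 0 1] (1 : ℝ), arcTime c (m - 1) + δ < arcTime c m * τ :=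
      ((hcont.tendsto 1).eventually (eventually_gt_nhds (by linarith))).filter_mono
        nhdsWithin_le_nhds
    constructor <;>
    · refine (isLittleO_zero _ _).congr' ?_ (EventuallyEq.refl _ _)
      filter_upwards [hev] with τ hτ
      rw [mul_one, h.curve_end hδ hχ, h.curve_last_apply hδ hχ hτ.le]
      simp

/-- Changing the rounding of one corner affects the curve only near that corner. -/
theorem roundedCurve_congr {χ' : ℕ → ℝ → ℝ} {k : ℕ} (hχ : ∀ j, IsCornerProfile δ (χ j))
    (hχ' : ∀ j, IsCornerProfile δ (χ' j)) (heq : ∀ j, j ≠ k → χ j = χ' j) {t : ℝ}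
    (ht : δ ≤ |t - arcTime c k|) : roundedCurve c m χ t = roundedCurve c m χ' t := by
  rw [roundedCurve, roundedCurve]
  congr 1
  refine Finset.sum_congr rfl fun j _ => ?_
  rcases eq_or_ne (j + 1) k with rfl | hne
  · rw [(hχ _).eq_abs _ ht, (hχ' _).eq_abs _ ht]
  · rw [heq _ hne]

theorem segment_height (h : IsPearlChain m c r) {x : E3} (hx : x ∈ segment ℝ (c 0) (c m)) :
    x 2 = 0 := by
  obtain ⟨a, b, -, -, -, rfl⟩ := hx
  simp [h.height_first, h.height_last]

/-- Changing the profile at a single corner does not change the knot type. -/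
theorem ambientEquiv_change_corner (h : IsPearlChain m c r) (hδ : IsRoundingWidth m c r δ)
    {χ' : ℕ → ℝ → ℝ} {n : ℕ} (hn : n + 1 < m) (hχ : ∀ j, IsCornerProfile δ (χ j))
    (hχ' : ∀ j, IsCornerProfile δ (χ' j)) (heq : ∀ j, j ≠ n + 1 → χ j = χ' j) :
    AmbientEquiv (roundedArc c m χ ∪ segment ℝ (c 0) (c m))
      (roundedArc c m χ' ∪ segment ℝ (c 0) (c m)) := by
  have hu := h.norm_neg_dir (show n < m by omega)
  have hv := norm_edgeDir (h.edgeLength_pos hn)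
  have hr := hδ.lt_radius (n + 1) hn.le
  obtain ⟨G, hG1, hG2, hG3⟩ := exists_rounding hδ.pos (hχ (n + 1)) (hχ' (n + 1)) hu hv (h.dir_ne hn)
  set H : E3 ≃ₜ E3 := (Homeomorph.subRight (c (n + 1))).trans
    (G.trans (Homeomorph.addRight (c (n + 1)))) with hH
  have hHx : ∀ x, H x = G (x - c (n + 1)) + c (n + 1) := fun x => rfl
  have hfar : ∀ (χ χ' : ℕ → ℝ → ℝ), (∀ j, IsCornerProfile δ (χ j)) → (∀ j, IsCornerProfile δ (χ' j)) →
      (∀ j, j ≠ n + 1 → χ j = χ' j) → ∀ x, δ ≤ ‖x - c (n + 1)‖ → x ∈ roundedArc c m χ →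
      x ∈ roundedArc c m χ' := by
    rintro χ χ' hχ hχ' heq x hx ⟨t, ht, rfl⟩
    refine ⟨t, ht, (roundedCurve_congr hχ hχ' heq ?_).symm⟩
    by_contra hcon
    rw [not_le] at hcon
    rw [h.curve_near hδ hχ hn (hcon.le.trans hr.le), add_sub_cancel_left] at hx
    exact absurd (hx.trans (norm_corner_le (hχ _) hu hv _)) (not_le.2 hcon)
  have key : ∀ x, H x ∈ roundedArc c m χ' ∪ segment ℝ (c 0) (c m) ↔
      x ∈ roundedArc c m χ ∪ segment ℝ (c 0) (c m) := by
    intro x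
    rcases le_or_gt δ ‖x - c (n + 1)‖ with hx | hx
    · have h1 : H x = x := by rw [hHx, hG2 _ hx, sub_add_cancel]
      rw [h1, mem_union, mem_union]
      exact or_congr_left ⟨hfar χ' χ hχ' hχ (fun j hj => (heq j hj).symm) x hx,
        hfar χ χ' hχ hχ' heq x hx⟩
    · have hx1 : ‖x - c (n + 1)‖ ≤ r (n + 1) := hx.le.trans hr.le
      have hx2 : ‖H x - c (n + 1)‖ ≤ r (n + 1) := by
        rw [hHx, add_sub_cancel_right, hG1]
        exact hx1
      have h1 : x ∉ segment ℝ (c 0) (c m) := fun h2 =>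
        (h.pos_of_mem_ball (by omega) hn hx1).ne' (h.segment_height h2)
      have h2 : H x ∉ segment ℝ (c 0) (c m) := fun h2 =>
        (h.pos_of_mem_ball (by omega) hn hx2).ne' (h.segment_height h2)
      rw [mem_union, mem_union, or_iff_left h1, or_iff_left h2, h.mem_roundedArc_iff hδ hχ hn hx1,
        h.mem_roundedArc_iff hδ hχ' hn hx2, hHx, add_sub_cancel_right, hG3]
  refine ⟨H, ?_⟩
  ext y
  obtain ⟨x, rfl⟩ := H.surjective y
  rw [H.injective.mem_set_image, key]

/-- Rounding the corners one after the other, one sees that the knot type of the closed-up arc does not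
depend on the profiles. -/
theorem ambientEquiv_roundedArc (h : IsPearlChain m c r) (hδ : IsRoundingWidth m c r δ)
    {f g : ℝ → ℝ} (hf : IsCornerProfile δ f) (hg : IsCornerProfile δ g) :
    AmbientEquiv (roundedArc c m (fun _ => f) ∪ segment ℝ (c 0) (c m))
      (roundedArc c m (fun _ => g) ∪ segment ℝ (c 0) (c m)) := by
  have hprof : ∀ n j : ℕ, IsCornerProfile δ (if j ≤ n then g else f) := by
    intro n j
    split_ifs <;> assumption
  have hstep : ∀ n, n < m → AmbientEquiv (roundedArc c m (fun _ => f) ∪ segment ℝ (c 0) (c m))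
      (roundedArc c m (fun j => if j ≤ n then g else f) ∪ segment ℝ (c 0) (c m)) := by
    intro n
    induction n with
    | zero =>
      intro _
      have : roundedCurve c m (fun _ => f) = roundedCurve c m (fun j => if j ≤ 0 then g else f) := by
        funext t
        simp [roundedCurve]
      rw [roundedArc, roundedArc, this]
      exact AmbientEquiv.refl _
    | succ n ih =>
      intro hn
      refine (ih (by omega)).trans (h.ambientEquiv_change_corner hδ hn (hprof n) (hprof (n + 1)) ?_)
      intro j hj
      by_cases h1 : j ≤ n
      · rw [if_pos h1, if_pos (by omega)]
      · rw [if_neg h1, if_neg (by omega)]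
  have hlast : roundedArc c m (fun j => if j ≤ m - 1 then g else f) = roundedArc c m (fun _ => g) := by
    have hcurve : roundedCurve c m (fun j => if j ≤ m - 1 then g else f) =
        roundedCurve c m (fun _ => g) := by
      funext t
      rw [roundedCurve, roundedCurve]
      congr 1
      refine Finset.sum_congr rfl fun j hj => ?_
      rw [Finset.mem_range] at hj
      simp only [show j + 1 ≤ m - 1 from hj, if_true]
    rw [roundedArc, roundedArc, hcurve]
  rw [← hlast]
  exact hstep (m - 1) (by linarith [Nat.sub_add_cancel h.one_lt.le, h.one_lt])

end IsPearlChain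

/-! ### Pearls on the six meridians -/

/-- Twice the cosine of the angle `2 π i / 6`. -/
def hexCos (i : ZMod 6) : ℤ := ([2, 1, -1, -2, -1, 1] : List ℤ).getD i.val 0

/-- The sine of the angle `2 π i / 6`, divided by `√3 / 2`. -/
def hexSin (i : ZMod 6) : ℤ := ([0, 1, 1, 0, -1, -1] : List ℤ).getD i.val 0

theorem cos_hexAngle (i : ZMod 6) : Real.cos (2 * Real.pi * (i.val : ℝ) / 6) = hexCos i / 2 := by
  have h1 : Real.cos (2 * Real.pi * 1 / 6) = 1 / 2 := by
    rw [show 2 * Real.pi * 1 / 6 = Real.pi / 3 by ring, Real.cos_pi_div_three]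
  have h2 : Real.cos (2 * Real.pi * 2 / 6) = -1 / 2 := by
    rw [show 2 * Real.pi * 2 / 6 = Real.pi - Real.pi / 3 by ring, Real.cos_pi_sub,
      Real.cos_pi_div_three]
    ring
  have h3 : Real.cos (2 * Real.pi * 3 / 6) = -1 := by
    rw [show 2 * Real.pi * 3 / 6 = Real.pi by ring, Real.cos_pi]
  have h4 : Real.cos (2 * Real.pi * 4 / 6) = -1 / 2 := by
    rw [show 2 * Real.pi * 4 / 6 = Real.pi / 3 + Real.pi by ring, Real.cos_add_pi,
      Real.cos_pi_div_three]
    ring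
  have h5 : Real.cos (2 * Real.pi * 5 / 6) = 1 / 2 := by
    rw [show 2 * Real.pi * 5 / 6 = 2 * Real.pi - Real.pi / 3 by ring, Real.cos_two_pi_sub,
      Real.cos_pi_div_three]
  fin_cases i
  · change Real.cos (2 * Real.pi * ((0 : ℕ) : ℝ) / 6) = ((2 : ℤ) : ℝ) / 2
    norm_num
  · change Real.cos (2 * Real.pi * ((1 : ℕ) : ℝ) / 6) = ((1 : ℤ) : ℝ) / 2
    push_cast; exact h1
  · change Real.cos (2 * Real.pi * ((2 : ℕ) : ℝ) / 6) = ((-1 : ℤ) : ℝ) / 2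
    push_cast; exact h2
  · change Real.cos (2 * Real.pi * ((3 : ℕ) : ℝ) / 6) = ((-2 : ℤ) : ℝ) / 2
    push_cast; rw [h3]; norm_num
  · change Real.cos (2 * Real.pi * ((4 : ℕ) : ℝ) / 6) = ((-1 : ℤ) : ℝ) / 2
    push_cast; exact h4
  · change Real.cos (2 * Real.pi * ((5 : ℕ) : ℝ) / 6) = ((1 : ℤ) : ℝ) / 2
    push_cast; exact h5

theorem sin_hexAngle (i : ZMod 6) :
    Real.sin (2 * Real.pi * (i.val : ℝ) / 6) = Real.sqrt 3 / 2 * hexSin i := by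
  have h1 : Real.sin (2 * Real.pi * 1 / 6) = Real.sqrt 3 / 2 := by
    rw [show 2 * Real.pi * 1 / 6 = Real.pi / 3 by ring, Real.sin_pi_div_three]
  have h2 : Real.sin (2 * Real.pi * 2 / 6) = Real.sqrt 3 / 2 := by
    rw [show 2 * Real.pi * 2 / 6 = Real.pi - Real.pi / 3 by ring, Real.sin_pi_sub,
      Real.sin_pi_div_three]
  have h3 : Real.sin (2 * Real.pi * 3 / 6) = 0 := by
    rw [show 2 * Real.pi * 3 / 6 = Real.pi by ring, Real.sin_pi]
  have h4 : Real.sin (2 * Real.pi * 4 / 6) = -(Real.sqrt 3 / 2) := by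
    rw [show 2 * Real.pi * 4 / 6 = Real.pi / 3 + Real.pi by ring, Real.sin_add_pi,
      Real.sin_pi_div_three]
  have h5 : Real.sin (2 * Real.pi * 5 / 6) = -(Real.sqrt 3 / 2) := by
    rw [show 2 * Real.pi * 5 / 6 = 2 * Real.pi - Real.pi / 3 by ring, Real.sin_two_pi_sub,
      Real.sin_pi_div_three]
  fin_cases i
  · change Real.sin (2 * Real.pi * ((0 : ℕ) : ℝ) / 6) = Real.sqrt 3 / 2 * ((0 : ℤ) : ℝ)
    norm_num
  · change Real.sin (2 * Real.pi * ((1 : ℕ) : ℝ) / 6) = Real.sqrt 3 / 2 * ((1 : ℤ) : ℝ)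
    push_cast; rw [h1, mul_one]
  · change Real.sin (2 * Real.pi * ((2 : ℕ) : ℝ) / 6) = Real.sqrt 3 / 2 * ((1 : ℤ) : ℝ)
    push_cast; rw [h2, mul_one]
  · change Real.sin (2 * Real.pi * ((3 : ℕ) : ℝ) / 6) = Real.sqrt 3 / 2 * ((0 : ℤ) : ℝ)
    push_cast; rw [h3, mul_zero]
  · change Real.sin (2 * Real.pi * ((4 : ℕ) : ℝ) / 6) = Real.sqrt 3 / 2 * ((-1 : ℤ) : ℝ)
    push_cast; rw [h4]; ring
  · change Real.sin (2 * Real.pi * ((5 : ℕ) : ℝ) / 6) = Real.sqrt 3 / 2 * ((-1 : ℤ) : ℝ)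
    push_cast; rw [h5]; ring

/-- The copy of a point of the half-space on the `i`-th meridian. -/
noncomputable def hexPoint (c : E3) (i : ZMod 6) : E4 :=
  spinRot (2 * Real.pi * (i.val : ℝ) / 6) (toFour c)

theorem hexPoint_eq (c : E3) (i : ZMod 6) : hexPoint c i =
    !₂[c 0, c 1, c 2 * (hexCos i / 2), c 2 * (Real.sqrt 3 / 2 * hexSin i)] := by
  rw [hexPoint, spinRot, cos_hexAngle, sin_hexAngle]
  simp [toFour]

theorem E4.dist_sq (x y : E4) : dist x y ^ 2 =
    (x 0 - y 0) ^ 2 + (x 1 - y 1) ^ 2 + (x 2 - y 2) ^ 2 + (x 3 - y 3) ^ 2 := by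
  rw [dist_eq_norm, E4.norm_sq]
  rfl

theorem E3.dist_sq (x y : E3) : dist x y ^ 2 =
    (x 0 - y 0) ^ 2 + (x 1 - y 1) ^ 2 + (x 2 - y 2) ^ 2 := by
  rw [dist_eq_norm, E3.norm_sq]
  rfl

theorem sqrt_three_sq : Real.sqrt 3 ^ 2 = 3 := Real.sq_sqrt (by norm_num)

theorem hexCos_sq (i : ZMod 6) : (hexCos i : ℝ) ^ 2 + 3 * (hexSin i : ℝ) ^ 2 = 4 := by
  have : ∀ i, hexCos i ^ 2 + 3 * hexSin i ^ 2 = 4 := by decide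
  exact_mod_cast this i

/-- Four times the scalar product of the direction of a meridian with the sum of those of two
neighbouring meridians. -/
def hexProd (i s : ZMod 6) : ℤ :=
  (hexCos i + hexCos (i + 1)) * hexCos s + 3 * ((hexSin i + hexSin (i + 1)) * hexSin s)

theorem hexProd_self (i : ZMod 6) : hexProd i i = 6 := by
  revert i; decide

theorem hexProd_succ (i : ZMod 6) : hexProd i (i + 1) = 6 := by
  revert i; decide

theorem hexProd_nonpos {i s : ZMod 6} (h : ¬ (s = i ∨ s = i + 1)) : hexProd i s ≤ 0 := by
  revert i s; decide

theorem hexSum_sq (i : ZMod 6) : ((hexCos i : ℝ) + hexCos (i + 1)) ^ 2 +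
    3 * ((hexSin i : ℝ) + hexSin (i + 1)) ^ 2 = 12 := by
  have : ∀ i, (hexCos i + hexCos (i + 1)) ^ 2 + 3 * (hexSin i + hexSin (i + 1)) ^ 2 = 12 := by decide
  exact_mod_cast this i

theorem dist_hexPoint_succ_sq (c : E3) (i : ZMod 6) :
    dist (hexPoint c i) (hexPoint c (i + 1)) ^ 2 = c 2 ^ 2 := by
  have h1 : (hexCos i - hexCos (i + 1) : ℝ) ^ 2 + 3 * (hexSin i - hexSin (i + 1) : ℝ) ^ 2 = 4 := by
    have : ∀ i, (hexCos i - hexCos (i + 1)) ^ 2 + 3 * (hexSin i - hexSin (i + 1)) ^ 2 = 4 := by decide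
    exact_mod_cast this i
  rw [E4.dist_sq, hexPoint_eq, hexPoint_eq]
  simp only [Matrix.cons_val]
  linear_combination (c 2 ^ 2 / 4) * h1 +
    c 2 ^ 2 / 4 * (hexSin i - hexSin (i + 1) : ℝ) ^ 2 * sqrt_three_sq

/-- The point where the pearls centered at the copies of `c` and `c'` on the meridians `i` and `i + 1`
meet. -/
noncomputable def jointPoint (c c' : E3) (i : ZMod 6) : E4 :=
  (c' 2 / (2 * (c 2 + c' 2))) • (hexPoint c i + hexPoint c (i + 1)) +
    (c 2 / (2 * (c 2 + c' 2))) • (hexPoint c' i + hexPoint c' (i + 1))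

theorem jointPoint_comm (c c' : E3) (i : ZMod 6) : jointPoint c c' i = jointPoint c' c i := by
  rw [jointPoint, jointPoint, add_comm (c 2), add_comm]

/-- The joint point has the distance of the radius from the four pearls, and is farther away from the
copies of the same two pearls on the other meridians. -/
theorem dist_jointPoint_sq {c c' : E3} (hc : 0 < c 2) (hc' : 0 < c' 2)
    (h : 2 * dist c c' ^ 2 = c 2 ^ 2 + c' 2 ^ 2) (i s : ZMod 6) :
    dist (jointPoint c c' i) (hexPoint c s) ^ 2 = c 2 ^ 2 / 2 +
      c 2 ^ 2 * c' 2 / (c 2 + c' 2) * (6 - hexProd i s) / 2 := by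
  obtain ⟨a, ha⟩ : ∃ a, a = c 2 / (c 2 + c' 2) := ⟨_, rfl⟩
  have hsum : 0 < c 2 + c' 2 := by positivity
  have ha1 : a * (c 2 + c' 2) = c 2 := by rw [ha]; field_simp
  have e1 : c 2 / (2 * (c 2 + c' 2)) = a / 2 := by rw [ha]; field_simp
  have e2 : c' 2 / (2 * (c 2 + c' 2)) = (1 - a) / 2 := by rw [ha]; field_simp; ring
  have e3 : c 2 ^ 2 * c' 2 / (c 2 + c' 2) = a * c 2 * c' 2 := by rw [ha]; field_simp
  have e4 : (hexProd i s : ℝ) = (hexCos i + hexCos (i + 1)) * hexCos s +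
      3 * ((hexSin i + hexSin (i + 1)) * hexSin s) := by
    rw [hexProd]; push_cast; ring
  have e5 : (1 - a) * c 2 = a * c' 2 := by linarith
  rw [E3.dist_sq] at h
  have hA := hexSum_sq i
  have hB := hexCos_sq s
  rw [E4.dist_sq, jointPoint, e1, e2, e3, e4, hexPoint_eq, hexPoint_eq, hexPoint_eq, hexPoint_eq,
    hexPoint_eq]
  simp only [PiLp.add_apply, PiLp.smul_apply, Matrix.cons_val, smul_eq_mul]
  have f0 : (1 - a) / 2 * (c 0 + c 0) + a / 2 * (c' 0 + c' 0) - c 0 = -(a * (c 0 - c' 0)) := by ring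
  have f1 : (1 - a) / 2 * (c 1 + c 1) + a / 2 * (c' 1 + c' 1) - c 1 = -(a * (c 1 - c' 1)) := by ring
  have f2 : ∀ p q : ℝ, (1 - a) / 2 * (c 2 * p + c 2 * q) + a / 2 * (c' 2 * p + c' 2 * q) =
      a * c' 2 * (p + q) := by
    intro p q
    linear_combination (p + q) / 2 * e5
  rw [f0, f1, f2, f2]
  generalize (hexCos i : ℝ) = C at *
  generalize (hexCos (i + 1) : ℝ) = C' at *
  generalize (hexCos s : ℝ) = K at *
  generalize (hexSin i : ℝ) = D at *
  generalize (hexSin (i + 1) : ℝ) = D' at *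
  generalize (hexSin s : ℝ) = L at *
  generalize c 2 = z at *
  generalize c' 2 = z' at *
  have h3 := sqrt_three_sq
  generalize Real.sqrt 3 = q at *
  have g1 : (a * z' * (C / 2 + C' / 2) - z * (K / 2)) ^ 2 +
      (a * z' * (q / 2 * D + q / 2 * D') - z * (q / 2 * L)) ^ 2 =
      3 * (a * z') ^ 2 + z ^ 2 - a * z * z' * ((C + C') * K + 3 * ((D + D') * L)) / 2 := by
    linear_combination (a * z') ^ 2 / 4 * hA + z ^ 2 / 4 * hB +
      (a * z' * (D + D') - z * L) ^ 2 / 4 * h3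
  have g2 : a ^ 2 * (4 * z * z' - z ^ 2 - z' ^ 2) / 2 + 3 * (a * z') ^ 2 + z ^ 2 / 2 -
      3 * (a * z * z') = 0 := by
    have hz : z = a * (z + z') := ha1.symm
    linear_combination (3 * a * z' - (z + a * (z + z')) / 2) * ha1
  linear_combination g1 + g2 + a ^ 2 / 2 * h

/-- A point common to four spheres is unique when it is an affine combination of their centers. -/
theorem jointPoint_unique {c c' : E3} (hc : 0 < c 2) (hc' : 0 < c' 2) (i : ZMod 6) {q : E4}
    (h1 : dist q (hexPoint c i) = dist (jointPoint c c' i) (hexPoint c i))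
    (h2 : dist q (hexPoint c (i + 1)) = dist (jointPoint c c' i) (hexPoint c (i + 1)))
    (h3 : dist q (hexPoint c' i) = dist (jointPoint c c' i) (hexPoint c' i))
    (h4 : dist q (hexPoint c' (i + 1)) = dist (jointPoint c c' i) (hexPoint c' (i + 1))) :
    q = jointPoint c c' i := by
  have key : ∀ x : E4, dist q x = dist (jointPoint c c' i) x →
      ‖q‖ ^ 2 - 2 * inner ℝ q x = ‖jointPoint c c' i‖ ^ 2 - 2 * inner ℝ (jointPoint c c' i) x := by
    intro x hx
    rw [dist_eq_norm, dist_eq_norm] at hx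
    have := congrArg (· ^ 2) hx
    simp only [norm_sub_sq_real] at this
    linarith
  have k1 := key _ h1
  have k2 := key _ h2
  have k3 := key _ h3
  have k4 := key _ h4
  have hsum : 0 < c 2 + c' 2 := by positivity
  obtain ⟨a, ha⟩ : ∃ a, a = c' 2 / (2 * (c 2 + c' 2)) := ⟨_, rfl⟩
  obtain ⟨b, hb⟩ : ∃ b, b = c 2 / (2 * (c 2 + c' 2)) := ⟨_, rfl⟩
  have hab : 2 * a + 2 * b = 1 := by rw [ha, hb]; field_simp; ring
  have hp : jointPoint c c' i = a • (hexPoint c i + hexPoint c (i + 1)) +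
      b • (hexPoint c' i + hexPoint c' (i + 1)) := by rw [ha, hb, jointPoint]
  obtain ⟨p, hpp⟩ : ∃ p, p = jointPoint c c' i := ⟨_, rfl⟩
  rw [← hpp] at k1 k2 k3 k4 hp ⊢
  have hin : ∀ y : E4, inner ℝ y p = a * (inner ℝ y (hexPoint c i) + inner ℝ y (hexPoint c (i + 1))) +
      b * (inner ℝ y (hexPoint c' i) + inner ℝ y (hexPoint c' (i + 1))) := by
    intro y
    conv_lhs => rw [hp]
    rw [inner_add_right, inner_smul_right, inner_smul_right, inner_add_right, inner_add_right]
  have e1 := hin q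
  have e2 := hin p
  rw [real_inner_self_eq_norm_sq] at e2
  rw [← sub_eq_zero, ← norm_eq_zero, ← sq_eq_zero_iff, norm_sub_sq_real, e1]
  linear_combination a * k1 + a * k2 + b * k3 + b * k4 + (2 : ℝ) * e2 +
    (‖p‖ ^ 2 - ‖q‖ ^ 2) * hab

theorem dist_unspin_le (y : E4) {c : E3} (hc : 0 ≤ c 2) (i : ZMod 6) :
    dist (unspin y) c ≤ dist y (hexPoint c i) := by
  rw [← sq_le_sq₀ dist_nonneg dist_nonneg, E3.dist_sq, E4.dist_sq, hexPoint_eq]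
  have h0 : unspin y 0 = y 0 := rfl
  have h1 : unspin y 1 = y 1 := rfl
  have h2 : unspin y 2 = Real.sqrt (y 2 ^ 2 + y 3 ^ 2) := rfl
  simp only [Matrix.cons_val, h0, h1, h2]
  have hs : Real.sqrt (y 2 ^ 2 + y 3 ^ 2) ^ 2 = y 2 ^ 2 + y 3 ^ 2 := Real.sq_sqrt (by positivity)
  have hB := hexCos_sq i
  have h3 := sqrt_three_sq
  generalize (hexCos i : ℝ) = K at *
  generalize (hexSin i : ℝ) = L at *
  generalize Real.sqrt 3 = q at *
  have hcs : y 2 * (K / 2) + y 3 * (q / 2 * L) ≤ Real.sqrt (y 2 ^ 2 + y 3 ^ 2) := by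
    refine Real.le_sqrt_of_sq_le ?_
    have : (K / 2) ^ 2 + (q / 2 * L) ^ 2 = 1 := by linear_combination hB / 4 + L ^ 2 / 4 * h3
    nlinarith [sq_nonneg (y 2 * (q / 2 * L) - y 3 * (K / 2))]
  have h5 := mul_le_mul_of_nonneg_left hcs hc
  have h6 : (c 2 * (K / 2)) ^ 2 + (c 2 * (q / 2 * L)) ^ 2 = c 2 ^ 2 := by
    linear_combination c 2 ^ 2 * hB / 4 + c 2 ^ 2 * L ^ 2 / 4 * h3
  nlinarith

/-- At a pole, the pearl centered there and two neighbouring pearls on consecutive meridians have a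
common point. -/
theorem exists_pole_point (c : E3) (i : ZMod 6) : ∃ q : E4,
    dist q (toFour !₂[c 0, c 1, 0]) ^ 2 = c 2 ^ 2 / 2 ∧ dist q (hexPoint c i) ^ 2 = c 2 ^ 2 / 2 ∧
      dist q (hexPoint c (i + 1)) ^ 2 = c 2 ^ 2 / 2 := by
  have h6 : Real.sqrt 6 ^ 2 = 6 := Real.sq_sqrt (by norm_num)
  have h3 := sqrt_three_sq
  have hA := hexSum_sq i
  have key : ∀ s, hexProd i s = 6 → dist (!₂[c 0 + c 2 * Real.sqrt 6 / 6, c 1,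
      c 2 / 3 * ((hexCos i + hexCos (i + 1)) / 2),
      c 2 / 3 * (Real.sqrt 3 / 2 * (hexSin i + hexSin (i + 1)))] : E4) (hexPoint c s) ^ 2 =
      c 2 ^ 2 / 2 := by
    intro s hs
    have hB := hexCos_sq s
    have e4 : ((hexCos i : ℝ) + hexCos (i + 1)) * hexCos s +
      3 * ((hexSin i + hexSin (i + 1)) * hexSin s) = 6 := by
      have := congrArg (Int.cast : ℤ → ℝ) hs
      rw [hexProd] at this
      push_cast at this
      linarith
    rw [E4.dist_sq, hexPoint_eq]
    simp only [Matrix.cons_val]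
    linear_combination c 2 ^ 2 / 36 * h6 + c 2 ^ 2 / 36 * hA + c 2 ^ 2 / 4 * hB -
      c 2 ^ 2 / 6 * e4 + c 2 ^ 2 / 4 *
        (((hexSin i : ℝ) + hexSin (i + 1)) / 3 - hexSin s) ^ 2 * h3
  refine ⟨_, ?_, key i (hexProd_self i), key (i + 1) (hexProd_succ i)⟩
  rw [E4.dist_sq]
  simp only [toFour, Matrix.cons_val]
  linear_combination c 2 ^ 2 / 36 * h6 + c 2 ^ 2 / 36 * hA + c 2 ^ 2 / 36 *
        ((hexSin i : ℝ) + hexSin (i + 1)) ^ 2 * h3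

theorem dist_toFour (x y : E3) : dist (toFour x) (toFour y) = dist x y := by
  rw [← pow_left_inj₀ dist_nonneg dist_nonneg two_ne_zero, E4.dist_sq, E3.dist_sq]
  simp [toFour]

theorem dist_hexPoint (c c' : E3) (i : ZMod 6) : dist (hexPoint c i) (hexPoint c' i) = dist c c' := by
  rw [hexPoint, hexPoint, dist_spinRot, dist_toFour]

theorem hexPoint_of_height_eq_zero {c : E3} (hc : c 2 = 0) (i : ZMod 6) : hexPoint c i = toFour c := by
  rw [hexPoint_eq]
  ext j
  fin_cases j <;> simp [toFour, hc]

/-- A horizontal unit vector perpendicular to a given horizontal direction. -/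
theorem exists_horizontal_normal (a b : ℝ) : ∃ ν : E4, ‖ν‖ = 1 ∧ ν 2 = 0 ∧ ν 3 = 0 ∧
    ν 0 * a + ν 1 * b = 0 := by
  have hnorm : ∀ x : E4, x 0 ^ 2 + x 1 ^ 2 = 1 → x 2 = 0 → x 3 = 0 → ‖x‖ = 1 := by
    intro x h h2 h3
    rw [← pow_left_inj₀ (norm_nonneg _) zero_le_one two_ne_zero, E4.norm_sq, h2, h3]
    linarith
  by_cases h : a ^ 2 + b ^ 2 = 0
  · have ha : a = 0 := by nlinarith [sq_nonneg a, sq_nonneg b]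
    have hb : b = 0 := by nlinarith [sq_nonneg a, sq_nonneg b]
    exact ⟨!₂[1, 0, 0, 0], hnorm _ (by simp) rfl rfl, rfl, rfl, by simp [ha, hb]⟩
  · have hpos : 0 < a ^ 2 + b ^ 2 := lt_of_le_of_ne (by positivity) (Ne.symm h)
    have hs := Real.sq_sqrt hpos.le
    have hs0 := Real.sqrt_pos.2 hpos
    generalize Real.sqrt (a ^ 2 + b ^ 2) = q at hs hs0
    refine ⟨!₂[-b / q, a / q, 0, 0], hnorm _ ?_ rfl rfl, rfl, rfl, ?_⟩
    · simp only [Matrix.cons_val]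
      field_simp
      linarith
    · simp only [Matrix.cons_val]
      ring

theorem inner_jointPoint_sub {c c' : E3} (hc : 0 < c 2) (hc' : 0 < c' 2) (i s : ZMod 6) {ν : E4}
    (h2 : ν 2 = 0) (h3 : ν 3 = 0) (h : ν 0 * (c 0 - c' 0) + ν 1 * (c 1 - c' 1) = 0) :
    inner ℝ ν (jointPoint c c' i - hexPoint c s) = 0 := by
  have hsum : c 2 + c' 2 ≠ 0 := by positivity
  rw [PiLp.inner_apply, Fin.sum_univ_four, h2, h3, jointPoint, hexPoint_eq, hexPoint_eq, hexPoint_eq,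
    hexPoint_eq, hexPoint_eq]
  simp only [PiLp.add_apply, PiLp.smul_apply, PiLp.sub_apply, Matrix.cons_val, smul_eq_mul,
    RCLike.inner_apply, conj_trivial]
  field_simp
  linear_combination (-4 * c 2) * h

namespace IsPearlChain

variable {m : ℕ} {c : ℕ → E3} {r : ℕ → ℝ}

theorem two_mul_dist_sq (h : IsPearlChain m c r) {k : ℕ} (hk : 1 ≤ k) (hkm : k + 1 < m) :
    2 * dist (c k) (c (k + 1)) ^ 2 = c k 2 ^ 2 + c (k + 1) 2 ^ 2 := by
  have h1 := h.orthogonal k (by omega)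
  have h2 := h.radius_sq k hk (by omega)
  have h3 := h.radius_sq (k + 1) (by omega) hkm
  rw [edgeLength] at h1
  linarith

theorem dist_joint (h : IsPearlChain m c r) {k : ℕ} (hk : 1 ≤ k) (hkm : k + 1 < m) {i s : ZMod 6}
    (hs : s = i ∨ s = i + 1) :
    dist (jointPoint (c k) (c (k + 1)) i) (hexPoint (c k) s) = r k ∧
      dist (jointPoint (c k) (c (k + 1)) i) (hexPoint (c (k + 1)) s) = r (k + 1) := by
  have hz := h.height_pos k hk (by omega)
  have hz' := h.height_pos (k + 1) (by omega) hkm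
  have he := h.two_mul_dist_sq hk hkm
  have h2 := h.radius_sq k hk (by omega)
  have h3 := h.radius_sq (k + 1) (by omega) hkm
  have hp : hexProd i s = 6 := by
    rcases hs with rfl | rfl
    exacts [hexProd_self _, hexProd_succ _]
  constructor
  · rw [← pow_left_inj₀ dist_nonneg (h.radius_pos k (by omega)).le two_ne_zero,
      dist_jointPoint_sq hz hz' he, hp]
    push_cast
    linarith
  · rw [← pow_left_inj₀ dist_nonneg (h.radius_pos (k + 1) (by omega)).le two_ne_zero, jointPoint_comm,
      dist_jointPoint_sq hz' hz (by rw [dist_comm, he, add_comm]), hp]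
    push_cast
    linarith

/-- A joint point lies outside the solid pearls other than the four that meet there. -/
theorem lt_dist_joint (h : IsPearlChain m c r) {k : ℕ} (hk : 1 ≤ k) (hkm : k + 1 < m) {q : ℕ}
    (hq : q ≤ m) {i s : ZMod 6} (hne : ¬ ((q = k ∨ q = k + 1) ∧ (s = i ∨ s = i + 1))) :
    r q < dist (jointPoint (c k) (c (k + 1)) i) (hexPoint (c q) s) := by
  have hz := h.height_pos k hk (by omega)
  have hz' := h.height_pos (k + 1) (by omega) hkm
  have he := h.two_mul_dist_sq hk hkm
  by_cases hqk : q = k ∨ q = k + 1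
  · have hp : (hexProd i s : ℝ) ≤ 0 := by exact_mod_cast hexProd_nonpos fun hs => hne ⟨hqk, hs⟩
    rcases hqk with rfl | rfl
    · rw [← sq_lt_sq₀ (h.radius_pos q (by omega)).le dist_nonneg, dist_jointPoint_sq hz hz' he]
      have h2 := h.radius_sq q hk (by omega)
      have h4 : 0 < c q 2 ^ 2 * c (q + 1) 2 / (c q 2 + c (q + 1) 2) * (6 - hexProd i s) := by
        apply mul_pos
        · positivity
        · linarith
      linarith
    · rw [← sq_lt_sq₀ (h.radius_pos _ hq).le dist_nonneg, jointPoint_comm,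
        dist_jointPoint_sq hz' hz (by rw [dist_comm, he, add_comm])]
      have h2 := h.radius_sq (k + 1) (by omega) hkm
      have h4 : 0 < c (k + 1) 2 ^ 2 * c k 2 / (c (k + 1) 2 + c k 2) * (6 - hexProd i s) := by
        apply mul_pos
        · positivity
        · linarith
      linarith
  · -- unspinning does not increase distances, and the unspun joint point is in two consecutive balls
    have hq0 : 0 ≤ c q 2 := by
      rcases (show q = 0 ∨ q = m ∨ 1 ≤ q ∧ q < m by omega) with rfl | rfl | ⟨h1, h2⟩
      · exact h.height_first.ge
      · exact h.height_last.ge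
      · exact (h.height_pos q h1 h2).le
    refine lt_of_lt_of_le ?_ (dist_unspin_le _ hq0 s)
    have h1 := dist_unspin_le (jointPoint (c k) (c (k + 1)) i) hz.le i
    have h2 := dist_unspin_le (jointPoint (c k) (c (k + 1)) i) hz'.le i
    rw [(h.dist_joint hk hkm (Or.inl rfl)).1] at h1
    rw [(h.dist_joint hk hkm (Or.inl rfl)).2] at h2
    generalize unspin (jointPoint (c k) (c (k + 1)) i) = x at *
    have t1 := dist_triangle_left (c k) (c q) x
    have t2 := dist_triangle_left (c (k + 1)) (c q) x
    rcases (show q + 1 < k + 1 ∨ k + 1 < q by omega) with h3 | h3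
    · have h4 := h.disjoint q (k + 1) h3 hkm.le
      rw [dist_comm] at h4
      linarith
    · linarith [h.disjoint k q h3 hq]

/-- The joints are distinct because each of them lies only in the four pearls that meet there. -/
theorem jointPoint_ne (h : IsPearlChain m c r) {k q : ℕ} (hk : 1 ≤ k) (hkm : k + 1 < m) (hq : 1 ≤ q)
    (hqm : q + 1 < m) {i s : ZMod 6} (hne : (k, i) ≠ (q, s)) :
    jointPoint (c k) (c (k + 1)) i ≠ jointPoint (c q) (c (q + 1)) s := by
  intro he
  have hex : ∃ j s', (j = q ∨ j = q + 1) ∧ (s' = s ∨ s' = s + 1) ∧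
      ¬ ((j = k ∨ j = k + 1) ∧ (s' = i ∨ s' = i + 1)) := by
    by_cases hkq : k = q
    · subst hkq
      have his : i ≠ s := fun h => hne (by rw [h])
      have hdec : ∀ i s : ZMod 6, i ≠ s → ¬ (s = i ∨ s = i + 1) ∨ ¬ (s + 1 = i ∨ s + 1 = i + 1) := by
        decide
      rcases hdec i s his with h1 | h1
      · exact ⟨k, s, Or.inl rfl, Or.inl rfl, fun h2 => h1 h2.2⟩
      · exact ⟨k, s + 1, Or.inl rfl, Or.inr rfl, fun h2 => h1 h2.2⟩
    · by_cases h1 : q = k ∨ q = k + 1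
      · exact ⟨q + 1, s, Or.inr rfl, Or.inl rfl, fun h2 => by omega⟩
      · exact ⟨q, s, Or.inl rfl, Or.inl rfl, fun h2 => h1 h2.1⟩
  obtain ⟨j, s', hj, hs', hn⟩ := hex
  have h1 := h.lt_dist_joint hk hkm (q := j) (by omega) hn
  have h2 := h.dist_joint hq hqm hs'
  rw [he] at h1
  rcases hj with rfl | rfl
  · exact h1.ne' h2.1
  · exact h1.ne' h2.2

/-- A radius small enough for all the pearls at the joint points. -/
theorem exists_joint_radius (h : IsPearlChain m c r) : ∃ ρ : ℝ, 0 < ρ ∧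
    (∀ k, 1 ≤ k → k + 1 < m → ∀ i : ZMod 6, ∀ q ≤ m, ∀ s : ZMod 6,
      ¬ ((q = k ∨ q = k + 1) ∧ (s = i ∨ s = i + 1)) →
        2 * ρ + r q < dist (jointPoint (c k) (c (k + 1)) i) (hexPoint (c q) s)) ∧
    ∀ k, 1 ≤ k → k + 1 < m → ∀ i : ZMod 6, ∀ q, 1 ≤ q → q + 1 < m → ∀ s : ZMod 6, (k, i) ≠ (q, s) →
      4 * ρ < dist (jointPoint (c k) (c (k + 1)) i) (jointPoint (c q) (c (q + 1)) s) := by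
  have hsmall : ∀ a : ℝ, 0 < a → ∀ᶠ ρ in 𝓝[>] (0 : ℝ), ρ < a := fun a ha =>
    (eventually_lt_nhds ha).filter_mono nhdsWithin_le_nhds
  have h1 : ∀ᶠ ρ in 𝓝[>] (0 : ℝ), ∀ k ∈ Finset.Ico 1 (m - 1), ∀ i : ZMod 6, ∀ q ∈ Finset.range (m + 1),
      ∀ s : ZMod 6, ¬ ((q = k ∨ q = k + 1) ∧ (s = i ∨ s = i + 1)) →
        2 * ρ + r q < dist (jointPoint (c k) (c (k + 1)) i) (hexPoint (c q) s) := by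
    rw [Filter.eventually_all_finset]
    intro k hk
    rw [Filter.eventually_all]
    intro i
    rw [Filter.eventually_all_finset]
    intro q hq
    rw [Filter.eventually_all]
    intro s
    rw [Filter.eventually_imp_distrib_left]
    intro hne
    simp only [Finset.mem_Ico, Finset.mem_range] at hk hq
    have h3 := h.lt_dist_joint hk.1 (by omega) (by omega) hne
    filter_upwards [hsmall _ (half_pos (sub_pos.2 h3))] with ρ hρ
    linarith
  have h2 : ∀ᶠ ρ in 𝓝[>] (0 : ℝ), ∀ k ∈ Finset.Ico 1 (m - 1), ∀ i : ZMod 6, ∀ q ∈ Finset.Ico 1 (m - 1),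
      ∀ s : ZMod 6, (k, i) ≠ (q, s) →
      4 * ρ < dist (jointPoint (c k) (c (k + 1)) i) (jointPoint (c q) (c (q + 1)) s) := by
    rw [Filter.eventually_all_finset]
    intro k hk
    rw [Filter.eventually_all]
    intro i
    rw [Filter.eventually_all_finset]
    intro q hq
    rw [Filter.eventually_all]
    intro s
    rw [Filter.eventually_imp_distrib_left]
    intro hne
    simp only [Finset.mem_Ico] at hk hq
    have h3 := dist_pos.2 (h.jointPoint_ne hk.1 (by omega) hq.1 (by omega) hne)
    filter_upwards [hsmall _ (show 0 < dist (jointPoint (c k) (c (k + 1)) i)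
      (jointPoint (c q) (c (q + 1)) s) / 4 by linarith)] with ρ hρ
    linarith
  obtain ⟨ρ, hρ1, hρ2, hρ⟩ := (h1.and (h2.and self_mem_nhdsWithin)).exists
  simp only [Finset.mem_Ico, Finset.mem_range] at hρ1 hρ2
  exact ⟨ρ, hρ, fun k hk hkm i q hq s => hρ1 k (by omega) i q (by omega) s,
    fun k hk hkm i q hq hqm s => hρ2 k (by omega) i q (by omega) s⟩

end IsPearlChain

theorem closedBall_disjoint_of_radius_eq {p C ν : E4} {ρ R : ℝ} (hρ : 0 < ρ) (hν : ‖ν‖ = 1)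
    (h : 2 * ρ + R < dist p C) :
    Disjoint (Metric.closedBall (p + ρ • ν) ρ) (Metric.closedBall C R) := by
  apply Metric.closedBall_disjoint_closedBall
  have h1 := dist_triangle_left p C (p + ρ • ν)
  rw [dist_eq_norm _ p, add_sub_cancel_left, norm_smul, hν, mul_one, Real.norm_of_nonneg hρ.le] at h1
  linarith

theorem dist_add_smul_sq_of_inner_eq_zero {p C ν : E4} {ρ : ℝ} (hν : ‖ν‖ = 1) (h : inner ℝ ν (p - C) = 0) :
    dist (p + ρ • ν) C ^ 2 = ρ ^ 2 + dist p C ^ 2 := by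
  rw [dist_eq_norm, dist_eq_norm, show p + ρ • ν - C = (p - C) + ρ • ν by abel, norm_add_sq_real,
    inner_smul_right, real_inner_comm, h, norm_smul, hν, mul_one, Real.norm_eq_abs, sq_abs]
  ring

namespace IsPearlChain

variable {m : ℕ} {c : ℕ → E3} {r : ℕ → ℝ} {δ : ℝ} {χ : ℕ → ℝ → ℝ}

theorem isSemiPearlNecklace (h : IsPearlChain m c r) {S : ℕ → Pearl}
    (hS : ∀ k ≤ m, (S k).center = toFour (c k)) (hr : ∀ k ≤ m, (S k).radius = r k)
    (hδ : IsRoundingWidth m c r δ) (hχ : ∀ k, IsCornerProfile δ (χ k)) :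
    IsSemiPearlNecklace (roundedArc c m χ) (c 0) (c m) m S := by
  have hsolid : ∀ k ≤ m, ∀ x : E3, toFour x ∈ (S k).solid ↔ ‖x - c k‖ ≤ r k := by
    intro k hk x
    rw [Pearl.solid, Metric.mem_closedBall, hS k hk, hr k hk, dist_toFour, dist_eq_norm]
  refine ⟨hS 0 (Nat.zero_le m), hS m le_rfl, ?_, fun k hk => ?_, fun j k hjk hk => ?_, fun k hk => ?_⟩
  · rintro x ⟨t, ht, rfl⟩
    obtain ⟨k, hk, hkt⟩ := h.exists_time_near ht
    exact ⟨k, hk, (hsolid k hk _).2 ((h.curve_mem_iff hδ hχ ht hk).2 hkt)⟩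
  · rw [Pearl.Orthogonal, hS k hk.le, hS (k + 1) hk, hr k hk.le, hr (k + 1) hk, dist_toFour]
    exact h.orthogonal k hk
  · apply Metric.closedBall_disjoint_closedBall
    rw [hS j (by omega), hS k hk, hr j (by omega), hr k hk, dist_toFour]
    exact h.disjoint j k hjk hk
  · have hset : {x : E3 | 0 ≤ x 2 ∧ toFour x ∈ (S k).solid} = {x : E3 | 0 ≤ x 2 ∧ ‖x - c k‖ ≤ r k} := by
      ext x
      simp only [mem_ofPred_eq, hsolid k hk]
    rw [hset]
    rcases (show k = 0 ∨ k = m ∨ 1 ≤ k ∧ k < m by omega) with rfl | rfl | ⟨h1, h2⟩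
    · exact h.isTrivialBallPair_first hδ hχ
    · exact h.isTrivialBallPair_last hδ hχ
    · obtain ⟨G, hG⟩ := h.exists_isStraightenedBy hδ hχ h1 h2
      have hball : {x : E3 | 0 ≤ x 2 ∧ ‖x - c k‖ ≤ r k} = Metric.closedBall (c k) (r k) := by
        ext x
        rw [mem_closedBall_iff_norm]
        exact ⟨fun hx => hx.2, fun hx => ⟨(h.pos_of_mem_ball h1 h2 hx).le, hx⟩⟩
      rw [hball]
      exact hG.isTrivialBallPair (h.radius_pos k hk)

/-- For a chain of balls the remaining conditions on a pearl-necklace hold automatically, and the pearls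
at the joint points can be chosen independently of the way in which the corners are rounded. -/
theorem exists_isPearlNecklace {l : ℕ} (h : IsPearlChain (l + 1) c r) {S : ℕ → Pearl}
    (hS : ∀ k ≤ l + 1, (S k).center = toFour (c k)) (hr : ∀ k ≤ l + 1, (S k).radius = r k) :
    ∃ P : ℕ → ZMod 6 → Pearl, ∀ δ χ, IsRoundingWidth (l + 1) c r δ →
      (∀ k, IsCornerProfile δ (χ k)) →
        IsPearlNecklace (roundedArc c (l + 1) χ) (c 0) (c (l + 1)) l S P := by
  have hl : 1 ≤ l := by linarith [h.one_lt]
  obtain ⟨ρ, hρ, hρ1, hρ2⟩ := h.exists_joint_radius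
  choose ν hν1 hν2 hν3 hν using fun k : ℕ => exists_horizontal_normal (c k 0 - c (k + 1) 0)
    (c k 1 - c (k + 1) 1)
  have hcen : ∀ k ≤ l + 1, ∀ i, (meridianPearl S k i).center = hexPoint (c k) i := by
    intro k hk i
    rw [hexPoint, ← hS k hk]
    rfl
  have hrad : ∀ k ≤ l + 1, ∀ i, (meridianPearl S k i).radius = r k := fun k hk i => hr k hk
  have hc0 := hexPoint_of_height_eq_zero h.height_first
  have hcl := hexPoint_of_height_eq_zero h.height_last
  -- distances from the joint points to the centers of the four pearls
  have hjoint : ∀ k, 1 ≤ k → k < l → ∀ i s : ZMod 6, (s = i ∨ s = i + 1) → ∀ q, (q = k ∨ q = k + 1) →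
      dist (jointPoint (c k) (c (k + 1)) i) (meridianPearl S q s).center =
        (meridianPearl S q s).radius ∧
      inner ℝ (ν k) (jointPoint (c k) (c (k + 1)) i - (meridianPearl S q s).center) = 0 := by
    intro k hk hkl i s hs q hq
    have hz := h.height_pos k hk (by omega)
    have hz' := h.height_pos (k + 1) (by omega) (by omega)
    rw [hcen q (by omega), hrad q (by omega)]
    rcases hq with rfl | rfl
    · exact ⟨(h.dist_joint hk (by omega) hs).1,
        inner_jointPoint_sub hz hz' i s (hν2 q) (hν3 q) (hν q)⟩
    · refine ⟨(h.dist_joint hk (by omega) hs).2, ?_⟩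
      rw [jointPoint_comm]
      exact inner_jointPoint_sub hz' hz i s (hν2 k) (hν3 k) (by linarith [hν k])
  set P : ℕ → ZMod 6 → Pearl := fun k i => ⟨jointPoint (c k) (c (k + 1)) i + ρ • ν k, ρ, hρ⟩ with hP
  have horth : ∀ k, 1 ≤ k → k < l → ∀ i s : ZMod 6, (s = i ∨ s = i + 1) → ∀ q, (q = k ∨ q = k + 1) →
      (P k i).Orthogonal (meridianPearl S q s) := by
    intro k hk hkl i s hs q hq
    have h1 := hjoint k hk hkl i s hs q hq
    rw [Pearl.Orthogonal, hP, dist_add_smul_sq_of_inner_eq_zero (hν1 k) h1.2, h1.1]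
  have hdisj : ∀ k, 1 ≤ k → k < l → ∀ i : ZMod 6, ∀ q ≤ l + 1, ∀ s : ZMod 6,
      ¬ ((q = k ∨ q = k + 1) ∧ (s = i ∨ s = i + 1)) →
        Disjoint (P k i).solid (Metric.closedBall (hexPoint (c q) s) (r q)) := fun k hk hkl i q hq s hne =>
    closedBall_disjoint_of_radius_eq hρ (hν1 k) (hρ1 k hk (by omega) i q hq s hne)
  refine ⟨P, fun δ χ hδ hχ => ⟨h.isSemiPearlNecklace hS hr hδ hχ, ?_, ?_, ?_, ?_, ?_, ?_, ?_, ?_, ?_⟩⟩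
  · intro k hk hkl i
    rw [Pearl.Orthogonal, hcen k (by omega), hcen k (by omega), hrad k (by omega), hrad k (by omega),
      dist_hexPoint_succ_sq]
    linarith [h.radius_sq k hk (by omega)]
  · intro i
    have h1 := h.orthogonal 0 (by omega)
    have h2 := h.radius_sq 1 le_rfl (by omega)
    have h3 := h.edgeLength_first
    obtain ⟨q, hq0, hq1, hq2⟩ := exists_pole_point (c 1) i
    rw [← h.first_eq] at hq0
    refine ⟨?_, q, ⟨?_, ?_⟩, ?_⟩
    · rw [Pearl.Orthogonal, hS 0 (by omega), hr 0 (by omega), hcen 1 (by omega), hrad 1 (by omega),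
        ← hc0 i, dist_hexPoint]
      exact h1
    · rw [Pearl.sphere, Metric.mem_sphere, hS 0 (by omega), hr 0 (by omega),
        ← pow_left_inj₀ dist_nonneg (h.radius_pos 0 (by omega)).le two_ne_zero, hq0]
      rw [h3, zero_add] at h1
      linarith
    · rw [Pearl.sphere, Metric.mem_sphere, hcen 1 (by omega), hrad 1 (by omega),
        ← pow_left_inj₀ dist_nonneg (h.radius_pos 1 (by omega)).le two_ne_zero, hq1]
      linarith
    · rw [Pearl.sphere, Metric.mem_sphere, hcen 1 (by omega), hrad 1 (by omega),
        ← pow_left_inj₀ dist_nonneg (h.radius_pos 1 (by omega)).le two_ne_zero, hq2]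
      linarith
  · intro i
    have h1 := h.orthogonal l (by omega)
    have h2 := h.radius_sq l hl (by omega)
    have h3 := h.edgeLength_last
    rw [Nat.add_sub_cancel] at h3
    obtain ⟨q, hq0, hq1, hq2⟩ := exists_pole_point (c l) i
    have h4 := h.last_eq
    rw [Nat.add_sub_cancel] at h4
    rw [← h4] at hq0
    refine ⟨?_, q, ⟨?_, ?_⟩, ?_⟩
    · rw [Pearl.Orthogonal, hS (l + 1) le_rfl, hr (l + 1) le_rfl, hcen l (by omega), hrad l (by omega),
        ← hcl i, dist_hexPoint, dist_comm, add_comm (r (l + 1) ^ 2)]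
      exact h1
    · rw [Pearl.sphere, Metric.mem_sphere, hS (l + 1) le_rfl, hr (l + 1) le_rfl,
        ← pow_left_inj₀ dist_nonneg (h.radius_pos (l + 1) le_rfl).le two_ne_zero, hq0]
      rw [h3] at h1
      linarith
    · rw [Pearl.sphere, Metric.mem_sphere, hcen l (by omega), hrad l (by omega),
        ← pow_left_inj₀ dist_nonneg (h.radius_pos l (by omega)).le two_ne_zero, hq1]
      linarith
    · rw [Pearl.sphere, Metric.mem_sphere, hcen l (by omega), hrad l (by omega),
        ← pow_left_inj₀ dist_nonneg (h.radius_pos l (by omega)).le two_ne_zero, hq2]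
      linarith
  · intro k hk hkl i
    have j1 := (hjoint k hk hkl i i (Or.inl rfl) k (Or.inl rfl)).1
    have j2 := (hjoint k hk hkl i i (Or.inl rfl) (k + 1) (Or.inr rfl)).1
    have j3 := (hjoint k hk hkl i (i + 1) (Or.inr rfl) k (Or.inl rfl)).1
    have j4 := (hjoint k hk hkl i (i + 1) (Or.inr rfl) (k + 1) (Or.inr rfl)).1
    refine ⟨jointPoint (c k) (c (k + 1)) i, ?_, ?_⟩
    · ext q
      rw [mem_singleton_iff]
      constructor
      · rintro ⟨⟨⟨q1, q2⟩, q3⟩, q4⟩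
        rw [Pearl.sphere, Metric.mem_sphere] at q1 q2 q3 q4
        rw [← j1, hcen k (by omega)] at q1
        rw [← j2, hcen (k + 1) (by omega)] at q2
        rw [← j3, hcen k (by omega)] at q3
        rw [← j4, hcen (k + 1) (by omega)] at q4
        exact jointPoint_unique (h.height_pos k hk (by omega))
          (h.height_pos (k + 1) (by omega) (by omega)) i q1 q3 q2 q4
      · rintro rfl
        exact ⟨⟨⟨j1, j2⟩, j3⟩, j4⟩
    · rw [Pearl.sphere, Metric.mem_sphere, dist_comm, dist_eq_norm, hP]
      simp only [add_sub_cancel_left, norm_smul, hν1, mul_one, Real.norm_of_nonneg hρ.le]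
  · intro k hk hkl i
    exact ⟨horth k hk hkl i i (Or.inl rfl) k (Or.inl rfl),
      horth k hk hkl i i (Or.inl rfl) (k + 1) (Or.inr rfl),
      horth k hk hkl i (i + 1) (Or.inr rfl) k (Or.inl rfl),
      horth k hk hkl i (i + 1) (Or.inr rfl) (k + 1) (Or.inr rfl)⟩
  · intro k hk hkl i q hq hql s hne
    have h1 := hdisj k hk hkl i q (by omega) s hne
    rwa [← hcen q (by omega), ← hrad q (by omega) s] at h1
  · intro k hk hkl i
    have h1 := hdisj k hk hkl i 0 (by omega) i (by omega)
    have h2 := hdisj k hk hkl i (l + 1) le_rfl i (by omega)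
    rw [hc0, ← hS 0 (by omega), ← hr 0 (by omega)] at h1
    rw [hcl, ← hS (l + 1) le_rfl, ← hr (l + 1) le_rfl] at h2
    exact ⟨h1, h2⟩
  · intro k hk hkl i q hq hql s hne
    refine closedBall_disjoint_of_radius_eq hρ (hν1 k) ?_
    have h1 := hρ2 k hk (by omega) i q hq (by omega) s hne
    have h2 := dist_triangle_right (jointPoint (c k) (c (k + 1)) i) (jointPoint (c q) (c (q + 1)) s)
      (P q s).center
    have h3 : dist (jointPoint (c q) (c (q + 1)) s) (P q s).center = ρ := by
      rw [dist_comm, dist_eq_norm, hP]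
      simp only [add_sub_cancel_left, norm_smul, hν1, mul_one, Real.norm_of_nonneg hρ.le]
    change 2 * ρ + ρ < dist _ (P q s).center
    linarith
  · intro k hk hkl i
    obtain ⟨G, hG⟩ := h.exists_isStraightenedBy hδ hχ hk (by omega)
    have h1 := isTrivialBallPair_spinSet hG (fun x hx => h.nonneg_of_mem hδ hχ hx)
      (h.height_pos k hk (by omega)) (h.radius_pos k (by omega)) (h.radius_sq k hk (by omega))
      (2 * Real.pi * (i.val : ℝ) / 6)
    rw [Pearl.solid, hcen k (by omega), hrad k (by omega)]
    exact h1

end IsPearlChain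

/-! ### The numerical data of the pearls -/

/-- The data of a pearl: a point with coordinates in `(1 / denom) ℤ`, multiplied by `denom`, whose third
coordinate `z` is to be multiplied by a power of `2 - √3`. The result is the height of an inner
pearl and `√2` times its radius; an outer pearl is centered on the boundary plane instead. -/
structure PearlDatum where
  point : Z3
  exponent : ℕ
  isInner : Bool

namespace PearlDatum

/-- The radius multiplied by `√2`. -/
noncomputable def reach (d : PearlDatum) : ℝ :=
  (d.point.2.2 : ℝ) / denom * (2 - Real.sqrt 3) ^ d.exponent

/-- The height of the center above the boundary plane. -/
noncomputable def height (d : PearlDatum) : ℝ := if d.isInner then d.reach else 0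

/-- The center of the pearl. -/
noncomputable def center (d : PearlDatum) : E3 :=
  !₂[(d.point.1 : ℝ) / denom, (d.point.2.1 : ℝ) / denom, d.height]

/-- The radius of the pearl. -/
noncomputable def radius (d : PearlDatum) : ℝ := d.reach / Real.sqrt 2

end PearlDatum

/-- The data of the 87 pearls. At both ends the heights form a geometric progression with ratio
`2 - √3`, which makes consecutive pearls on a vertical line orthogonal. -/
def pearlData : List PearlDatum :=
  let v : Z3 := (592302077680855, 560764615106144, 134277013854144)
  let w : Z3 := (183106561495191, 122069720790112, 39876111207232)
  [⟨v, 5, false⟩, ⟨v, 5, true⟩, ⟨v, 4, true⟩, ⟨v, 3, true⟩, ⟨v, 2, true⟩, ⟨v, 1, true⟩] ++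
  rationalCenters.map (fun u => ⟨u, 0, true⟩) ++
  [⟨w, 1, true⟩, ⟨w, 2, true⟩, ⟨w, 3, true⟩, ⟨w, 4, true⟩, ⟨w, 4, false⟩]

/-- The data of the `k`-th pearl. -/
def pearlDatum (k : ℕ) : PearlDatum := pearlData.getD k ⟨(0, 0, 1), 0, true⟩

/-- A lower bound for `10 ^ 9 * (2 - √3) ^ e`. -/
def powLower (e : ℕ) : ℤ :=
  [1000000000, 267949192, 71796769, 19237886, 5154776, 1381218].getD e 0

/-- An upper bound for `10 ^ 9 * (2 - √3) ^ e`. -/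
def powUpper (e : ℕ) : ℤ :=
  [1000000000, 267949193, 71796770, 19237887, 5154777, 1381219].getD e 0

theorem two_sub_sqrt_three_pos : 0 < 2 - Real.sqrt 3 := by
  have h : Real.sqrt 3 < 2 := by
    rw [Real.sqrt_lt' (by norm_num)]
    norm_num
  linarith

theorem powLower_le_and_le_powUpper {e : ℕ} (he : e ≤ 5) :
    (powLower e : ℝ) ≤ 10 ^ 9 * (2 - Real.sqrt 3) ^ e ∧
      10 ^ 9 * (2 - Real.sqrt 3) ^ e ≤ (powUpper e : ℝ) := by
  have h3 := sqrt_three_sq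
  have hlo : 1.73205080756887 < Real.sqrt 3 := by
    rw [Real.lt_sqrt (by norm_num)]
    norm_num
  have hhi : Real.sqrt 3 < 1.73205080756888 := by
    rw [Real.sqrt_lt' (by norm_num)]
    norm_num
  generalize Real.sqrt 3 = q at *
  interval_cases e
  · norm_num [powLower, powUpper]
  · norm_num [powLower, powUpper]
    constructor <;> linarith
  · rw [show (2 - q) ^ 2 = 7 - 4 * q by linear_combination h3]
    norm_num [powLower, powUpper]
    constructor <;> linarith
  · rw [show (2 - q) ^ 3 = 26 - 15 * q by linear_combination (6 - q) * h3]
    norm_num [powLower, powUpper]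
    constructor <;> linarith
  · rw [show (2 - q) ^ 4 = 97 - 56 * q by linear_combination (q ^ 2 - 8 * q + 27) * h3]
    norm_num [powLower, powUpper]
    constructor <;> linarith
  · rw [show (2 - q) ^ 5 = 362 - 209 * q by
      linear_combination (-q ^ 3 + 10 * q ^ 2 - 43 * q + 110) * h3]
    norm_num [powLower, powUpper]
    constructor <;> linarith

theorem denom_pos : (0 : ℝ) < denom := by
  norm_num [denom]

namespace PearlDatum

/-- A lower bound for `10 ^ 9 * denom * reach`. -/
def reachLower (d : PearlDatum) : ℤ := d.point.2.2 * powLower d.exponent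

/-- An upper bound for `10 ^ 9 * denom * reach`. -/
def reachUpper (d : PearlDatum) : ℤ := d.point.2.2 * powUpper d.exponent

/-- A lower bound for `10 ^ 9 * denom * height`. -/
def heightLower (d : PearlDatum) : ℤ := if d.isInner then d.reachLower else 0

/-- An upper bound for `10 ^ 9 * denom * height`. -/
def heightUpper (d : PearlDatum) : ℤ := if d.isInner then d.reachUpper else 0

/-- The basic requirements on the data. -/
def isValid (d : PearlDatum) : Bool := 0 < d.point.2.2 && decide (d.exponent ≤ 5)

theorem reach_bounds {d : PearlDatum} (hd : d.isValid) :
    (d.reachLower : ℝ) ≤ 10 ^ 9 * denom * d.reach ∧ 10 ^ 9 * denom * d.reach ≤ d.reachUpper := by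
  simp only [isValid, Bool.and_eq_true, decide_eq_true_eq] at hd
  have h := powLower_le_and_le_powUpper hd.2
  have hz : (0 : ℝ) ≤ (d.point.2.2 : ℝ) := by exact_mod_cast hd.1.le
  have e : 10 ^ 9 * denom * d.reach = d.point.2.2 * (10 ^ 9 * (2 - Real.sqrt 3) ^ d.exponent) := by
    rw [reach]
    have := denom_pos
    field_simp
  rw [e, reachLower, reachUpper]
  push_cast
  exact ⟨mul_le_mul_of_nonneg_left h.1 hz, mul_le_mul_of_nonneg_left h.2 hz⟩

theorem reach_pos {d : PearlDatum} (hd : d.isValid) : 0 < d.reach := by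
  simp only [isValid, Bool.and_eq_true, decide_eq_true_eq] at hd
  have hz : (0 : ℝ) < (d.point.2.2 : ℝ) := by exact_mod_cast hd.1
  exact mul_pos (div_pos hz denom_pos) (pow_pos two_sub_sqrt_three_pos _)

theorem radius_pos {d : PearlDatum} (hd : d.isValid) : 0 < d.radius :=
  div_pos (reach_pos hd) (Real.sqrt_pos.2 (by norm_num))

theorem two_mul_radius_sq (d : PearlDatum) : 2 * d.radius ^ 2 = d.reach ^ 2 := by
  rw [radius, div_pow, Real.sq_sqrt (by norm_num)]
  ring

/-- The test that two solid pearls are disjoint: it bounds twice the squared distance of the centers from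
below and twice the squared sum of the radii from above. -/
def isFar (a b : PearlDatum) : Bool :=
  (a.reachUpper + b.reachUpper) ^ 2 + 4 * (a.heightUpper * b.heightUpper) <
    2 * 10 ^ 18 * ((a.point.1 - b.point.1) ^ 2 + (a.point.2.1 - b.point.2.1) ^ 2) +
      2 * (a.heightLower ^ 2 + b.heightLower ^ 2)

theorem radius_add_lt_dist {a b : PearlDatum} (ha : a.isValid) (hb : b.isValid) (h : isFar a b) :
    a.radius + b.radius < dist a.center b.center := by
  have hM : (0 : ℝ) < 10 ^ 9 * denom := mul_pos (by norm_num) denom_pos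
  have hheight : ∀ d : PearlDatum, d.isValid → 0 ≤ (d.heightLower : ℝ) ∧
      (d.heightLower : ℝ) ≤ 10 ^ 9 * denom * d.height ∧
      10 ^ 9 * denom * d.height ≤ d.heightUpper := by
    intro d hd
    have h1 := reach_bounds hd
    have h2 : 0 ≤ d.reachLower := by
      simp only [isValid, Bool.and_eq_true, decide_eq_true_eq] at hd
      obtain ⟨hz, he⟩ := hd
      refine mul_nonneg hz.le ?_
      generalize d.exponent = e at he
      interval_cases e <;> simp [powLower]
    have h3 : (0 : ℝ) ≤ d.reachLower := by exact_mod_cast h2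
    rw [heightLower, height, heightUpper]
    split_ifs
    · exact ⟨h3, h1⟩
    · simp
  obtain ⟨a1, a2, a3⟩ := hheight a ha
  obtain ⟨b1, b2, b3⟩ := hheight b hb
  have ra := (reach_bounds ha).2
  have rb := (reach_bounds hb).2
  have pa := reach_pos ha
  have pb := reach_pos hb
  have hI : ((a.reachUpper : ℝ) + b.reachUpper) ^ 2 + 4 * (a.heightUpper * b.heightUpper) <
    2 * 10 ^ 18 * ((a.point.1 - b.point.1) ^ 2 + (a.point.2.1 - b.point.2.1) ^ 2) +
      2 * (a.heightLower ^ 2 + b.heightLower ^ 2) := by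
    have := of_decide_eq_true h
    exact_mod_cast this
  rw [← sq_lt_sq₀ (add_nonneg (radius_pos ha).le (radius_pos hb).le) dist_nonneg, E3.dist_sq]
  have hs : a.radius + b.radius = (a.reach + b.reach) / Real.sqrt 2 := by
    rw [radius, radius, add_div]
  rw [hs, div_pow, Real.sq_sqrt (by norm_num)]
  simp only [center, Matrix.cons_val]
  have e1 : (10 ^ 9 * denom * a.reach + 10 ^ 9 * denom * b.reach) ^ 2 ≤
      ((a.reachUpper : ℝ) + b.reachUpper) ^ 2 :=
    pow_le_pow_left₀ (by positivity) (add_le_add ra rb) 2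
  have e2 : (10 ^ 9 * denom * a.height) * (10 ^ 9 * denom * b.height) ≤
      (a.heightUpper : ℝ) * b.heightUpper :=
    mul_le_mul a3 b3 (b1.trans b2) ((a1.trans a2).trans a3)
  have e3 := pow_le_pow_left₀ a1 a2 2
  have e4 := pow_le_pow_left₀ b1 b2 2
  have e5 : ∀ x y : ℤ, (10 ^ 9 * denom : ℝ) ^ 2 * ((x : ℝ) / denom - y / denom) ^ 2 =
      10 ^ 18 * ((x : ℝ) - y) ^ 2 := by
    intro x y
    have := denom_pos
    field_simp
  have key : (10 ^ 9 * denom : ℝ) ^ 2 * ((a.reach + b.reach) ^ 2 / 2) < (10 ^ 9 * denom : ℝ) ^ 2 *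
      (((a.point.1 : ℝ) / denom - b.point.1 / denom) ^ 2 +
        ((a.point.2.1 : ℝ) / denom - b.point.2.1 / denom) ^ 2 + (a.height - b.height) ^ 2) := by
    rw [mul_add _ (_ + _), mul_add, e5, e5]
    generalize (10 ^ 9 * denom : ℝ) = M at *
    nlinarith only [e1, e2, e3, e4, hI]
  exact lt_of_mul_lt_mul_left key (sq_nonneg _)

end PearlDatum

open PearlDatum in
/-- The test that non-consecutive pearls of a list are disjoint. -/
def areFar : List PearlDatum → Bool
  | a :: b :: l => l.all (isFar a) && areFar (b :: l)
  | _ => true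

open PearlDatum in
theorem isFar_of_areFar {L : List PearlDatum} (h : areFar L) (d : PearlDatum) {j k : ℕ}
    (hjk : j + 1 < k) (hk : k < L.length) : isFar (L.getD j d) (L.getD k d) := by
  induction L generalizing j k with
  | nil => simp at hk
  | cons a L ih =>
    cases L with
    | nil => simp at hk; omega
    | cons b L =>
      rw [areFar, Bool.and_eq_true, List.all_eq_true] at h
      obtain ⟨k, rfl⟩ : ∃ k', k = k' + 1 := ⟨k - 1, by omega⟩
      cases j with
      | zero =>
        obtain ⟨k, rfl⟩ : ∃ k', k = k' + 1 := ⟨k - 1, by omega⟩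
        simp only [List.length_cons] at hk
        simp only [List.getD_cons_zero, List.getD_cons_succ]
        rw [List.getD_eq_getElem _ _ (by omega)]
        exact h.1 _ (List.getElem_mem _)
      | succ j =>
        simp only [List.getD_cons_succ]
        simp only [List.length_cons] at hk
        exact ih h.2 (by omega) (by simp only [List.length_cons]; omega)

theorem areFar_pearlData : areFar pearlData = true := by decide +kernel

theorem pearlData_length : pearlData.length = 87 := by decide +kernel

theorem isValid_pearlDatum {k : ℕ} (hk : k < 87) : (pearlDatum k).isValid := by
  have h : ∀ k < 87, (pearlDatum k).isValid := by decide +kernel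
  exact h k hk

namespace PearlDatum

/-- The test that two pearls are orthogonal: either they lie on a vertical line, and one of them is
centered on the boundary plane or the quotient of their heights is `2 - √3`, or they are rational. -/
def isOrthogonal (a b : PearlDatum) : Bool :=
  (a.point == b.point && ((a.isInner ^^ b.isInner) && a.exponent == b.exponent ||
    a.isInner && b.isInner &&
      (a.exponent == b.exponent + 1 || b.exponent == a.exponent + 1))) ||
  (a.isInner && b.isInner && a.exponent == 0 && b.exponent == 0 &&
    2 * ((a.point.1 - b.point.1) ^ 2 + (a.point.2.1 - b.point.2.1) ^ 2) + a.point.2.2 ^ 2 +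
      b.point.2.2 ^ 2 == 4 * (a.point.2.2 * b.point.2.2))

theorem dist_center_sq (a b : PearlDatum) : dist a.center b.center ^ 2 =
    ((a.point.1 : ℝ) / denom - b.point.1 / denom) ^ 2 +
      ((a.point.2.1 : ℝ) / denom - b.point.2.1 / denom) ^ 2 + (a.height - b.height) ^ 2 :=
  E3.dist_sq _ _

theorem dist_sq_of_exponent_succ {a b : PearlDatum} (hp : a.point = b.point) (ha : a.isInner = true)
    (hb : b.isInner = true) (he : a.exponent = b.exponent + 1) :
    dist a.center b.center ^ 2 = a.radius ^ 2 + b.radius ^ 2 := by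
  have h1 := two_mul_radius_sq a
  have h2 := two_mul_radius_sq b
  have h3 : a.reach = (2 - Real.sqrt 3) * b.reach := by
    rw [reach, reach, hp, he, pow_succ]
    ring
  rw [h3] at h1
  rw [dist_center_sq, hp, height, height, if_pos ha, if_pos hb, h3]
  have := sqrt_three_sq
  linear_combination -h1 / 2 - h2 / 2 + b.reach ^ 2 / 2 * this

theorem dist_sq_of_isOrthogonal {a b : PearlDatum} (h : isOrthogonal a b) :
    dist a.center b.center ^ 2 = a.radius ^ 2 + b.radius ^ 2 := by
  simp only [isOrthogonal, Bool.or_eq_true, Bool.and_eq_true, beq_iff_eq] at h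
  have h1 := two_mul_radius_sq a
  have h2 := two_mul_radius_sq b
  rcases h with ⟨hp, ⟨hi, he⟩ | ⟨⟨ha, hb⟩, he | he⟩⟩ | ⟨⟨⟨⟨ha, hb⟩, ea⟩, eb⟩, he⟩
  · have h3 : a.reach = b.reach := by rw [reach, reach, hp, he]
    rw [dist_center_sq, hp, height, height]
    rw [h3] at h1 ⊢
    rcases ha : a.isInner <;> rcases hb : b.isInner <;> simp [ha, hb] at hi ⊢ <;> linarith
  · exact dist_sq_of_exponent_succ hp ha hb he
  · rw [dist_comm, add_comm]
    exact dist_sq_of_exponent_succ hp.symm hb ha he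
  · rw [dist_center_sq, height, height, if_pos ha, if_pos hb]
    rw [reach, ea, pow_zero, mul_one] at h1 ⊢
    rw [reach, eb, pow_zero, mul_one] at h2 ⊢
    have he' : 2 * (((a.point.1 : ℝ) - b.point.1) ^ 2 + ((a.point.2.1 : ℝ) - b.point.2.1) ^ 2) +
        (a.point.2.2 : ℝ) ^ 2 + (b.point.2.2 : ℝ) ^ 2 = 4 * (a.point.2.2 * b.point.2.2) := by
      exact_mod_cast he
    have hd := denom_pos.ne'
    generalize (denom : ℝ) = D at *
    have h3 : a.radius ^ 2 + b.radius ^ 2 =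
        ((a.point.2.2 / D) ^ 2 + (b.point.2.2 / D) ^ 2 : ℝ) / 2 := by linarith
    rw [h3]
    field_simp
    linear_combination he'

end PearlDatum

open PearlDatum

/-- The vertices of the polygonal arc. -/
noncomputable def pearlCenter (k : ℕ) : E3 := (pearlDatum k).center

/-- The radii of the pearls. -/
noncomputable def pearlRadius (k : ℕ) : ℝ := (pearlDatum k).radius

theorem isInner_pearlDatum {k : ℕ} (hk : 1 ≤ k) (hk' : k < 86) : (pearlDatum k).isInner = true := by
  have h : ∀ k < 86, 1 ≤ k → (pearlDatum k).isInner = true := by decide +kernel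
  exact h k hk' hk

theorem pearlCenter_apply_two {k : ℕ} (hk : 1 ≤ k) (hk' : k < 86) :
    pearlCenter k 2 = (pearlDatum k).reach := by
  change (pearlDatum k).height = _
  rw [height, if_pos (isInner_pearlDatum hk hk')]

theorem pearlCenter_of_point_eq {j k : ℕ} (hp : (pearlDatum j).point = (pearlDatum k).point)
    (hj : (pearlDatum j).isInner = false) :
    pearlCenter j = !₂[pearlCenter k 0, pearlCenter k 1, 0] := by
  rw [pearlCenter, pearlCenter, PearlDatum.center, hp, height, hj]
  rfl

theorem isPearlChain_pearlCenter : IsPearlChain 86 pearlCenter pearlRadius where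
  one_lt := by norm_num
  radius_pos k hk := radius_pos (isValid_pearlDatum (by omega))
  orthogonal k hk := by
    have h : ∀ k < 86, isOrthogonal (pearlDatum k) (pearlDatum (k + 1)) := by decide +kernel
    exact dist_sq_of_isOrthogonal (h k hk)
  disjoint j k hjk hk := radius_add_lt_dist (isValid_pearlDatum (by omega))
    (isValid_pearlDatum (by omega))
    (isFar_of_areFar areFar_pearlData _ hjk (by rw [pearlData_length]; omega))
  height_pos k hk hk' := by
    rw [pearlCenter_apply_two hk hk']
    exact reach_pos (isValid_pearlDatum (by omega))
  radius_sq k hk hk' := by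
    rw [pearlCenter_apply_two hk hk']
    exact two_mul_radius_sq _
  first_eq := pearlCenter_of_point_eq (by decide +kernel) (by decide +kernel)
  last_eq := pearlCenter_of_point_eq (by decide +kernel) (by decide +kernel)

/-! ### Algebraicity and the decimal table -/

theorem isAlgebraic_sqrt (n : ℕ) : IsAlgebraic ℚ (Real.sqrt n) := by
  refine IsAlgebraic.of_pow (n := 2) (by norm_num) ?_
  rw [Real.sq_sqrt (Nat.cast_nonneg n)]
  exact isAlgebraic_natCast n

theorem isAlgebraic_reach (d : PearlDatum) : IsAlgebraic ℚ d.reach := by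
  have h2 : IsAlgebraic ℚ (2 - Real.sqrt 3) := by
    exact_mod_cast (isAlgebraic_natCast (R := ℚ) (A := ℝ) 2).sub (isAlgebraic_sqrt 3)
  have hq : IsAlgebraic ℚ ((d.point.2.2 : ℝ) / denom) := by
    rw [div_eq_mul_inv]
    exact (isAlgebraic_intCast _).mul (isAlgebraic_intCast _).inv
  exact hq.mul (h2.pow _)

theorem isAlgebraic_pearlCenter (k : ℕ) (j : Fin 3) : IsAlgebraic ℚ (pearlCenter k j) := by
  have hq : ∀ n : ℤ, IsAlgebraic ℚ ((n : ℝ) / denom) := fun n => by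
    rw [div_eq_mul_inv]
    exact (isAlgebraic_intCast _).mul (isAlgebraic_intCast _).inv
  fin_cases j
  · exact hq _
  · exact hq _
  · change IsAlgebraic ℚ (height _)
    rw [height]
    split_ifs
    · exact isAlgebraic_reach _
    · exact isAlgebraic_zero

theorem isAlgebraic_pearlRadius (k : ℕ) : IsAlgebraic ℚ (pearlRadius k) := by
  rw [pearlRadius, radius, div_eq_mul_inv]
  exact (isAlgebraic_reach _).mul (by exact_mod_cast (isAlgebraic_sqrt 2).inv)

/-- The test that a pearl agrees with an entry of the decimal table up to rounding. -/
def PearlDatum.matchesEntry (d : PearlDatum) (e : ℚ × ℚ × ℚ × ℚ) : Prop :=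
  (|(d.point.1 : ℚ) / denom - e.1| ≤ 1 / 100 ∧ |(d.point.2.1 : ℚ) / denom - e.2.1| ≤ 1 / 100) ∧
  (e.2.2.1 - 1 / 100 ≤ d.reachLower / (10 ^ 9 * denom) ∧
    d.reachUpper / (10 ^ 9 * denom) ≤ e.2.2.1 + 1 / 100) ∧
  (e.2.2.2 - 1 / 100 ≤ d.reachLower / (10 ^ 9 * denom) * (7071067 / 10000000) ∧
    d.reachUpper / (10 ^ 9 * denom) * (7071068 / 10000000) ≤ e.2.2.2 + 1 / 100)

instance (d : PearlDatum) (e : ℚ × ℚ × ℚ × ℚ) : Decidable (d.matchesEntry e) := by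
  unfold PearlDatum.matchesEntry
  infer_instance

theorem matchesEntry_pearlDatum : ∀ k < 85, ∀ e ∈ pearlTable[k]?,
    (pearlDatum (k + 1)).matchesEntry e := by
  decide +kernel

theorem pearl_matches_table {k : ℕ} {x y z r : ℚ} (h : pearlTable[k]? = some (x, y, z, r)) :
    |pearlCenter (k + 1) 0 - (x : ℝ)| ≤ 1 / 100 ∧ |pearlCenter (k + 1) 1 - (y : ℝ)| ≤ 1 / 100 ∧
      |pearlCenter (k + 1) 2 - (z : ℝ)| ≤ 1 / 100 ∧ |pearlRadius (k + 1) - (r : ℝ)| ≤ 1 / 100 := by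
  have hk : k < 85 := by
    rw [← pearlTable_length]
    exact (List.getElem?_eq_some_iff.1 h).1
  obtain ⟨⟨hx, hy⟩, ⟨hz1, hz2⟩, hr1, hr2⟩ := matchesEntry_pearlDatum k hk _ h
  rw [← Rat.cast_le (K := ℝ)] at hx hy hz1 hz2 hr1 hr2
  push_cast at hx hy hz1 hz2 hr1 hr2
  have hb := reach_bounds (isValid_pearlDatum (show k + 1 < 87 by omega))
  have hpos := reach_pos (isValid_pearlDatum (show k + 1 < 87 by omega))
  have h2 := pearlCenter_apply_two (show 1 ≤ k + 1 by omega) (by omega)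
  rw [h2, pearlRadius, PearlDatum.radius]
  generalize hd : pearlDatum (k + 1) = d at *
  have hM : (0 : ℝ) < 10 ^ 9 * denom := mul_pos (by norm_num) denom_pos
  have hb1 : (d.reachLower : ℝ) / (10 ^ 9 * denom) ≤ d.reach := (div_le_iff₀' hM).2 hb.1
  have hb2 : d.reach ≤ (d.reachUpper : ℝ) / (10 ^ 9 * denom) := (le_div_iff₀' hM).2 hb.2
  have hs0 : 0 < Real.sqrt 2 := Real.sqrt_pos.2 (by norm_num)
  have hs1 : 7071067 / 10000000 ≤ (Real.sqrt 2)⁻¹ := by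
    rw [← Real.sqrt_inv]
    exact Real.le_sqrt_of_sq_le (by norm_num)
  have hs2 : (Real.sqrt 2)⁻¹ ≤ 7071068 / 10000000 := by
    rw [← Real.sqrt_inv, Real.sqrt_le_left (by norm_num)]
    norm_num
  have e0 : pearlCenter (k + 1) 0 = (d.point.1 : ℝ) / denom := by rw [pearlCenter, hd]; rfl
  have e1 : pearlCenter (k + 1) 1 = (d.point.2.1 : ℝ) / denom := by rw [pearlCenter, hd]; rfl
  rw [e0, e1, div_eq_mul_inv d.reach]
  refine ⟨hx, hy, abs_le.2 ⟨by linarith, by linarith⟩, abs_le.2 ⟨?_, ?_⟩⟩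
  · have := mul_le_mul hb1 hs1 (by norm_num) hpos.le
    linarith
  · have := mul_le_mul hb2 hs2 (inv_nonneg.2 hs0.le) (hpos.le.trans hb2)
    linarith

theorem pearlDatum_long : pearlDatum 76 = ⟨(881822021484375, -24414062500000, 244140625000000), 0, true⟩ ∧
    pearlDatum 77 = ⟨(637681396484375, -24414062500000, 244140625000000), 0, true⟩ ∧
    pearlDatum 78 = ⟨(393540771484375, -24414062500000, 244140625000000), 0, true⟩ := by
  refine ⟨?_, ?_, ?_⟩ <;> rfl

theorem pearlCenter_long : pearlCenter 76 = !₂[3611.943, -100, 1000] ∧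
    pearlCenter 77 = !₂[2611.943, -100, 1000] ∧ pearlCenter 78 = !₂[1611.943, -100, 1000] := by
  obtain ⟨h1, h2, h3⟩ := pearlDatum_long
  rw [pearlCenter, pearlCenter, pearlCenter, h1, h2, h3]
  refine ⟨?_, ?_, ?_⟩ <;>
  · ext i
    fin_cases i <;> norm_num [PearlDatum.center, height, reach, denom]

theorem pearlRadius_long {k : ℕ} (hk : 76 ≤ k) (hk' : k ≤ 78) : pearlRadius k = 1000 / Real.sqrt 2 := by
  obtain ⟨h1, h2, h3⟩ := pearlDatum_long
  interval_cases k
  · norm_num [pearlRadius, h1, PearlDatum.radius, reach, denom]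
  · norm_num [pearlRadius, h2, PearlDatum.radius, reach, denom]
  · norm_num [pearlRadius, h3, PearlDatum.radius, reach, denom]

/-! ### The polygonal arc is a trefoil arc -/

theorem polygonalArc_succ (v : ℕ → E3) (n : ℕ) :
    polygonalArc v (n + 1) = polygonalArc v n ∪ segment ℝ (v n) (v (n + 1)) := by
  rw [polygonalArc, polygonalArc, Finset.range_add_one, Finset.set_biUnion_insert, union_comm]

theorem polygonalPath_map_range (u : ℕ → Z3) (n : ℕ) :
    polygonalPath ((List.range (n + 1)).map u) = polygonalArc (fun k => (u k).toE) n := by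
  induction n with
  | zero => simp [polygonalPath, polygonalArc]
  | succ n ih =>
    have h := polygonalPath_append ((List.range n).map u) (u n) (u (n + 1))
    rw [polygonalArc_succ, ← ih, List.range_succ, List.range_succ]
    simpa using h

/-- Subdividing an edge does not change a polygonal line. -/
theorem segment_union_segment {a b c : E3} (h : b ∈ segment ℝ a c) :
    segment ℝ a b ∪ segment ℝ b c = segment ℝ a c := by
  apply Subset.antisymm
  · exact union_subset ((convex_segment a c).segment_subset (left_mem_segment ℝ a c) h)
      ((convex_segment a c).segment_subset h (right_mem_segment ℝ a c))
  · intro x hx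
    rw [segment_eq_image'] at hx h
    obtain ⟨s, hs, rfl⟩ := h
    obtain ⟨t, ht, rfl⟩ := hx
    rcases le_total t s with hts | hts
    · left
      rcases hs.1.eq_or_lt with h0 | h0
      · have : t = 0 := le_antisymm (h0 ▸ hts) ht.1
        rw [this]
        beta_reduce
        rw [zero_smul, add_zero]
        exact left_mem_segment ℝ _ _
      · rw [segment_eq_image']
        refine ⟨t / s, ⟨div_nonneg ht.1 h0.le, (div_le_one h0).2 hts⟩, ?_⟩
        beta_reduce
        rw [add_sub_cancel_left, smul_smul, div_mul_cancel₀ _ h0.ne']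
    · right
      rcases hs.2.eq_or_lt with h1 | h1
      · have : t = 1 := le_antisymm ht.2 (h1 ▸ hts)
        rw [this, h1]
        exact left_mem_segment ℝ _ _
      · have h2 : 0 < 1 - s := by linarith
        rw [segment_eq_image']
        refine ⟨(t - s) / (1 - s), ⟨div_nonneg (by linarith) h2.le,
          (div_le_one h2).2 (by linarith [ht.2])⟩, ?_⟩
        beta_reduce
        rw [show c - (a + s • (c - a)) = (1 - s) • (c - a) by module, smul_smul,
          div_mul_cancel₀ _ h2.ne']
        module

theorem mem_segment_of_height {a b c : E3} (h0 : b 0 = a 0 ∧ c 0 = a 0) (h1 : b 1 = a 1 ∧ c 1 = a 1)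
    (hab : a 2 ≤ b 2) (hbc : b 2 < c 2) : b ∈ segment ℝ a c := by
  rw [segment_eq_image']
  have h : 0 < c 2 - a 2 := by linarith
  refine ⟨(b 2 - a 2) / (c 2 - a 2), ⟨div_nonneg (by linarith) h.le,
    (div_le_one h).2 (by linarith)⟩, ?_⟩
  ext i
  fin_cases i
  · simp [h0.1, h0.2]
  · simp [h1.1, h1.2]
  · change a 2 + (b 2 - a 2) / (c 2 - a 2) * (c 2 - a 2) = b 2
    rw [div_mul_cancel₀ _ h.ne']
    ring

theorem two_sub_sqrt_three_lt_one : 2 - Real.sqrt 3 < 1 := by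
  have h : 1 < Real.sqrt 3 := by
    rw [Real.lt_sqrt (by norm_num)]
    norm_num
  linarith

theorem height_lt_of_exponent {a b : PearlDatum} (hb : b.isInner = true) (hv : b.isValid)
    (hp : a.point = b.point) (h : a.isInner = false ∨ b.exponent < a.exponent) :
    a.height < b.height := by
  rw [height, height, if_pos hb]
  have hpos := reach_pos hv
  split_ifs with ha
  · have he : b.exponent < a.exponent := by
      rcases h with h | h
      · rw [ha] at h; cases h
      · exact h
    rw [reach, reach, hp]
    simp only [isValid, Bool.and_eq_true, decide_eq_true_eq] at hv
    have hz : (0 : ℝ) < (b.point.2.2 : ℝ) := by exact_mod_cast hv.1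
    exact mul_lt_mul_of_pos_left (pow_lt_pow_right_of_lt_one₀ two_sub_sqrt_three_pos
      two_sub_sqrt_three_lt_one he) (div_pos hz denom_pos)
  · exact hpos

/-- The test that the second of three pearls lies on the vertical segment from the first, lower one up to
the third one. -/
def PearlDatum.isBelow (a b : PearlDatum) : Bool :=
  b.isInner && a.point == b.point && (!a.isInner || decide (b.exponent < a.exponent))

theorem mem_segment_of_isBelow {a b d : PearlDatum} (hb : b.isValid) (hd : d.isValid)
    (hab : a.isBelow b) (hbd : b.isBelow d) : b.center ∈ segment ℝ a.center d.center := by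
  simp only [PearlDatum.isBelow, Bool.and_eq_true, Bool.or_eq_true, Bool.not_eq_true', beq_iff_eq,
    decide_eq_true_eq] at hab hbd
  refine mem_segment_of_height ?_ ?_ (height_lt_of_exponent hab.1.1 hb hab.1.2 hab.2).le
    (height_lt_of_exponent hbd.1.1 hd hbd.1.2 hbd.2)
  · constructor
    · change (b.point.1 : ℝ) / denom = a.point.1 / denom
      rw [hab.1.2]
    · change (d.point.1 : ℝ) / denom = a.point.1 / denom
      rw [hab.1.2, hbd.1.2]
  · constructor
    · change (b.point.2.1 : ℝ) / denom = a.point.2.1 / denom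
      rw [hab.1.2]
    · change (d.point.2.1 : ℝ) / denom = a.point.2.1 / denom
      rw [hab.1.2, hbd.1.2]

theorem polygonalArc_first {n : ℕ} (hn : n ≤ 5) :
    polygonalArc pearlCenter (n + 1) = segment ℝ (pearlCenter 0) (pearlCenter (n + 1)) := by
  induction n with
  | zero => simp [polygonalArc]
  | succ n ih =>
    rw [polygonalArc_succ, ih (by omega)]
    have h : ∀ n < 5, (pearlDatum 0).isBelow (pearlDatum (n + 1)) ∧
      (pearlDatum (n + 1)).isBelow (pearlDatum (n + 2)) := by decide +kernel
    exact segment_union_segment (mem_segment_of_isBelow (isValid_pearlDatum (by omega))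
      (isValid_pearlDatum (by omega)) (h n (by omega)).1 (h n (by omega)).2)

theorem polygonalArc_last {n : ℕ} (hn : n ≤ 4) : polygonalArc pearlCenter (81 + (n + 1)) =
    polygonalArc pearlCenter 81 ∪ segment ℝ (pearlCenter 81) (pearlCenter (81 + (n + 1))) := by
  induction n with
  | zero => exact polygonalArc_succ _ _
  | succ n ih =>
    rw [← add_assoc, polygonalArc_succ, ih (by omega), union_assoc]
    have h : ∀ n < 4, (pearlDatum (81 + (n + 1) + 1)).isBelow (pearlDatum (81 + (n + 1))) ∧
      (pearlDatum (81 + (n + 1))).isBelow (pearlDatum 81) := by decide +kernel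
    congr 1
    refine segment_union_segment ?_
    rw [segment_symm]
    exact mem_segment_of_isBelow (isValid_pearlDatum (by omega))
      (isValid_pearlDatum (by omega)) (h n (by omega)).1 (h n (by omega)).2

/-- The vertices of `necklacePolygon`, enumerated by the natural numbers. -/
def necklaceVertex (k : ℕ) : Z3 := necklacePolygon.getD k (592302077680855, 560764615106144, 0)

theorem pearlCenter_eq_smul {k : ℕ} {d : PearlDatum} (hd : pearlDatum k = d) {v : Z3}
    (h : (d.exponent = 0 ∧ d.isInner = true ∧ d.point = v) ∨
      (d.isInner = false ∧ d.point.1 = v.1 ∧ d.point.2.1 = v.2.1 ∧ v.2.2 = 0)) :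
    pearlCenter k = (denom : ℝ)⁻¹ • v.toE := by
  have hD := denom_pos.ne'
  rw [pearlCenter, hd]
  rcases h with ⟨h1, h2, rfl⟩ | ⟨h1, h2, h3, h4⟩
  · ext i
    fin_cases i <;> simp [PearlDatum.center, height, reach, h1, h2, Z3.toE] <;> field_simp
  · ext i
    fin_cases i <;> simp [PearlDatum.center, height, h1, h2, h3, h4, Z3.toE] <;> field_simp

theorem smul_necklaceVertex : (denom : ℝ)⁻¹ • (necklaceVertex 0).toE = pearlCenter 0 ∧
    (∀ k < 76, (denom : ℝ)⁻¹ • (necklaceVertex (1 + k)).toE = pearlCenter (6 + k)) ∧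
    (denom : ℝ)⁻¹ • (necklaceVertex 77).toE = pearlCenter 86 := by
  refine ⟨(pearlCenter_eq_smul rfl (Or.inr ?_)).symm, fun k hk =>
    (pearlCenter_eq_smul rfl (Or.inl ?_)).symm, (pearlCenter_eq_smul rfl (Or.inr ?_)).symm⟩
  · decide +kernel
  · have h : ∀ k < 76, (pearlDatum (6 + k)).exponent = 0 ∧ (pearlDatum (6 + k)).isInner = true ∧
      (pearlDatum (6 + k)).point = necklaceVertex (1 + k) := by decide +kernel
    exact h k hk
  · decide +kernel

/-- The pearls of the two vertical ends contribute no corners, so the arc is that of the 78 vertices of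
`necklacePolygon`. -/
theorem polygonalArc_pearlCenter :
    polygonalArc pearlCenter 86 = polygonalArc (fun k => (denom : ℝ)⁻¹ • (necklaceVertex k).toE) 77 := by
  obtain ⟨h0, h1, h2⟩ := smul_necklaceVertex
  have hmid : ∀ k < 76, polygonalArc pearlCenter (6 + k) =
      polygonalArc (fun k => (denom : ℝ)⁻¹ • (necklaceVertex k).toE) (1 + k) := by
    intro k
    induction k with
    | zero =>
      intro _
      have h3 := h1 0 (by omega)
      rw [add_zero] at h3
      rw [add_zero, add_zero, polygonalArc_succ _ 0, h3, h0]
      rw [show (6 : ℕ) = 5 + 1 from rfl, polygonalArc_first le_rfl]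
      simp [polygonalArc]
    | succ k ih =>
      intro hk
      rw [← add_assoc, ← add_assoc, polygonalArc_succ, polygonalArc_succ, ih (by omega),
        h1 k (by omega), add_assoc 1 k 1, h1 (k + 1) hk, add_assoc]
  have h3 := h1 75 (by omega)
  rw [show (77 : ℕ) = 76 + 1 from rfl, polygonalArc_succ _ 76, show (86 : ℕ) = 81 + (4 + 1) from rfl,
    polygonalArc_last le_rfl, h2, show (76 : ℕ) = 1 + 75 from rfl, h3, ← hmid 75 (by omega)]

theorem closedPolygon_necklacePolygon : closedPolygon necklacePolygon =
    polygonalArc (fun k => (necklaceVertex k).toE) 77 ∪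
      segment ℝ (necklaceVertex 0).toE (necklaceVertex 77).toE := by
  have h : closedPolygon necklacePolygon =
      polygonalPath ((List.range 77).map necklaceVertex ++ [necklaceVertex 77, necklaceVertex 0]) := by
    have h1 : necklacePolygon ++ [necklaceVertex 0] =
        (List.range 77).map necklaceVertex ++ [necklaceVertex 77, necklaceVertex 0] := by
      decide +kernel
    rw [← h1]
    rfl
  rw [h, polygonalPath_append, ← polygonalPath_map_range, segment_symm, List.range_succ,
    List.map_append]
  rfl

theorem isTrefoilArc_polygonalArc :
    IsTrefoilArc (polygonalArc pearlCenter 86) (pearlCenter 0) (pearlCenter 86) := by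
  obtain ⟨h, hh⟩ := ambientEquiv_standardTrefoil_necklacePolygon
  obtain ⟨h0, -, h2⟩ := smul_necklaceVertex
  have hD : (denom : ℝ)⁻¹ ≠ 0 := inv_ne_zero denom_pos.ne'
  set σ : E3 ≃ₜ E3 := Homeomorph.smulOfNeZero _ hD with hσ
  have hseg : ∀ a b : E3, σ '' segment ℝ a b = segment ℝ (σ a) (σ b) := fun a b =>
    image_segment ℝ ((LinearMap.lsmul ℝ E3 (denom : ℝ)⁻¹).toAffineMap) a b
  refine ⟨h.trans σ, ?_⟩
  have himg : ⇑(h.trans σ) '' standardTrefoil = σ '' (h '' standardTrefoil) := by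
    rw [image_image]
    rfl
  rw [himg, hh, closedPolygon_necklacePolygon, image_union, hseg, polygonalArc_pearlCenter, ← h0, ← h2]
  congr 1
  simp only [polygonalArc, image_iUnion, hseg]
  rfl

theorem mainTheorem8 :
    ∃ (c : ℕ → E3) (S : ℕ → Pearl) (P : ℕ → ZMod 6 → Pearl),
      -- the pearls are centered at the points `c k` of the half-space
      (∀ k ≤ 86, (S k).center = toFour (c k)) ∧
      -- centers and radii are algebraic over the rationals
      (∀ k ≤ 86, (∀ j, IsAlgebraic ℚ (c k j)) ∧ IsAlgebraic ℚ (S k).radius) ∧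
      -- the pearls `1, …, 85` are those of the decimal table, up to its rounding
      (∀ (k : ℕ) (x y z r : ℚ), pearlTable[k]? = some (x, y, z, r) →
        |c (k + 1) 0 - (x : ℝ)| ≤ 1 / 100 ∧ |c (k + 1) 1 - (y : ℝ)| ≤ 1 / 100 ∧
        |c (k + 1) 2 - (z : ℝ)| ≤ 1 / 100 ∧ |(S (k + 1)).radius - (r : ℝ)| ≤ 1 / 100) ∧
      -- the pearls `76, 77, 78` have exactly the tabulated centers and the radius `1000 / √2`
      (c 76 = !₂[3611.943, -100, 1000] ∧ c 77 = !₂[2611.943, -100, 1000] ∧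
        c 78 = !₂[1611.943, -100, 1000] ∧
        (∀ k, 76 ≤ k → k ≤ 78 → (S k).radius = 1000 / Real.sqrt 2)) ∧
      -- the end-points of the arc lie below the centers of the first and last tabulated pearls
      (c 0 = !₂[c 1 0, c 1 1, 0] ∧ c 86 = !₂[c 85 0, c 85 1, 0]) ∧
      -- the polygonal arc through the centers
      (IsHalfSpaceArc (polygonalArc c 86) (c 0) (c 86) ∧
        IsTrefoilArc (polygonalArc c 86) (c 0) (c 86) ∧
        IsPearlNecklace (polygonalArc c 86) (c 0) (c 86) 85 S P) ∧
      -- a spinnable (smooth) trefoil arc with the same pearls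
      (∃ A : Set E3, IsSpinnableArc A (c 0) (c 86) ∧ IsTrefoilArc A (c 0) (c 86) ∧
        IsPearlNecklace A (c 0) (c 86) 85 S P) := by
  have hchain := isPearlChain_pearlCenter
  have hpos : ∀ k, 0 < pearlRadius k := by
    intro k
    rcases lt_or_ge k 87 with hk | hk
    · exact radius_pos (isValid_pearlDatum hk)
    · rw [pearlRadius, pearlDatum, List.getD_eq_default _ _ (by rw [pearlData_length]; exact hk)]
      exact radius_pos (by decide)
  set S : ℕ → Pearl := fun k => ⟨toFour (pearlCenter k), pearlRadius k, hpos k⟩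
  obtain ⟨P, hP⟩ := hchain.exists_isPearlNecklace (l := 85) (S := S) (fun _ _ => rfl) (fun _ _ => rfl)
  obtain ⟨δ, hδ⟩ := hchain.exists_isRoundingWidth
  have habs : ∀ _ : ℕ, IsCornerProfile δ fun s => |s| := fun _ => isCornerProfile_abs δ
  have hsm : ∀ _ : ℕ, IsCornerProfile δ (smoothProfile δ) := fun _ =>
    isCornerProfile_smoothProfile hδ.pos
  have hpoly := roundedArc_abs (c := pearlCenter) (m := 86) (by norm_num)
    (fun _ hk => hchain.edgeLength_pos hk)
  have htrefoil := isTrefoilArc_polygonalArc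
  refine ⟨pearlCenter, S, P, fun _ _ => rfl,
    fun k _ => ⟨isAlgebraic_pearlCenter k, isAlgebraic_pearlRadius k⟩,
    fun k x y z r h => pearl_matches_table h,
    ⟨pearlCenter_long.1, pearlCenter_long.2.1, pearlCenter_long.2.2,
      fun k hk hk' => pearlRadius_long hk hk'⟩,
    ⟨hchain.first_eq, hchain.last_eq⟩, ⟨?_, htrefoil, ?_⟩,
    roundedArc pearlCenter 86 fun _ => smoothProfile δ,
    hchain.isSpinnableArc hδ hsm fun _ => contDiff_smoothProfile δ, ?_, hP δ _ hδ hsm⟩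
  · rw [← hpoly]
    exact ⟨_, hchain.parametrizesArc hδ habs⟩
  · rw [← hpoly]
    exact hP δ _ hδ habs
  · have h1 := hchain.ambientEquiv_roundedArc hδ (habs 0) (hsm 0)
    rw [hpoly] at h1
    exact AmbientEquiv.trans htrefoil h1
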